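/- Let $K$ be a finite extension of $\mathbb{Q}_p$ with valuation ring $R_K$, residue field of cardinality $q$ and normalized absolute value $|z|_K=q^{-\mathrm{ord}(z)}$; put $\|z\|_K=\max_i|z_i|_K$ for $z\in K^l$, and let $|dx|$ be the Haar measure on $K^n$ with $R_K^n$ of measure $1$. For a mapping $f$ into $K^l$ and a Schwartz–Bruhat (locally constant, compactly supported) function $\Phi:K^n\to\mathbb{C}$ supported in the domain of $f$, let $$Z_\Phi(s,f)=\int_{K^n}\Phi(x)\,\|f(x)\|_K^s\,|dx|,\qquad \mathrm{Re}(s)>0,$$ and let $Z(s,f)$ be this function for $\Phi$ the characteristic function of $R_K^n$. By a pole of $Z_\Phi(s,f)$ we mean a pole of its meromorphic continuation to $\mathbb{C}$. Let $f=(f_1,\dots,f_l)$ be a $K$-analytic mapping on a neighborhood of the origin of $K^n$, not constant near $0$, with $f(0)=0$ and Taylor expansions $f_i(x)=\sum_m c_{m,i}x^m$ at the origin. Its Newton polyhedron $\Gamma(f)$ is the convex hull of $\bigcup_m (m+\mathbb{R}_{\ge 0}^n)$, where $m$ runs over all exponents with $c_{m,i}\ne 0$ for some $i$. For a (nonempty)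 face $\tau$ of $\Gamma(f)$ put $f_{i,\tau}(x)=\sum_{m\in\tau}c_{m,i}x^m$. The rank condition on $\tau$ says that $\mathrm{rank}_K\left[\frac{\partial f_{i,\tau}}{\partial x_j}(z)\right]=\min\{l,n\}$ at every $z\in(K^\times)^n$ with $f_{1,\tau}(z)=\dots=f_{l,\tau}(z)=0$. The mapping $f$ is strongly non-degenerate at the origin with respect to $\Gamma(f)$ if the rank condition holds on all compact faces $\tau$; a polynomial mapping $f$ is strongly non-degenerate with respect to $\Gamma(f)$ if it holds on all faces $\tau$, including $\Gamma(f)$ itself. Let $\mathfrak{D}(\Gamma(f))$ be the set of primitive vectors $\xi\in\mathbb{N}^n\setminus\{0\}$ perpendicular to a facet of $\Gamma(f)$. Put $\sigma(\xi)=\xi_1+\dots+\xi_n$, $d(\xi)=\min_{x\in\Gamma(f)}\langle\xi,x\rangle$ and $$\mathcal{P}=\bigcup_{\xi\in\mathfrak{D}(\Gamma(f)),\ d(\xi)\ne0}\left\{-\frac{\sigma(\xi)}{d(\xi)}+\frac{2\pi\sqrt{-1}\,k}{d(\xi)\log q}\ :\ k\in\mathbb{Z}\right\}.$$ (1) Let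 $f$ be an analytic mapping on an open neighborhood of the origin that is strongly non-degenerate at the origin with respect to $\Gamma(f)$. Then there is an open neighborhood $V$ of the origin such that, for every Schwartz–Bruhat function $\Phi$ with support in $V$, $Z_\Phi(s,f)$ has a meromorphic continuation to $\mathbb{C}$ that is a rational function of $q^{-s}$, and its poles belong to $$\mathcal{P}\cup\left\{-l+\frac{2\pi\sqrt{-1}\,k}{\log q}\ :\ k\in\mathbb{Z}\right\},$$ where the last set may be discarded if $l\ge n$. (2) Let $f:K^n\to K^l$ be a polynomial mapping that is strongly non-degenerate with respect to $\Gamma(f)$. Then $Z(s,f)$ has a meromorphic continuation to $\mathbb{C}$ that is a rational function of $q^{-s}$, and its poles belong to $$\mathcal{P}\cup\left\{-\min\{l,n\}+\frac{2\pi\sqrt{-1}\,k}{\log q}\ :\ k\in\mathbb{Z}\right\}.$$ -/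

import Mathlib

open scoped Topology

noncomputable section

/-! ### The ground field -/

/-- The cardinality `q` of the residue field `R_K / P_K`, where `R_K = {z | ‖z‖ ≤ 1}`. -/
def residueCard (K : Type*) [NontriviallyNormedField K] [IsUltrametricDist K] : ℕ :=
  Nat.card (IsLocalRing.ResidueField (NormedField.valuation (K := K)).valuationSubring)

/-- The norm of `K` is the normalized absolute value `‖z‖ = q ^ (-ord z)`: the norms of the
nonzero elements are exactly the integral powers of `q`. -/
def IsNormalizedNorm (K : Type*) [NontriviallyNormedField K] [IsUltrametricDist K] : Prop :=
  ∀ r : ℝ, (∃ z : K, z ≠ 0 ∧ ‖z‖ = r) ↔ ∃ k : ℤ, r = (residueCard K : ℝ) ^ k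

/-! ### Newton polyhedra -/

/-- An exponent `m ∈ ℕⁿ` as a point of `ℝⁿ`. -/
def expPoint {n : ℕ} (m : Fin n →₀ ℕ) : Fin n → ℝ := fun j => (m j : ℝ)

/-- The convex hull of `⋃_{m ∈ G} (m + ℝ₊ⁿ)`. -/
def newtonPolyhedron {n : ℕ} (G : Set (Fin n →₀ ℕ)) : Set (Fin n → ℝ) :=
  convexHull ℝ (⋃ m ∈ G, {x | ∀ j, expPoint m j ≤ x j})

/-- Nonempty faces of a convex set `Γ`, including `Γ` itself. -/
def IsFace {n : ℕ} (Γ τ : Set (Fin n → ℝ)) : Prop :=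
  τ.Nonempty ∧ IsExposed ℝ Γ τ

/-- Faces of dimension `n - 1`. -/
def IsFacet {n : ℕ} (Γ γ : Set (Fin n → ℝ)) : Prop :=
  IsFace Γ γ ∧ Module.finrank ℝ (vectorSpan ℝ γ) + 1 = n

/-- The pairing `⟨ξ, x⟩`. -/
def pairing {n : ℕ} (ξ : Fin n → ℕ) (x : Fin n → ℝ) : ℝ := ∑ j, (ξ j : ℝ) * x j

/-- The primitive vectors `ξ ∈ ℕⁿ` that are perpendicular to some facet of `Γ`. -/
def facetNormals {n : ℕ} (Γ : Set (Fin n → ℝ)) : Set (Fin n → ℕ) :=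
  {ξ | Finset.univ.gcd ξ = 1 ∧
    ∃ γ, IsFacet Γ γ ∧ ∀ x ∈ γ, ∀ y ∈ γ, pairing ξ x = pairing ξ y}

/-- `d(ξ) = min_{x ∈ Γ} ⟨ξ, x⟩`. -/
def minPairing {n : ℕ} (Γ : Set (Fin n → ℝ)) (ξ : Fin n → ℕ) : ℝ :=
  sInf (pairing ξ '' Γ)

/-- `σ(ξ) = ξ₁ + ⋯ + ξₙ`. -/
def coordSum {n : ℕ} (ξ : Fin n → ℕ) : ℕ := ∑ j, ξ j

/-! ### Mappings, their Newton polyhedron and non-degeneracy -/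

section Mappings

variable {K : Type*} [Field K] {n l : ℕ}

/-- `Γ(f)` for the mapping with components `F 1, …, F l`. -/
def mapPolyhedron (F : Fin l → MvPowerSeries (Fin n) K) : Set (Fin n → ℝ) :=
  newtonPolyhedron {m | ∃ i, MvPowerSeries.coeff m (F i) ≠ 0}

open Classical in
/-- The part `g_τ = ∑_{m ∈ supp g ∩ τ} c_m x^m` of `g = ∑ c_m x^m`. The sum is finite if `τ` is
compact or if `g` is a polynomial; only these cases are used. -/
def facePart (g : MvPowerSeries (Fin n) K) (τ : Set (Fin n → ℝ)) : MvPolynomial (Fin n) K :=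
  ∑ᶠ m : Fin n →₀ ℕ,
    if expPoint m ∈ τ then MvPolynomial.monomial m (MvPowerSeries.coeff m g) else 0

/-- The rank condition on `τ`: at each common zero of `f_{1,τ}, …, f_{l,τ}` in the torus, the
Jacobian matrix of `f_τ` has rank `min {l, n}`. -/
def NonDegenerateOn (F : Fin l → MvPowerSeries (Fin n) K) (τ : Set (Fin n → ℝ)) : Prop :=
  ∀ z : Fin n → K, (∀ j, z j ≠ 0) →
    (∀ i, MvPolynomial.eval z (facePart (F i) τ) = 0) →
    (Matrix.of fun (i : Fin l) (j : Fin n) =>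
      MvPolynomial.eval z (MvPolynomial.pderiv j (facePart (F i) τ))).rank = min l n

/-- Strong non-degeneracy at the origin of the nonconstant mapping with Taylor series `F`,
vanishing at the origin: the rank condition on all compact faces of `Γ(f)`. -/
structure StronglyNonDegenerateAtOrigin (F : Fin l → MvPowerSeries (Fin n) K) : Prop where
  map_zero : ∀ i, MvPowerSeries.constantCoeff (F i) = 0
  nonconstant : ∃ i, F i ≠ 0
  nonDegenerateOn : ∀ τ, IsFace (mapPolyhedron F) τ → IsCompact τ → NonDegenerateOn F τ

/-- Strong non-degeneracy of a nonconstant polynomial mapping vanishing at the origin: the rank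
condition on all faces of `Γ(f)`, including `Γ(f)` itself. -/
structure StronglyNonDegenerate (f : Fin l → MvPolynomial (Fin n) K) : Prop where
  map_zero : ∀ i, MvPolynomial.constantCoeff (f i) = 0
  nonconstant : ∃ i, f i ≠ 0
  nonDegenerateOn : ∀ τ, IsFace (mapPolyhedron fun i => (f i : MvPowerSeries (Fin n) K)) τ →
    NonDegenerateOn (fun i => (f i : MvPowerSeries (Fin n) K)) τ

end Mappings

/-- `f_i(x) = ∑_m c_{m,i} x^m` for all `x` near the origin, where `F i = ∑_m c_{m,i} x^m`. -/
def IsTaylorSeriesAtOrigin {K : Type*} [NontriviallyNormedField K] {n l : ℕ}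
    (f : (Fin n → K) → (Fin l → K)) (F : Fin l → MvPowerSeries (Fin n) K) : Prop :=
  ∀ᶠ x in 𝓝 (0 : Fin n → K), ∀ i,
    HasSum (fun m : Fin n →₀ ℕ => MvPowerSeries.coeff m (F i) * m.prod fun j e => x j ^ e) (f x i)

/-! ### Zeta functions and their poles -/

/-- Schwartz–Bruhat functions. -/
def IsSchwartzBruhat {X : Type*} [TopologicalSpace X] (Φ : X → ℂ) : Prop :=
  IsLocallyConstant Φ ∧ HasCompactSupport Φ

section Zeta

variable {K : Type*} [NontriviallyNormedField K] {n l : ℕ}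

/-- The integrand `Φ(x) ‖f(x)‖^s`; the norm on `K^l` is the maximum norm. -/
def zetaIntegrand (Φ : (Fin n → K) → ℂ) (f : (Fin n → K) → (Fin l → K)) (s : ℂ) :
    (Fin n → K) → ℂ :=
  fun x => Φ x * ((‖f x‖ : ℝ) : ℂ) ^ s

/-- The integral of `Φ(x) ‖f(x)‖^s` converges for `Re s > 0`, it has a meromorphic continuation
to `ℂ` which is a rational function of `q^{-s}`, and all poles of the continuation lie in `S`. -/
def ZetaPolesIn [MeasurableSpace K] [IsUltrametricDist K] (μ : MeasureTheory.Measure (Fin n → K))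
    (Φ : (Fin n → K) → ℂ) (f : (Fin n → K) → (Fin l → K)) (S : Set ℂ) : Prop :=
  (∀ s : ℂ, 0 < s.re → MeasureTheory.Integrable (zetaIntegrand Φ f s) μ) ∧
  ∃ Z : ℂ → ℂ,
    (∀ s, MeromorphicAt Z s) ∧
    (∃ R : RatFunc ℂ, ∀ s, Z s = R.eval (RingHom.id ℂ) ((residueCard K : ℂ) ^ (-s))) ∧
    (∀ s : ℂ, 0 < s.re → Z s = ∫ x, zetaIntegrand Φ f s x ∂μ) ∧
    ∀ s, meromorphicOrderAt Z s < 0 → s ∈ S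

end Zeta

/-- The union of the sets `𝒫(ξ) = {-σ(ξ)/d(ξ) + 2πik/(d(ξ) log q) | k ∈ ℤ}` over the primitive
normal vectors `ξ` of facets of `Γ` with `d(ξ) ≠ 0`. -/
def facetPoles {n : ℕ} (q : ℕ) (Γ : Set (Fin n → ℝ)) : Set ℂ :=
  {s | ∃ ξ ∈ facetNormals Γ, minPairing Γ ξ ≠ 0 ∧ ∃ k : ℤ,
    s = -((coordSum ξ : ℂ) / (minPairing Γ ξ : ℂ)) +
      2 * (Real.pi : ℂ) * Complex.I * (k : ℂ) / ((minPairing Γ ξ : ℂ) * (Real.log q : ℂ))}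

/-- The set `{-r + 2πik/log q | k ∈ ℤ}`. -/
def codimPoles (q r : ℕ) : Set ℂ :=
  {s | ∃ k : ℤ, s = -(r : ℂ) + 2 * (Real.pi : ℂ) * Complex.I * (k : ℂ) / (Real.log q : ℂ)}

end

set_option linter.unusedSectionVars false

/-! ### The ground field -/

section GroundField

open MeasureTheory
open scoped Pointwise

variable {K : Type*} [NontriviallyNormedField K] [IsUltrametricDist K]

/-! Cut the domain into the shells on which every `‖x j‖` is fixed. They are indexed by k in ℕⁿ, and
the coordinate hyperplanes they miss are null. The normal fan of the Newton polyhedron, triangulated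
without new rays, partitions ℕⁿ into finitely many sets b + ∑ ℕ aᵢ whose generators aᵢ are primitive
facet normals and on which a single exponent v minimizes every weight
(`nonempty_coneDecomposition`). On the shell of k = b + ∑ tᵢ aᵢ substitute xⱼ = ϖ^(M + kⱼ) uⱼ with u
in the unit torus. Then f(x) = ϖ^⟨k,v⟩ g_t(u), where the monomial u^m of g_t carries the nonnegative
power ϖ^⟨k,m-v⟩. Up to a factor independent of t, the shell contributes ∏ (q^(-σ(aᵢ) - s d(aᵢ)))^tᵢ
times the torus integral G(t, s) of Φ ‖g_t‖^s.

The crux is that G is locally constant in t on the compact space (ℕ ∪ {∞})^κ, with ϖ^∞ = 0. At a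
parameter with infinite entries, g_t keeps only the monomials on the face where the sum of the
corresponding aᵢ is minimal. So it is a rescaled face part of f (`pow_smul_powSum_eq_eval`), and the
rank condition applies to it. Away from zeros the norm is locally constant. At a zero with l ≤ n the
derivative is surjective, and an isometric, measure-preserving change of variables turns all nearby
g_t into one linear map A (`locallyRational_of_submersive`); scaling shows that the integral of ‖A
w‖^s has denominator 1 - q^(-l-s). If n ≤ l, Euler's identity for the quasi-homogeneous face part
excludes zeros as soon as some tᵢ is infinite. The remaining zeros sit at isolated parameters, where
the derivative is injective and the denominator is 1 - q^(-n-s) (`locallyRational_of_immersive`). A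
locally constant function of t depends only on a truncation of t, so the sum over a cone is a finite
combination of products of powers and geometric series (`exists_rational_hasSum_cone`), and its only
further denominators are 1 - q^(-σ(aᵢ) - s d(aᵢ)).

For a polynomial mapping every face is available, hence every t. For an analytic mapping only
compact faces are. The parameters whose point `conePoint` is the origin do lead to compact faces,
and by openness and compactness the conclusion extends to all parameters whose points are close to
the origin (`exists_pos_locallyRational_coneFamily`). This determines V. -/

theorem one_lt_residueCard (hK : IsNormalizedNorm K) : 1 < residueCard K := by
  obtain ⟨z, hz⟩ := NontriviallyNormedField.non_trivial (α := K)
  obtain ⟨k, hk⟩ := (hK ‖z‖).1 ⟨z, by rintro rfl; simp at hz; linarith, rfl⟩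
  rw [hk] at hz
  by_contra! h
  -- A `Nat.card` equal to 0 would mean an infinite residue field, so excluding it also yields
  -- finiteness.
  interval_cases hq : residueCard K
  · rcases eq_or_ne k 0 with rfl | h0
    · simp at hz
    · rw [Nat.cast_zero, zero_zpow k h0] at hz; linarith
  · simp at hz

theorem residueCard_pos_real (hK : IsNormalizedNorm K) : (0 : ℝ) < residueCard K := by
  have := one_lt_residueCard hK
  positivity

theorem exists_uniformizer (hK : IsNormalizedNorm K) :
    ∃ ϖ : K, ‖ϖ‖ = (residueCard K : ℝ)⁻¹ := by
  obtain ⟨z, -, hz⟩ := (hK ((residueCard K : ℝ)⁻¹)).2 ⟨-1, by simp⟩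
  exact ⟨z, hz⟩

theorem norm_le_inv_of_lt_one (hK : IsNormalizedNorm K) {z : K} (hz : ‖z‖ < 1) :
    ‖z‖ ≤ (residueCard K : ℝ)⁻¹ := by
  have hq : (1 : ℝ) < residueCard K := by exact_mod_cast one_lt_residueCard hK
  rcases eq_or_ne z 0 with rfl | h0
  · simp
  obtain ⟨k, hk⟩ := (hK ‖z‖).1 ⟨z, h0, rfl⟩
  rw [hk] at hz ⊢
  have : k < 0 := by
    by_contra! h
    exact absurd hz (not_lt.2 (one_le_zpow₀ hq.le h))
  rw [← zpow_neg_one]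
  exact zpow_le_zpow_right₀ hq.le (by omega)

theorem properSpace_of_finiteDimensional_padic (p : ℕ) [Fact p.Prime]
    (K : Type*) [NontriviallyNormedField K]
    [Algebra ℚ_[p] K] [FiniteDimensional ℚ_[p] K] [ContinuousSMul ℚ_[p] K] : ProperSpace K := by
  have e : K ≃L[ℚ_[p]] (Fin (Module.finrank ℚ_[p] K) → ℚ_[p]) :=
    ContinuousLinearEquiv.ofFinrankEq (by simp)
  have : LocallyCompactSpace K := e.toHomeomorph.isClosedEmbedding.locallyCompactSpace
  exact ProperSpace.of_locallyCompactSpace K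

theorem mem_valuationSubring_iff (z : K) :
    z ∈ (NormedField.valuation (K := K)).valuationSubring ↔ ‖z‖ ≤ 1 := by
  rw [Valuation.mem_valuationSubring_iff]
  rfl

theorem residue_eq_iff (x y : (NormedField.valuation (K := K)).valuationSubring) :
    IsLocalRing.residue _ x = IsLocalRing.residue _ y ↔ ‖(x : K) - y‖ < 1 := by
  rw [← sub_eq_zero, ← map_sub, IsLocalRing.residue_eq_zero_iff, IsLocalRing.mem_maximalIdeal,
    mem_nonunits_iff, (Valuation.valuationSubring.integers _).isUnit_iff_valuation_eq_one,
    ← ne_eq, ← lt_iff_le_and_ne.trans (and_iff_right ?_)]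
  · rfl
  · exact (x - y).2

variable [MeasurableSpace K] [BorelSpace K]

/-- The unit ball is the disjoint union of the residue classes, each a translate of the ball of
radius 1/q. This ties q as a cardinality to q as a value of the norm. -/
theorem measure_closedBall_inv_residueCard (hK : IsNormalizedNorm K) (ν : Measure K)
    [ν.IsAddHaarMeasure] :
    residueCard K * ν (Metric.closedBall 0 (residueCard K : ℝ)⁻¹) = ν (Metric.closedBall 0 1) := by
  classical
  have hfin : Finite (IsLocalRing.ResidueField (NormedField.valuation (K := K)).valuationSubring) :=
    Nat.finite_of_card_ne_zero (by have := one_lt_residueCard hK; unfold residueCard at this; omega)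
  have := Fintype.ofFinite (IsLocalRing.ResidueField (NormedField.valuation (K := K)).valuationSubring)
  choose lift hlift using IsLocalRing.residue_surjective
    (R := (NormedField.valuation (K := K)).valuationSubring)
  have hq : (1 : ℝ) < residueCard K := by exact_mod_cast one_lt_residueCard hK
  have hball : Metric.closedBall (0 : K) 1 =
      ⋃ r, Metric.closedBall (lift r : K) (residueCard K : ℝ)⁻¹ := by
    ext z
    simp only [Metric.mem_closedBall, dist_zero_right, Set.mem_iUnion]
    constructor
    · intro hz
      refine ⟨IsLocalRing.residue _ ⟨z, (mem_valuationSubring_iff z).2 hz⟩, ?_⟩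
      rw [dist_eq_norm]
      exact norm_le_inv_of_lt_one hK ((residue_eq_iff ⟨z, _⟩ _).1 (hlift _).symm)
    · rintro ⟨r, hr⟩
      have h1 : ‖(lift r : K)‖ ≤ 1 := (mem_valuationSubring_iff _).1 (lift r).2
      rw [dist_eq_norm] at hr
      have := IsUltrametricDist.norm_add_le_max (z - lift r) (lift r : K)
      rw [sub_add_cancel] at this
      exact this.trans (max_le (hr.trans (inv_le_one_of_one_le₀ hq.le)) h1)
  rw [hball, measure_iUnion]
  · rw [tsum_fintype]
    simp only [residueCard, Nat.card_eq_fintype_card]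
    have : ∀ z : K, ν (Metric.closedBall z (residueCard K : ℝ)⁻¹) =
        ν (Metric.closedBall 0 (residueCard K : ℝ)⁻¹) := fun z =>
      Measure.addHaar_closedBall_center ν z _
    simp only [residueCard, Nat.card_eq_fintype_card] at this
    simp [this]
  · intro r r' hrr
    rw [Function.onFun, Set.disjoint_left]
    intro z hz hz'
    apply hrr
    rw [← hlift r, ← hlift r', residue_eq_iff]
    rw [Metric.mem_closedBall] at hz hz'
    rw [← dist_eq_norm]
    rw [dist_comm] at hz
    exact ((dist_triangle_max _ z _).trans (max_le hz hz')).trans_lt (inv_lt_one_of_one_lt₀ hq)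
  · exact fun r => Metric.isClosed_closedBall.measurableSet


variable [ProperSpace K]

/-- Multiplication by a uniformizer scales Haar measure by a constant factor, and the unit ball
shows that this factor is 1/q. Induction on k then goes in both directions. -/
theorem measure_closedBall_zpow (hK : IsNormalizedNorm K) (ν : Measure K) [ν.IsAddHaarMeasure]
    (hν : ν (Metric.closedBall 0 1) = 1) (k : ℤ) :
    ν (Metric.closedBall 0 ((residueCard K : ℝ) ^ k)) = (residueCard K : ENNReal) ^ k := by
  have hq1 : (1 : ℝ) < residueCard K := by exact_mod_cast one_lt_residueCard hK
  have hq0 : (residueCard K : ENNReal) ≠ 0 := by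
    have := one_lt_residueCard hK
    simp only [ne_eq, Nat.cast_eq_zero]; omega
  have hqt : (residueCard K : ENNReal) ≠ ⊤ := ENNReal.natCast_ne_top _
  obtain ⟨ϖ, hϖ⟩ := exists_uniformizer hK
  have hϖ0 : ϖ ≠ 0 := by
    rw [← norm_pos_iff, hϖ]; positivity
  have hsmul (k : ℤ) : (Units.mk0 ϖ hϖ0) • Metric.closedBall (0 : K) ((residueCard K : ℝ) ^ k) =
      Metric.closedBall 0 ((residueCard K : ℝ) ^ (k - 1)) := by
    change ϖ • Metric.closedBall (0 : K) ((residueCard K : ℝ) ^ k) = _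
    rw [smul_closedBall' hϖ0, smul_zero, hϖ, zpow_sub_one₀ (by positivity), mul_comm]
  have hstep (k : ℤ) : ν (Metric.closedBall 0 ((residueCard K : ℝ) ^ (k - 1))) =
      (residueCard K : ENNReal)⁻¹ * ν (Metric.closedBall 0 ((residueCard K : ℝ) ^ k)) := by
    have h1 := distribHaarChar_mul ν (Units.mk0 ϖ hϖ0)
      (Metric.closedBall (0 : K) ((residueCard K : ℝ) ^ (0 : ℤ)))
    rw [hsmul, zpow_zero, hν, mul_one, zero_sub, zpow_neg_one] at h1
    have h2 := measure_closedBall_inv_residueCard hK ν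
    rw [hν, ← h1] at h2
    have h3 := distribHaarChar_mul ν (Units.mk0 ϖ hϖ0)
      (Metric.closedBall (0 : K) ((residueCard K : ℝ) ^ k))
    rw [hsmul] at h3
    rw [← h3]
    congr 1
    exact ENNReal.eq_inv_of_mul_eq_one_left (by rwa [mul_comm] at h2)
  induction k with
  | zero => simpa using hν
  | succ k ih =>
    have := hstep (k + 1)
    rw [add_sub_cancel_right, ih] at this
    rw [ENNReal.zpow_add hq0 hqt, this, zpow_one, mul_comm, ← mul_assoc,
      ENNReal.mul_inv_cancel hq0 hqt, one_mul]
  | pred k ih =>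
    rw [hstep, ih, sub_eq_add_neg, ENNReal.zpow_add hq0 hqt, zpow_neg_one, mul_comm]

variable {n : ℕ}

theorem setOf_norm_le_eq_pi (r : Fin n → ℝ) :
    {x : Fin n → K | ∀ j, ‖x j‖ ≤ r j} = Set.univ.pi fun j => Metric.closedBall 0 (r j) := by
  ext x; simp

theorem exists_isAddHaarMeasure_closedBall_eq_one (K : Type*) [NontriviallyNormedField K]
    [MeasurableSpace K] [BorelSpace K] [ProperSpace K] :
    ∃ ν : Measure K, ν.IsAddHaarMeasure ∧ ν (Metric.closedBall 0 1) = 1 := by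
  let B : TopologicalSpace.PositiveCompacts K :=
    ⟨⟨Metric.closedBall 0 1, isCompact_closedBall _ _⟩,
      ⟨0, mem_interior_iff_mem_nhds.2 (Metric.closedBall_mem_nhds _ one_pos)⟩⟩
  exact ⟨Measure.addHaarMeasure B, inferInstance, Measure.addHaarMeasure_self⟩

theorem eq_pi_of_polydisc_eq_one (μ : Measure (Fin n → K)) [μ.IsAddHaarMeasure]
    (hμ : μ {x | ∀ j, ‖x j‖ ≤ 1} = 1) (ν : Measure K) [ν.IsAddHaarMeasure]
    (hν : ν (Metric.closedBall 0 1) = 1) : μ = Measure.pi fun _ => ν := by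
  have h := Measure.isAddLeftInvariant_eq_smul μ (Measure.pi fun _ => ν)
  have h1 : (Measure.pi fun _ => ν) {x : Fin n → K | ∀ j, ‖x j‖ ≤ 1} = 1 := by
    rw [setOf_norm_le_eq_pi (fun _ => 1), Measure.pi_pi]
    simp [hν]
  have h2 := congrArg (fun m : Measure (Fin n → K) => m {x : Fin n → K | ∀ j, ‖x j‖ ≤ 1}) h
  simp only [Measure.smul_apply, hμ, h1, ENNReal.smul_def, smul_eq_mul, mul_one] at h2
  rw [h]
  have h3 : Measure.addHaarScalarFactor μ (Measure.pi fun _ => ν) = 1 := by exact_mod_cast h2.symm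
  rw [h3, one_smul]

theorem measure_polydisc_zpow (hK : IsNormalizedNorm K) (μ : Measure (Fin n → K))
    [μ.IsAddHaarMeasure] (hμ : μ {x | ∀ j, ‖x j‖ ≤ 1} = 1) (k : Fin n → ℤ) :
    μ {x | ∀ j, ‖x j‖ ≤ (residueCard K : ℝ) ^ k j} = ∏ j, (residueCard K : ENNReal) ^ k j := by
  obtain ⟨ν, _, hν⟩ := exists_isAddHaarMeasure_closedBall_eq_one K
  rw [eq_pi_of_polydisc_eq_one μ hμ ν hν, setOf_norm_le_eq_pi fun j => (residueCard K : ℝ) ^ k j,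
    Measure.pi_pi]
  simp only [measure_closedBall_zpow hK ν hν]

/-- The factor by which a linear automorphism of `K^n` scales the Haar measures. -/
noncomputable def haarScale (T : (Fin n → K) ≃L[K] (Fin n → K)) : NNReal :=
  addEquivAddHaarChar T.toContinuousAddEquiv

theorem haarScale_mul_measure_preimage (μ : Measure (Fin n → K)) [μ.IsAddHaarMeasure]
    (T : (Fin n → K) ≃L[K] (Fin n → K)) (E : Set (Fin n → K)) :
    haarScale T * μ (T ⁻¹' E) = μ E :=
  addEquivAddHaarChar_smul_preimage μ T.toContinuousAddEquiv

theorem integral_eq_haarScale_mul (μ : Measure (Fin n → K)) [μ.IsAddHaarMeasure]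
    (T : (Fin n → K) ≃L[K] (Fin n → K)) (φ : (Fin n → K) → ℂ) :
    ∫ x, φ x ∂μ = haarScale T * ∫ x, φ (T x) ∂μ := by
  have h : haarScale T • μ.map T = μ := addEquivAddHaarChar_smul_map μ T.toContinuousAddEquiv
  conv_lhs => rw [← h]
  rw [integral_smul_nnreal_measure]
  rw [T.toHomeomorph.measurableEmbedding.integral_map φ |> fun h => (h : ∫ x, φ x ∂(μ.map T) = _)]
  rw [NNReal.smul_def, Complex.real_smul]
  rfl

theorem setIntegral_eq_haarScale_mul (μ : Measure (Fin n → K)) [μ.IsAddHaarMeasure]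
    (T : (Fin n → K) ≃L[K] (Fin n → K)) {E : Set (Fin n → K)} (hE : MeasurableSet E)
    (φ : (Fin n → K) → ℂ) :
    ∫ x in E, φ x ∂μ = haarScale T * ∫ x in T ⁻¹' E, φ (T x) ∂μ := by
  rw [← integral_indicator hE, integral_eq_haarScale_mul μ T,
    ← integral_indicator (T.continuous.measurable hE)]
  rfl

/-- The scale is multiplicative with commutative values. Hence the scale of a diagonalizable
automorphism can be read off from its eigenvalues, without determinants. -/
theorem haarScale_conj (S T : (Fin n → K) ≃L[K] (Fin n → K)) :
    haarScale ((S.symm.trans T).trans S) = haarScale T := by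
  have h (A B : (Fin n → K) ≃L[K] (Fin n → K)) :
      haarScale (A.trans B) = haarScale A * haarScale B :=
    addEquivAddHaarChar_trans (ψ := A.toContinuousAddEquiv) (φ := B.toContinuousAddEquiv)
  have h1 : haarScale S.symm = (haarScale S)⁻¹ :=
    addEquivAddHaarChar_symm (φ := S.toContinuousAddEquiv)
  have h2 : haarScale S ≠ 0 := (addEquivAddHaarChar_pos _).ne'
  rw [h, h, h1]
  field_simp

/-- Coordinatewise multiplication by a vector with nonzero entries. -/
noncomputable def diagEquiv (a : Fin n → K) (ha : ∀ j, a j ≠ 0) :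
    (Fin n → K) ≃L[K] (Fin n → K) :=
  ContinuousLinearEquiv.piCongrRight fun j => ContinuousLinearEquiv.unitsEquivAut K (Units.mk0 (a j) (ha j))

theorem diagEquiv_apply (a : Fin n → K) (ha : ∀ j, a j ≠ 0) (x : Fin n → K) (j : Fin n) :
    diagEquiv a ha x j = a j * x j := by
  simp [diagEquiv, mul_comm]

/-- It suffices to test on the polydisc with radii `‖a j‖`, whose preimage is the unit polydisc. -/
theorem haarScale_diagEquiv (hK : IsNormalizedNorm K) (a : Fin n → K) (ha : ∀ j, a j ≠ 0) :
    (haarScale (diagEquiv a ha) : ℝ) = ∏ j, ‖a j‖ := by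
  obtain ⟨ν, _, hν⟩ := exists_isAddHaarMeasure_closedBall_eq_one K
  let μ : Measure (Fin n → K) := Measure.pi fun _ => ν
  have hμ : μ {x | ∀ j, ‖x j‖ ≤ 1} = 1 := by
    rw [setOf_norm_le_eq_pi (fun _ => 1), Measure.pi_pi]
    simp [hν]
  choose k hk using fun j => (hK ‖a j‖).1 ⟨a j, ha j, rfl⟩
  have h1 := haarScale_mul_measure_preimage μ (diagEquiv a ha)
    {x | ∀ j, ‖x j‖ ≤ (residueCard K : ℝ) ^ k j}
  have h2 : diagEquiv a ha ⁻¹' {x | ∀ j, ‖x j‖ ≤ (residueCard K : ℝ) ^ k j} =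
      {x | ∀ j, ‖x j‖ ≤ 1} := by
    ext x
    simp only [Set.mem_preimage, Set.mem_ofPred_eq, diagEquiv_apply, norm_mul, ← hk]
    exact forall_congr' fun j => mul_le_iff_le_one_right (norm_pos_iff.2 (ha j))
  rw [h2, hμ, mul_one, measure_polydisc_zpow hK μ hμ] at h1
  have h3 := congrArg ENNReal.toReal h1
  simp only [ENNReal.coe_toReal, ENNReal.toReal_prod] at h3
  rw [h3]
  refine Finset.prod_congr rfl fun j _ => ?_
  rw [hk]
  cases k j <;> simp [zpow_negSucc, ENNReal.toReal_inv, ENNReal.toReal_pow]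

theorem measure_coordinate_eq_zero (μ : Measure (Fin n → K)) [μ.IsAddHaarMeasure]
    (hμ : μ {x | ∀ j, ‖x j‖ ≤ 1} = 1) (j : Fin n) : μ {x | x j = 0} = 0 := by
  obtain ⟨ν, _, hν⟩ := exists_isAddHaarMeasure_closedBall_eq_one K
  rw [eq_pi_of_polydisc_eq_one μ hμ ν hν]
  exact Measure.pi_hyperplane (fun _ => ν) j 0

end GroundField

/-! ### Functions of `s` that are rational in `q ^ (-s)` -/

section Rational

open Polynomial

/-- For `Re s > 0` the function `I` is `P(q^{-s}) / (q^{-es} D(q^{-s}))` for some polynomial `P`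
and some `e`. -/
def RationalWithDenom (q : ℕ) (D : ℂ[X]) (I : ℂ → ℂ) : Prop :=
  ∃ (P : ℂ[X]) (e : ℕ), ∀ s : ℂ, 0 < s.re →
    I s * ((q : ℂ) ^ (-s)) ^ e * D.eval ((q : ℂ) ^ (-s)) = P.eval ((q : ℂ) ^ (-s))

variable {q : ℕ} {D D' : ℂ[X]} {I I' : ℂ → ℂ}

theorem RationalWithDenom.congr (h : RationalWithDenom q D I)
    (hI : ∀ s : ℂ, 0 < s.re → I' s = I s) : RationalWithDenom q D I' := by
  obtain ⟨P, e, h⟩ := h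
  exact ⟨P, e, fun s hs => by rw [hI s hs, h s hs]⟩

theorem RationalWithDenom.zero : RationalWithDenom q D 0 := ⟨0, 0, fun s _ => by simp⟩

theorem RationalWithDenom.add (h : RationalWithDenom q D I) (h' : RationalWithDenom q D I') :
    RationalWithDenom q D (I + I') := by
  obtain ⟨P, e, h⟩ := h
  obtain ⟨P', e', h'⟩ := h'
  refine ⟨P * X ^ e' + P' * X ^ e, e + e', fun s hs => ?_⟩
  simp only [eval_add, eval_mul, eval_pow, eval_X, ← h s hs, ← h' s hs, Pi.add_apply]
  ring

theorem RationalWithDenom.sum {ι : Type*} (t : Finset ι) {I : ι → ℂ → ℂ}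
    (h : ∀ i ∈ t, RationalWithDenom q D (I i)) : RationalWithDenom q D (∑ i ∈ t, I i) := by
  classical
  induction t using Finset.induction_on with
  | empty => exact RationalWithDenom.zero
  | insert i t hi ih =>
    rw [Finset.sum_insert hi]
    exact (h i (Finset.mem_insert_self i t)).add
      (ih fun j hj => h j (Finset.mem_insert_of_mem hj))

theorem RationalWithDenom.mul (h : RationalWithDenom q D I) (h' : RationalWithDenom q D' I') :
    RationalWithDenom q (D * D') (I * I') := by
  obtain ⟨P, e, h⟩ := h
  obtain ⟨P', e', h'⟩ := h'
  refine ⟨P * P', e + e', fun s hs => ?_⟩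
  simp only [eval_mul, ← h s hs, ← h' s hs, Pi.mul_apply]
  ring

theorem RationalWithDenom.of_dvd (h : RationalWithDenom q D I) (hD : D ∣ D') :
    RationalWithDenom q D' I := by
  obtain ⟨P, e, h⟩ := h
  obtain ⟨Q, rfl⟩ := hD
  exact ⟨P * Q, e, fun s hs => by rw [eval_mul, eval_mul, ← h s hs]; ring⟩

theorem RationalWithDenom.const (c : ℂ) : RationalWithDenom q 1 fun _ => c :=
  ⟨C c, 0, fun s _ => by simp⟩

theorem RationalWithDenom.const_mul (h : RationalWithDenom q D I) (c : ℂ) :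
    RationalWithDenom q D fun s => c * I s := by
  rw [← one_mul D]
  exact (RationalWithDenom.const c).mul h

theorem RationalWithDenom.pow (k : ℕ) : RationalWithDenom q 1 fun s => ((q : ℂ) ^ (-s)) ^ k :=
  ⟨X ^ k, 0, fun s _ => by simp⟩

theorem ofReal_zpow_cpow (hq : 1 < q) (k : ℤ) (s : ℂ) :
    (((q : ℝ) ^ k : ℝ) : ℂ) ^ s = ((q : ℂ) ^ (-s)) ^ (-k) := by
  have hq0 : (0 : ℝ) < q := by positivity
  rw [← Complex.cpow_int_mul]
  have h1 : (((q : ℝ) ^ k : ℝ) : ℂ) = Complex.exp (k * Real.log q) := by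
    rw [← Complex.ofReal_intCast, ← Complex.ofReal_mul, ← Complex.ofReal_exp, mul_comm,
      Real.exp_mul, Real.exp_log hq0, Real.rpow_intCast]
  rw [h1, Complex.cpow_def_of_ne_zero (Complex.exp_ne_zero _),
    Complex.cpow_def_of_ne_zero (by exact_mod_cast hq0.ne')]
  rw [← Complex.ofReal_intCast, ← Complex.ofReal_mul, ← Complex.ofReal_exp, ← Complex.ofReal_log
    (Real.exp_pos _).le, Real.log_exp, ← Complex.ofReal_natCast, ← Complex.ofReal_log hq0.le]
  push_cast
  ring_nf

/-- A norm greater than 1 gives a negative power of q^(-s), which is what the exponent `e` in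
`RationalWithDenom` absorbs. Such powers never produce poles, since q^(-s) has no zeros. -/
theorem RationalWithDenom.zpow_cpow (hq : 1 < q) (k : ℤ) :
    RationalWithDenom q 1 fun s => (((q : ℝ) ^ k : ℝ) : ℂ) ^ s := by
  have hq0 (s : ℂ) : (q : ℂ) ^ (-s) ≠ 0 := by
    rw [Complex.cpow_def_of_ne_zero (by norm_cast; omega)]
    exact Complex.exp_ne_zero _
  obtain ⟨m, rfl | rfl⟩ := k.eq_nat_or_neg
  · refine ⟨1, m, fun s _ => ?_⟩
    simp only [ofReal_zpow_cpow hq]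
    simp [hq0]
  · refine ⟨X ^ m, 0, fun s _ => ?_⟩
    simp only [ofReal_zpow_cpow hq]
    simp

end Rational

/-! ### Local integrals -/

section LocalIntegrals

open MeasureTheory Polynomial

variable {K : Type*} [NontriviallyNormedField K] [IsUltrametricDist K]
  [MeasurableSpace K] [BorelSpace K] [ProperSpace K] {n l : ℕ}

theorem exists_norm_eq_zpow (hK : IsNormalizedNorm K) {v : Fin l → K} (hv : v ≠ 0) :
    ∃ k : ℤ, ‖v‖ = (residueCard K : ℝ) ^ k := by
  have : Nonempty (Fin l) := by
    by_contra h
    rw [not_nonempty_iff] at h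
    exact hv (Subsingleton.elim _ _)
  obtain ⟨i, -, hmax⟩ := Finset.exists_max_image Finset.univ (fun i => ‖v i‖) Finset.univ_nonempty
  have hi : ‖v i‖ = ‖v‖ := le_antisymm (norm_le_pi_norm v i)
    ((pi_norm_le_iff_of_nonneg (norm_nonneg _)).2 fun j => hmax j (Finset.mem_univ j))
  rw [← hi]
  exact (hK _).1 ⟨v i, by rw [← norm_pos_iff, hi]; exact norm_pos_iff.2 hv, rfl⟩

theorem norm_sub_le_max' {E : Type*} [SeminormedAddGroup E] [IsUltrametricDist E] (x y : E) :
    ‖x - y‖ ≤ max ‖x‖ ‖y‖ := by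
  rw [sub_eq_add_neg, ← norm_neg y]
  exact IsUltrametricDist.norm_add_le_max _ _

/-- In a basis adapted to the decomposition into range and kernel of the projection, T is diagonal,
with entries ϖ on the range and 1 on the kernel. -/
theorem haarScale_one_add_smul_proj (hK : IsNormalizedNorm K)
    (P : (Fin n → K) →ₗ[K] (Fin n → K)) (hP : ∀ x, P (P x) = P x) {ϖ : K} (hϖ : ϖ ≠ 0)
    (T : (Fin n → K) ≃L[K] (Fin n → K)) (hT : ∀ x, T x = x + (ϖ - 1) • P x) :
    (haarScale T : ℝ) = ‖ϖ‖ ^ Module.finrank K (LinearMap.range P) := by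
  have hPi : IsIdempotentElem P := LinearMap.ext hP
  have hc : IsCompl (LinearMap.range P) (LinearMap.ker P) := LinearMap.IsIdempotentElem.isCompl hPi
  let b₁ := Module.finBasis K (LinearMap.range P)
  let b₂ := Module.finBasis K (LinearMap.ker P)
  let e : Fin (Module.finrank K (LinearMap.range P)) ⊕ Fin (Module.finrank K (LinearMap.ker P)) ≃
      Fin n := Fintype.equivOfCardEq (by
        simpa using LinearMap.finrank_range_add_finrank_ker P)
  let v := ((b₁.prod b₂).map (Submodule.prodEquivOfIsCompl _ _ hc)).reindex e
  let S : (Fin n → K) ≃L[K] (Fin n → K) := v.equivFun.symm.toContinuousLinearEquiv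
  let a : Fin n → K := fun j => Sum.elim (fun _ => ϖ) (fun _ => 1) (e.symm j)
  have ha : ∀ j, a j ≠ 0 := fun j => by
    simp only [a]; cases e.symm j <;> simp [hϖ]
  have hSv (j : Fin n) : S (Pi.single j 1) = v j := by
    simp [S]
  have hTv (j : Fin n) : T (v j) = a j • v j := by
    rw [hT]
    obtain ⟨j, rfl⟩ := e.surjective j
    rcases j with i | i
    · have : v (e (Sum.inl i)) = b₁ i := by simp [v]
      have h2 : P (b₁ i : Fin n → K) = b₁ i := by
        obtain ⟨y, hy⟩ := (b₁ i).2
        rw [← hy, hP]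
      rw [this, h2]
      simp [a, sub_smul]
    · have : v (e (Sum.inr i)) = b₂ i := by simp [v]
      have h2 : P (b₂ i : Fin n → K) = 0 := (b₂ i).2
      rw [this, h2]
      simp [a]
  have hconj : T = (S.symm.trans (diagEquiv a ha)).trans S := by
    refine ContinuousLinearEquiv.toLinearEquiv_injective (v.ext' fun j => ?_)
    change T (v j) = S (diagEquiv a ha (S.symm (v j)))
    rw [hTv, ← hSv, S.symm_apply_apply, ← map_smul]
    congr 1
    ext i
    rw [diagEquiv_apply]
    rcases eq_or_ne i j with rfl | h
    · simp
    · simp [h]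
  rw [hconj, haarScale_conj, haarScale_diagEquiv hK, ← e.prod_comp]
  simp [a, Fintype.prod_sum_type]

/-- On a compact set without zeros the norm takes only finitely many values, all powers of q, so the
integral is a Laurent polynomial in q^(-s). -/
theorem rationalWithDenom_setIntegral_of_ne_zero (hK : IsNormalizedNorm K)
    (μ : Measure (Fin n → K)) [μ.IsAddHaarMeasure] {C : Set (Fin n → K)} (hC : IsCompact C)
    {h : (Fin n → K) → (Fin l → K)} (hc : ContinuousOn h C) (h0 : ∀ x ∈ C, h x ≠ 0) :
    RationalWithDenom (residueCard K) 1 fun s => ∫ x in C, ((‖h x‖ : ℝ) : ℂ) ^ s ∂μ := by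
  have hq : (1 : ℝ) < residueCard K := by exact_mod_cast one_lt_residueCard hK
  obtain ⟨M, hM⟩ := hC.bddAbove_image hc.norm
  obtain ⟨M', hM'⟩ := hC.bddAbove_image (hc.norm.inv₀ fun x hx => norm_ne_zero_iff.2 (h0 x hx))
  obtain ⟨N, hN⟩ := pow_unbounded_of_one_lt (max M M') hq
  let Ck : ℤ → Set (Fin n → K) := fun k => C ∩ {x | ‖h x‖ = (residueCard K : ℝ) ^ k}
  have hCk (k : ℤ) : MeasurableSet (Ck k) :=
    (hc.norm.preimage_isClosed_of_isClosed hC.isClosed (isClosed_singleton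
      (x := (residueCard K : ℝ) ^ k))).measurableSet
  have hCu : C = ⋃ k ∈ Finset.Icc (-N : ℤ) N, Ck k := by
    ext x
    simp only [Finset.mem_Icc, Set.mem_iUnion, exists_prop, Ck, Set.mem_inter_iff,
      Set.mem_ofPred_eq]
    refine ⟨fun hx => ?_, fun ⟨_, _, hx, _⟩ => hx⟩
    obtain ⟨k, hk⟩ := exists_norm_eq_zpow hK (h0 x hx)
    refine ⟨k, ⟨?_, ?_⟩, hx, hk⟩
    · have h1 : ‖h x‖⁻¹ < (residueCard K : ℝ) ^ N :=
        ((hM' ⟨x, hx, rfl⟩).trans (le_max_right _ _)).trans_lt hN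
      rw [hk, ← zpow_neg, ← zpow_natCast, zpow_lt_zpow_iff_right₀ hq] at h1
      omega
    · have h1 : ‖h x‖ < (residueCard K : ℝ) ^ N :=
        ((hM ⟨x, hx, rfl⟩).trans (le_max_left _ _)).trans_lt hN
      rw [hk, ← zpow_natCast, zpow_lt_zpow_iff_right₀ hq] at h1
      omega
  have hCf (k : ℤ) : μ (Ck k) ≠ ⊤ :=
    ((measure_mono Set.inter_subset_left).trans_lt hC.measure_lt_top).ne
  have hintegrable (k : ℤ) (s : ℂ) : Set.EqOn (fun x => ((‖h x‖ : ℝ) : ℂ) ^ s)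
      (fun _ => (((residueCard K : ℝ) ^ k : ℝ) : ℂ) ^ s) (Ck k) := fun x hx => by
    simp only [hx.2.out]
  refine (RationalWithDenom.sum (Finset.Icc (-N : ℤ) N) fun k _ =>
    (RationalWithDenom.zpow_cpow (one_lt_residueCard hK) k).const_mul (μ.real (Ck k))).congr
      fun s _ => ?_
  conv_lhs => rw [hCu]
  rw [integral_biUnion_finset _ (fun k _ => hCk k), Finset.sum_apply]
  · refine Finset.sum_congr rfl fun k _ => ?_
    rw [setIntegral_congr_fun (hCk k) (hintegrable k s), setIntegral_const, Complex.real_smul]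
  · intro k _ k' _ hkk
    rw [Function.onFun, Set.disjoint_left]
    rintro x ⟨-, hx⟩ ⟨-, hx'⟩
    exact hkk (zpow_right_injective₀ (by linarith) hq.ne' (hx.symm.trans hx'))
  · exact fun k _ => (integrableOn_congr_fun (hintegrable k s) (hCk k)).2
      (integrableOn_const (hCf k))

theorem continuous_norm_cpow {α : Type*} [TopologicalSpace α] {E : Type*}
    [SeminormedAddCommGroup E] {h : α → E} (hh : Continuous h) {s : ℂ} (hs : 0 < s.re) :
    Continuous fun x => ((‖h x‖ : ℝ) : ℂ) ^ s :=
  (Complex.continuous_ofReal_cpow_const hs).comp hh.norm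

/-- The automorphism T multiplies A by ϖ and volumes by q^(-rank A), and for large j it carries the
region `D j` near the kernel of A onto `D (j + 1)`. So the integral over `D (j + 1)` is q^(-rank A -
s) times the one over `D j`, while their difference is a Laurent polynomial in q^(-s). Solving for
the integral over `D j` gives the denominator. -/
theorem rationalWithDenom_setIntegral_linear (hK : IsNormalizedNorm K)
    (μ : Measure (Fin n → K)) [μ.IsAddHaarMeasure]
    (A : (Fin n → K) →L[K] (Fin l → K)) (σ : (Fin l → K) →L[K] (Fin n → K))
    (hσ : ∀ w, A (σ (A w)) = A w) {r : ℝ} (hr : 0 < r) :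
    RationalWithDenom (residueCard K)
      (1 - C (((residueCard K : ℂ)⁻¹) ^ Module.finrank K (LinearMap.range A.toLinearMap)) * X)
      fun s => ∫ x in Metric.closedBall 0 r, ((‖A x‖ : ℝ) : ℂ) ^ s ∂μ := by
  have hq : (1 : ℝ) < residueCard K := by exact_mod_cast one_lt_residueCard hK
  obtain ⟨q, hqdef⟩ : ∃ q : ℝ, q = residueCard K := ⟨_, rfl⟩
  rw [← hqdef] at hq
  obtain ⟨ϖ, hϖ⟩ := exists_uniformizer hK
  rw [← hqdef] at hϖ
  have hϖ0 : ϖ ≠ 0 := by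
    rw [← norm_pos_iff, hϖ]; positivity
  have hϖ1 : ‖ϖ - 1‖ ≤ 1 := by
    have := norm_sub_le_max' ϖ 1
    rw [hϖ, norm_one] at this
    exact this.trans (max_le (inv_le_one_of_one_le₀ hq.le) le_rfl)
  let P : (Fin n → K) →L[K] (Fin n → K) := σ.comp A
  have hP (x) : P (P x) = P x := by simp [P, hσ]
  have hinv {a : K} (ha : a ≠ 0) : Function.LeftInverse
      (⇑(ContinuousLinearMap.id K (Fin n → K) + (a⁻¹ - 1) • P))
      ⇑(ContinuousLinearMap.id K (Fin n → K) + (a - 1) • P) := by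
    intro x
    simp only [add_apply, ContinuousLinearMap.id_apply,
      smul_apply, map_add, map_smul, hP]
    match_scalars <;> field_simp
    ring
  let T : (Fin n → K) ≃L[K] (Fin n → K) := ContinuousLinearEquiv.equivOfInverse
    (ContinuousLinearMap.id K _ + (ϖ - 1) • P) (ContinuousLinearMap.id K _ + (ϖ⁻¹ - 1) • P)
    (hinv hϖ0) (by have := hinv (inv_ne_zero hϖ0); rwa [inv_inv] at this)
  have hT (x) : T x = x + (ϖ - 1) • P x := rfl
  have hrank : Module.finrank K (LinearMap.range P.toLinearMap) =
      Module.finrank K (LinearMap.range A.toLinearMap) := by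
    apply le_antisymm
    · have : LinearMap.range P.toLinearMap =
          (LinearMap.range A.toLinearMap).map σ.toLinearMap := by
        rw [← LinearMap.range_comp]; rfl
      rw [this]
      exact Submodule.finrank_map_le _ _
    · have : LinearMap.range A.toLinearMap =
          (LinearMap.range P.toLinearMap).map A.toLinearMap := by
        rw [← LinearMap.range_comp]
        congr 1
        exact LinearMap.ext fun x => (hσ x).symm
      rw [this]
      exact Submodule.finrank_map_le _ _
  have hscale := haarScale_one_add_smul_proj hK P.toLinearMap hP hϖ0 T hT
  rw [hrank, hϖ] at hscale
  have hAT (x) : A (T x) = ϖ • A x := by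
    rw [hT, map_add, map_smul]
    simp only [P, ContinuousLinearMap.comp_apply, hσ]
    module
  let D : ℕ → Set (Fin n → K) := fun j =>
    Metric.closedBall 0 r ∩ A ⁻¹' Metric.closedBall 0 ((q ^ j)⁻¹)
  -- With this j the vector P x has norm at most r for x in `D j`, so adding `(ϖ - 1) • P x` does
  -- not change membership in the ball of radius r.
  obtain ⟨j, hj⟩ : ∃ j : ℕ, ‖σ‖ * (q ^ j)⁻¹ ≤ r := by
    obtain ⟨j, hj⟩ := pow_unbounded_of_one_lt (‖σ‖ / r) hq
    refine ⟨j, ?_⟩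
    rw [div_lt_iff₀ hr] at hj
    rw [← div_eq_mul_inv, div_le_iff₀ (by positivity)]
    linarith
  have hDc (j : ℕ) : IsClosed (D j) :=
    Metric.isClosed_closedBall.inter (Metric.isClosed_closedBall.preimage A.continuous)
  have hDo (j : ℕ) : IsOpen (D j) :=
    (IsUltrametricDist.isOpen_closedBall _ hr.ne').inter
      ((IsUltrametricDist.isOpen_closedBall _ (by positivity)).preimage A.continuous)
  have hE : IsCompact (Metric.closedBall (0 : Fin n → K) r) := isCompact_closedBall _ _
  have hDsub : D (j + 1) ⊆ D j := fun x hx => ⟨hx.1, Metric.closedBall_subset_closedBall (by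
    gcongr
    · exact hq.le
    · omega) hx.2⟩
  have hTD : T ⁻¹' (D (j + 1)) = D j := by
    ext x
    have h1 : ‖A (T x)‖ ≤ (q ^ (j + 1))⁻¹ ↔ ‖A x‖ ≤ (q ^ j)⁻¹ := by
      rw [hAT, norm_smul, hϖ, pow_succ, mul_inv_rev]
      exact mul_le_mul_iff_right₀ (by positivity)
    simp only [D, Set.mem_preimage, Set.mem_inter_iff, Metric.mem_closedBall, dist_zero_right, h1]
    refine and_congr_left fun hx => ?_
    have h2 : ‖(ϖ - 1) • P x‖ ≤ r := by
      rw [norm_smul]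
      refine (mul_le_of_le_one_left (norm_nonneg _) hϖ1).trans ?_
      refine (σ.le_opNorm (A x)).trans (le_trans ?_ hj)
      gcongr
    rw [hT]
    constructor
    · intro h3
      have := norm_sub_le_max' (x + (ϖ - 1) • P x) ((ϖ - 1) • P x)
      rw [add_sub_cancel_right] at this
      exact this.trans (max_le h3 h2)
    · intro h3
      exact (IsUltrametricDist.norm_add_le_max _ _).trans (max_le h3 h2)
  have hne {x} (k : ℕ) (hx : x ∈ Metric.closedBall 0 r \ D k) : A x ≠ 0 := fun h0 => by
    refine hx.2 ⟨hx.1, ?_⟩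
    rw [Set.mem_preimage, h0]
    exact Metric.mem_closedBall_self (by positivity)
  have hI₁ := rationalWithDenom_setIntegral_of_ne_zero hK μ (hE.diff (hDo j))
    A.continuous.continuousOn fun x hx => hne j hx
  have hI₂ := rationalWithDenom_setIntegral_of_ne_zero hK μ
    ((hE.inter_right (hDc j)).diff (hDo (j + 1))) A.continuous.continuousOn
      fun x hx => hne (j + 1) ⟨hx.1.1, hx.2⟩
  have hintegrable (s : ℂ) (hs : 0 < s.re) : IntegrableOn (fun x => ((‖A x‖ : ℝ) : ℂ) ^ s)
      (Metric.closedBall 0 r) μ :=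
    (continuous_norm_cpow A.continuous hs).continuousOn.integrableOn_compact hE
  have hJ : RationalWithDenom (residueCard K)
      (1 - C (((residueCard K : ℂ)⁻¹) ^ Module.finrank K (LinearMap.range A.toLinearMap)) * X)
      fun s => ∫ x in D j, ((‖A x‖ : ℝ) : ℂ) ^ s ∂μ := by
    obtain ⟨Q, e, h⟩ := hI₂
    refine ⟨Q, e, fun s hs => ?_⟩
    rw [← h s hs]
    have h0 : D j ⊆ Metric.closedBall 0 r := Set.inter_subset_left
    have h1 := setIntegral_sdiff (hDc (j + 1)).measurableSet ((hintegrable s hs).mono_set h0) hDsub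
    have h2 : Metric.closedBall 0 r ∩ D j = D j :=
      Set.inter_eq_right.2 Set.inter_subset_left
    simp only [h2]
    rw [h1, setIntegral_eq_haarScale_mul μ T (hDc (j + 1)).measurableSet, hTD]
    have h3 (x) : ((‖A (T x)‖ : ℝ) : ℂ) ^ s = (residueCard K : ℂ) ^ (-s) * ((‖A x‖ : ℝ) : ℂ) ^ s := by
      rw [hAT, norm_smul, hϖ, Complex.ofReal_mul,
        Complex.mul_cpow_ofReal_nonneg (by positivity) (norm_nonneg _)]
      congr 1
      have := ofReal_zpow_cpow (one_lt_residueCard hK) (-1) s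
      simpa [hqdef] using this
    simp only [h3, integral_const_mul]
    have h4 : ((haarScale T : ℝ) : ℂ) =
        ((residueCard K : ℂ)⁻¹) ^ Module.finrank K (LinearMap.range A.toLinearMap) := by
      rw [hscale, hqdef]; push_cast; rfl
    rw [h4]
    simp only [eval_sub, eval_one, eval_mul, eval_C, eval_X]
    ring
  refine ((hI₁.of_dvd (one_dvd _)).add hJ).congr fun s hs => ?_
  rw [Pi.add_apply, setIntegral_sdiff (hDc j).measurableSet (hintegrable s hs) Set.inter_subset_left,
    sub_add_cancel]

end LocalIntegrals

/-! ### Perturbations of the identity on balls -/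

section Isometry

open MeasureTheory Metric

theorem norm_eq_of_norm_sub_lt {E : Type*} [SeminormedAddCommGroup E] [IsUltrametricDist E]
    {x y : E} (h : ‖x - y‖ < ‖y‖) : ‖x‖ = ‖y‖ := by
  have := IsUltrametricDist.norm_add_eq_max_of_norm_ne_norm h.ne
  rwa [sub_add_cancel, max_eq_right h.le] at this

/-- In an ultrametric space a finite family of closed balls has a disjoint subfamily with the same
union. -/
theorem exists_disjoint_closedBall_subfamily {X : Type*} [MetricSpace X] [IsUltrametricDist X]
    (r : X → ℝ) (F : Finset X) :
    ∃ F' ⊆ F, (F' : Set X).PairwiseDisjoint (fun x => closedBall x (r x)) ∧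
      ⋃ x ∈ F', closedBall x (r x) = ⋃ x ∈ F, closedBall x (r x) := by
  classical
  induction F using Finset.induction_on with
  | empty => exact ⟨∅, subset_rfl, by simp, rfl⟩
  | insert a F ha ih =>
    obtain ⟨F', hF', hdisj, hun⟩ := ih
    by_cases h : ∃ x ∈ F', closedBall a (r a) ⊆ closedBall x (r x)
    · refine ⟨F', hF'.trans (Finset.subset_insert a F), hdisj, ?_⟩
      obtain ⟨x, hx, hax⟩ := h
      rw [Finset.set_biUnion_insert, ← hun, Set.union_eq_right.2]
      exact hax.trans (Set.subset_biUnion_of_mem (u := fun x => closedBall x (r x)) hx)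
    · push Not at h
      have key : ∀ x ∈ F', Disjoint (closedBall x (r x)) (closedBall a (r a)) ∨
          closedBall x (r x) ⊆ closedBall a (r a) := fun x hx => by
        rcases IsUltrametricDist.closedBall_subset_trichotomy x a (r x) (r a) with h' | h' | h'
        · exact Or.inr h'
        · exact absurd h' (h x hx)
        · exact Or.inl h'
      -- Balls that meet are nested, and the new ball lies in no old one. So the balls dropped here
      -- are swallowed by the new one and the union is unchanged.
      refine ⟨insert a (F'.filter fun x => Disjoint (closedBall x (r x)) (closedBall a (r a))),
        Finset.insert_subset_insert a ((Finset.filter_subset _ _).trans hF'), ?_, ?_⟩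
      · rw [Finset.coe_insert]
        refine Set.PairwiseDisjoint.insert (hdisj.subset fun x hx =>
          (Finset.mem_filter.1 hx).1) fun x hx _ => (Finset.mem_filter.1 hx).2.symm
      · rw [Finset.set_biUnion_insert, Finset.set_biUnion_insert, ← hun]
        ext y
        simp only [Set.mem_union, Set.mem_iUnion, Finset.mem_filter]
        constructor
        · rintro (h | ⟨x, ⟨hx, -⟩, hy⟩)
          · exact Or.inl h
          · exact Or.inr ⟨x, hx, hy⟩
        · rintro (h | ⟨x, hx, hy⟩)
          · exact Or.inl h
          · rcases key x hx with hd | hs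
            · exact Or.inr ⟨x, ⟨hx, hd⟩, hy⟩
            · exact Or.inl (hs hy)

variable {K : Type*} [NontriviallyNormedField K] [IsUltrametricDist K]
  [MeasurableSpace K] [BorelSpace K] [ProperSpace K] {n : ℕ}

theorem closedBall_inter_closedBall_self {X : Type*} [PseudoMetricSpace X] (x : X) (r δ : ℝ) :
    closedBall x r ∩ closedBall x δ = closedBall x (min r δ) := by
  ext y; simp

/-! ### Maps whose difference from the identity is a contraction -/

section NearId

variable {h : (Fin n → K) → (Fin n → K)} {u₁ : Fin n → K} {r c : ℝ} (hr : 0 < r) (hc : c < 1)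
  (hh : ∀ u ∈ closedBall u₁ r, ∀ u' ∈ closedBall u₁ r,
    ‖h u - h u' - (u - u')‖ ≤ c * ‖u - u'‖)
  (h₁ : ‖h u₁‖ ≤ r)

include hc hh in
-- The error is strictly smaller than the displacement, so by the ultrametric inequality it does not
-- affect the norm.
theorem dist_eq_of_near_id {u u' : Fin n → K} (hu : u ∈ closedBall u₁ r)
    (hu' : u' ∈ closedBall u₁ r) : dist (h u) (h u') = dist u u' := by
  rw [dist_eq_norm, dist_eq_norm]
  rcases eq_or_ne u u' with rfl | hne
  · simp
  have hpos : 0 < ‖u - u'‖ := norm_pos_iff.2 (sub_ne_zero.2 hne)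
  exact norm_eq_of_norm_sub_lt ((hh u hu u' hu').trans_lt (by nlinarith))

include hr hc hh h₁

theorem mapsTo_closedBall_of_near_id : Set.MapsTo h (closedBall u₁ r) (closedBall 0 r) := by
  intro u hu
  have h2 := dist_eq_of_near_id hc hh hu (mem_closedBall_self hr.le)
  rw [mem_closedBall, dist_zero_right]
  have h3 := IsUltrametricDist.norm_add_le_max (h u - h u₁) (h u₁)
  rw [sub_add_cancel, ← dist_eq_norm, h2] at h3
  exact h3.trans (max_le hu h₁)

theorem surjOn_closedBall_of_near_id : Set.SurjOn h (closedBall u₁ r) (closedBall 0 r) := by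
  intro w hw
  have hmaps := mapsTo_closedBall_of_near_id hr hc hh h₁
  -- A fixed point of f is a preimage of w, and f contracts by c on the complete ball.
  let f : (Fin n → K) → (Fin n → K) := fun u => u - (h u - w)
  have hf : Set.MapsTo f (closedBall u₁ r) (closedBall u₁ r) := by
    intro u hu
    have h1 : ‖h u - w‖ ≤ r := by
      rw [← dist_eq_norm]
      have h2 : dist (h u) 0 ≤ r := hmaps hu
      have h3 : dist 0 w ≤ r := by rw [dist_comm]; exact hw
      exact (dist_triangle_max _ 0 _).trans (max_le h2 h3)
    rw [mem_closedBall, dist_eq_norm]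
    have h2 := norm_sub_le_max' (u - u₁) (h u - w)
    have h3 : f u - u₁ = u - u₁ - (h u - w) := by simp only [f]; abel
    rw [h3]
    rw [mem_closedBall, dist_eq_norm] at hu
    exact h2.trans (max_le hu h1)
  have hcon : ContractingWith c.toNNReal (hf.restrict f _ _) := by
    refine ⟨by rwa [Real.toNNReal_lt_one], LipschitzWith.of_dist_le_mul fun u u' => ?_⟩
    change dist (f u) (f u') ≤ _ * dist (u : Fin n → K) u'
    rw [dist_eq_norm, dist_eq_norm]
    have h1 : f u - f u' = -(h u - h u' - (u - u')) := by simp only [f]; abel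
    rw [h1, norm_neg]
    refine (hh u u.2 u' u'.2).trans ?_
    gcongr
    exact Real.le_coe_toNNReal c
  obtain ⟨y, hy, hfix, -⟩ := hcon.exists_fixedPoint' isClosed_closedBall.isComplete hf
    (mem_closedBall_self hr.le) (edist_ne_top _ _)
  refine ⟨y, hy, ?_⟩
  have : y - (h y - w) = y := hfix
  exact sub_eq_zero.1 (sub_eq_self.1 this)

/-- A surjective isometry between balls pulls balls back to balls of the same radius, and Haar
measure depends only on the radius. Balls, with the empty set added, determine a finite Borel
measure. -/
theorem map_restrict_closedBall_of_near_id (μ : Measure (Fin n → K)) [μ.IsAddHaarMeasure] :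
    (μ.restrict (closedBall u₁ r)).map h = μ.restrict (closedBall 0 r) := by
  have hmaps := mapsTo_closedBall_of_near_id hr hc hh h₁
  have hsurj := surjOn_closedBall_of_near_id hr hc hh h₁
  have hcont : ContinuousOn h (closedBall u₁ r) := by
    refine LipschitzOnWith.continuousOn (K := 1) (LipschitzOnWith.of_dist_le_mul fun u hu u' hu' => ?_)
    rw [dist_eq_of_near_id hc hh hu hu', NNReal.coe_one, one_mul]
  have hmeas : AEMeasurable h (μ.restrict (closedBall u₁ r)) :=
    hcont.aemeasurable isClosed_closedBall.measurableSet
  have hfin (x : Fin n → K) : IsFiniteMeasure (μ.restrict (closedBall x r)) :=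
    isFiniteMeasure_restrict.2 (isCompact_closedBall x r).measure_lt_top.ne
  have := hfin u₁
  have := hfin 0
  let 𝒞 : Set (Set (Fin n → K)) := {s | ∃ w δ, 0 < δ ∧ s = closedBall w δ}
  have hbasis : TopologicalSpace.IsTopologicalBasis 𝒞 := by
    refine TopologicalSpace.isTopologicalBasis_of_isOpen_of_nhds ?_ ?_
    · rintro _ ⟨w, δ, hδ, rfl⟩
      exact IsUltrametricDist.isOpen_closedBall w hδ.ne'
    · intro w U hw hU
      obtain ⟨δ, hδ, hδU⟩ := nhds_basis_closedBall.mem_iff.1 (hU.mem_nhds hw)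
      exact ⟨_, ⟨w, δ, hδ, rfl⟩, mem_closedBall_self hδ.le, hδU⟩
  have hvol (x y : Fin n → K) (δ : ℝ) : μ (closedBall x δ) = μ (closedBall y δ) := by
    rw [Measure.addHaar_closedBall_center, Measure.addHaar_closedBall_center μ y]
  have hrestrict (w : Fin n → K) (δ : ℝ) :
      μ (h ⁻¹' closedBall w δ ∩ closedBall u₁ r) = μ (closedBall w δ ∩ closedBall 0 r) := by
    by_cases hne : (closedBall w δ ∩ closedBall 0 r).Nonempty
    · obtain ⟨w', hw', hw'0⟩ := hne
      obtain ⟨u', hu', rfl⟩ := hsurj hw'0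
      rw [IsUltrametricDist.closedBall_eq_of_mem hw', IsUltrametricDist.closedBall_eq_of_mem hw'0,
        IsUltrametricDist.closedBall_eq_of_mem hu', closedBall_inter_closedBall_self, hvol _ u',
        ← closedBall_inter_closedBall_self]
      congr 1
      ext u
      simp only [Set.mem_inter_iff, Set.mem_preimage, mem_closedBall]
      refine and_congr_left fun hu => ?_
      rw [dist_eq_of_near_id hc hh _ hu']
      rwa [IsUltrametricDist.closedBall_eq_of_mem hu']
    · rw [Set.not_nonempty_iff_eq_empty.1 hne, measure_empty]
      convert! measure_empty (μ := μ)
      rw [Set.eq_empty_iff_forall_notMem]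
      rintro u ⟨hu, hu'⟩
      exact hne ⟨h u, hu, hmaps hu'⟩
  -- Two balls that meet can be recentred at a common point, so their intersection is the smaller
  -- one and the family is a π-system.
  refine ext_of_generate_finite {s | s ∈ 𝒞 ∨ s = ∅} ?_ ?_ ?_ ?_
  · rw [BorelSpace.measurable_eq (α := Fin n → K), hbasis.borel_eq_generateFrom]
    apply le_antisymm
    · exact MeasurableSpace.generateFrom_mono fun s hs => Or.inl hs
    · refine MeasurableSpace.generateFrom_le fun s hs => ?_
      rcases hs with hs | rfl
      · exact MeasurableSpace.measurableSet_generateFrom hs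
      · exact @MeasurableSet.empty _ (MeasurableSpace.generateFrom 𝒞)
  · rintro s hs t ht ⟨x, hxs, hxt⟩
    rcases hs with ⟨w, δ, hδ, rfl⟩ | rfl
    · rcases ht with ⟨w', δ', hδ', rfl⟩ | rfl
      · left
        refine ⟨x, min δ δ', lt_min hδ hδ', ?_⟩
        rw [IsUltrametricDist.closedBall_eq_of_mem hxs, IsUltrametricDist.closedBall_eq_of_mem hxt,
          closedBall_inter_closedBall_self]
      · exact absurd hxt (Set.notMem_empty x)
    · exact absurd hxs (Set.notMem_empty x)
  · rintro s (⟨w, δ, hδ, rfl⟩ | rfl)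
    · rw [Measure.map_apply_of_aemeasurable hmeas isClosed_closedBall.measurableSet,
        Measure.restrict_apply' isClosed_closedBall.measurableSet,
        Measure.restrict_apply' isClosed_closedBall.measurableSet, hrestrict]
    · simp
  · rw [Measure.map_apply_of_aemeasurable hmeas MeasurableSet.univ]
    simp only [Set.preimage_univ, Measure.restrict_apply_univ]
    exact hvol _ _ _

theorem setIntegral_closedBall_of_near_id (μ : Measure (Fin n → K)) [μ.IsAddHaarMeasure]
    {φ : (Fin n → K) → ℂ} (hφ : Continuous φ) :
    ∫ u in closedBall u₁ r, φ (h u) ∂μ = ∫ w in closedBall 0 r, φ w ∂μ := by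
  rw [← map_restrict_closedBall_of_near_id hr hc hh h₁ μ, integral_map]
  · refine ContinuousOn.aemeasurable ?_ isClosed_closedBall.measurableSet
    refine LipschitzOnWith.continuousOn (K := 1) (LipschitzOnWith.of_dist_le_mul fun u hu u' hu' => ?_)
    rw [dist_eq_of_near_id hc hh hu hu', NNReal.coe_one, one_mul]
  · exact hφ.aestronglyMeasurable

end NearId

end Isometry

/-! ### Families of local integrals -/

section Families

open MeasureTheory Metric Polynomial

variable {K : Type*} [NontriviallyNormedField K] [IsUltrametricDist K]
  [MeasurableSpace K] [BorelSpace K] [ProperSpace K] {n l : ℕ}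
  {T : Type*} [TopologicalSpace T]

/-- For arbitrarily small balls around `u₁`, the integral of `‖g(u, t)‖^s` over the ball does not
depend on `t` near `t₁` and is rational in `q^{-s}` with denominator `D`. -/
def LocallyRational (μ : Measure (Fin n → K)) (D : ℂ[X]) (g : (Fin n → K) → T → (Fin l → K))
    (u₁ : Fin n → K) (t₁ : T) : Prop :=
  ∀ δ > 0, ∃ r, 0 < r ∧ r < δ ∧ ∃ R : ℂ → ℂ, RationalWithDenom (residueCard K) D R ∧
    ∀ᶠ t in 𝓝 t₁, ∀ s : ℂ, 0 < s.re →
      ∫ u in closedBall u₁ r, ((‖g u t‖ : ℝ) : ℂ) ^ s ∂μ = R s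

/-- Near `(u₁, t₁)` the maps `g(·, t)` are uniformly close to a fixed surjective linear map. -/
def UniformlySubmersiveAt (g : (Fin n → K) → T → (Fin l → K)) (u₁ : Fin n → K) (t₁ : T) : Prop :=
  ∃ (A : (Fin n → K) →L[K] (Fin l → K)) (σ : (Fin l → K) →L[K] (Fin n → K)) (c : ℝ),
    (∀ v, A (σ v) = v) ∧ c < 1 ∧ ∃ O ∈ 𝓝 u₁, ∀ᶠ t in 𝓝 t₁, ∀ u ∈ O, ∀ u' ∈ O,
      ‖σ (g u t - g u' t - A (u - u'))‖ ≤ c * ‖u - u'‖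

theorem LocallyRational.of_dvd {μ : Measure (Fin n → K)} {D D' : ℂ[X]}
    {g : (Fin n → K) → T → (Fin l → K)} {u₁ : Fin n → K} {t₁ : T}
    (h : LocallyRational μ D g u₁ t₁) (hD : D ∣ D') : LocallyRational μ D' g u₁ t₁ := by
  intro δ hδ
  obtain ⟨r, hr, hrδ, R, hR, h⟩ := h δ hδ
  exact ⟨r, hr, hrδ, R, hR.of_dvd hD, h⟩

variable (hK : IsNormalizedNorm K) (μ : Measure (Fin n → K)) [μ.IsAddHaarMeasure]
  {g : (Fin n → K) → T → (Fin l → K)} {u₁ : Fin n → K} {t₁ : T}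

include hK

/-- Near a nonzero value the ultrametric norm is constant, so each small ball contributes its
measure times one power. -/
theorem locallyRational_of_ne_zero
    (hg : Filter.Tendsto (fun p : (Fin n → K) × T => g p.1 p.2) (𝓝 (u₁, t₁)) (𝓝 (g u₁ t₁)))
    (h0 : g u₁ t₁ ≠ 0) : LocallyRational μ 1 g u₁ t₁ := by
  intro δ hδ
  have h1 : ∀ᶠ p : (Fin n → K) × T in 𝓝 (u₁, t₁), ‖g p.1 p.2‖ = ‖g u₁ t₁‖ := by
    filter_upwards [hg (ball_mem_nhds _ (norm_pos_iff.2 h0))] with p hp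
    refine norm_eq_of_norm_sub_lt ?_
    rw [← dist_eq_norm]
    exact hp
  rw [nhds_prod_eq] at h1
  obtain ⟨pa, ha, pb, hb, h1⟩ := Filter.eventually_prod_iff.1 h1
  obtain ⟨ρ, hρ, hρa⟩ := nhds_basis_closedBall.mem_iff.1 ha
  obtain ⟨k, hk⟩ := exists_norm_eq_zpow hK h0
  refine ⟨min ρ (δ / 2), by positivity, (min_le_right _ _).trans_lt (by linarith), _,
    (RationalWithDenom.zpow_cpow (one_lt_residueCard hK) k).const_mul
      (μ.real (closedBall u₁ (min ρ (δ / 2)))), ?_⟩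
  filter_upwards [hb] with t ht s _
  rw [setIntegral_congr_fun (g := fun _ => (((residueCard K : ℝ) ^ k : ℝ) : ℂ) ^ s)
    isClosed_closedBall.measurableSet, setIntegral_const, Complex.real_smul]
  intro u hu
  have := h1 (hρa (closedBall_subset_closedBall (min_le_left _ _) hu)) ht
  simp only [this, hk]

/-- The map h(u) = u - u₁ + σ(g(u, t) - A(u - u₁)) satisfies A ∘ h = g(·, t), because σ is a right
inverse of A, and it is close to the identity up to translation. Changing variables by h replaces
g(·, t) by A on a ball around 0, and t disappears. -/
theorem locallyRational_of_submersive (hg : ContinuousAt (g u₁) t₁) (h0 : g u₁ t₁ = 0)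
    (hs : UniformlySubmersiveAt g u₁ t₁) :
    LocallyRational μ (1 - C (((residueCard K : ℂ)⁻¹) ^ l) * X) g u₁ t₁ := by
  intro δ hδ
  obtain ⟨A, σ, c, hAσ, hc, O, hO, hs⟩ := hs
  obtain ⟨ρ, hρ, hρO⟩ := nhds_basis_closedBall.mem_iff.1 hO
  have hr : 0 < min ρ (δ / 2) := by positivity
  have hfin : Module.finrank K (LinearMap.range A.toLinearMap) = l := by
    rw [LinearMap.range_eq_top.2 fun v => ⟨σ v, hAσ v⟩]
    simp
  have hR := rationalWithDenom_setIntegral_linear hK μ A σ (fun w => hAσ _) hr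
  rw [hfin] at hR
  refine ⟨min ρ (δ / 2), hr, (min_le_right _ _).trans_lt (by linarith), _, hR, ?_⟩
  -- This is the norm of h(u₁). It must not exceed the radius for the image to be the ball centred
  -- at 0.
  have h1 : ∀ᶠ t in 𝓝 t₁, ‖σ (g u₁ t)‖ ≤ min ρ (δ / 2) := by
    have h2 : ContinuousAt (fun t => ‖σ (g u₁ t)‖) t₁ := (σ.continuous.continuousAt.comp hg).norm
    have h3 : ‖σ (g u₁ t₁)‖ < min ρ (δ / 2) := by rw [h0]; simpa using hr
    exact (h2.eventually_lt continuousAt_const h3).mono fun t => le_of_lt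
  filter_upwards [h1, hs] with t ht hst s hs
  let h : (Fin n → K) → (Fin n → K) := fun u => u - u₁ + σ (g u t - A (u - u₁))
  have hAh (u) : A (h u) = g u t := by
    simp only [h, map_add, hAσ, add_sub_cancel]
  have hsub : closedBall u₁ (min ρ (δ / 2)) ⊆ O :=
    (closedBall_subset_closedBall (min_le_left _ _)).trans hρO
  have := setIntegral_closedBall_of_near_id (h := h) (u₁ := u₁) hr hc
    (fun u hu u' hu' => by
      convert! hst u (hsub hu) u' (hsub hu') using 2
      simp only [h, map_sub]
      abel) (by simpa [h] using ht) μ (continuous_norm_cpow A.continuous hs)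
  simp only [hAh] at this
  exact this

/-- An injective derivative dominates the remainder, so near u₁ the norm of g equals that of its
linear part. Independence of t is free because t₁ is isolated. -/
theorem locallyRational_of_immersive (ht : 𝓝 t₁ = pure t₁) (h0 : g u₁ t₁ = 0)
    (A : (Fin n → K) →L[K] (Fin l → K)) (σ : (Fin l → K) →L[K] (Fin n → K))
    (hσ : ∀ w, σ (A w) = w) (hA : HasFDerivAt (fun u => g u t₁) A u₁) :
    LocallyRational μ (1 - C (((residueCard K : ℂ)⁻¹) ^ n) * X) g u₁ t₁ := by
  intro δ hδ
  have hfin : Module.finrank K (LinearMap.range A.toLinearMap) = n := by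
    rw [LinearMap.finrank_range_of_inj (Function.LeftInverse.injective (g := σ) hσ)]
    simp
  -- Since `‖w‖ ≤ ‖σ‖ * ‖A w‖`, a remainder of at most `(‖σ‖ + 1)⁻¹ * ‖w‖` is strictly smaller than
  -- `‖A w‖` for w ≠ 0.
  have hε : 0 < (‖σ‖ + 1)⁻¹ := by positivity
  obtain ⟨ρ, hρ, hρO⟩ := nhds_basis_closedBall.mem_iff.1 (hA.isLittleO.def hε)
  have hr : 0 < min ρ (δ / 2) := by positivity
  have hR := rationalWithDenom_setIntegral_linear hK μ A σ (fun w => by rw [hσ]) hr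
  rw [hfin] at hR
  refine ⟨min ρ (δ / 2), hr, (min_le_right _ _).trans_lt (by linarith), _, hR, ?_⟩
  rw [ht, Filter.eventually_pure]
  intro s hs
  have h1 : ∀ u ∈ closedBall u₁ (min ρ (δ / 2)), ‖g u t₁‖ = ‖A (u - u₁)‖ := by
    intro u hu
    rcases eq_or_ne u u₁ with rfl | hne
    · simp [h0]
    have h2 : ‖g u t₁ - g u₁ t₁ - A (u - u₁)‖ ≤ (‖σ‖ + 1)⁻¹ * ‖u - u₁‖ :=
      hρO (closedBall_subset_closedBall (min_le_left _ _) hu)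
    rw [h0, sub_zero] at h2
    refine norm_eq_of_norm_sub_lt (h2.trans_lt ?_)
    have h3 : ‖u - u₁‖ ≤ ‖σ‖ * ‖A (u - u₁)‖ := by
      conv_lhs => rw [← hσ (u - u₁)]
      exact σ.le_opNorm _
    have h4 : 0 < ‖u - u₁‖ := norm_pos_iff.2 (sub_ne_zero.2 hne)
    have h5 : 0 < ‖A (u - u₁)‖ := by
      by_contra! h
      have := le_antisymm h (norm_nonneg _)
      rw [this, mul_zero] at h3
      linarith
    rw [inv_mul_lt_iff₀ (by positivity)]
    linarith
  rw [setIntegral_congr_fun (g := fun u => ((‖A (u - u₁)‖ : ℝ) : ℂ) ^ s)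
    isClosed_closedBall.measurableSet fun u hu => by simp only [h1 u hu]]
  rw [← integral_indicator isClosed_closedBall.measurableSet,
    ← integral_indicator isClosed_closedBall.measurableSet,
    ← integral_sub_right_eq_self ((closedBall 0 (min ρ (δ / 2))).indicator
      fun x => ((‖A x‖ : ℝ) : ℂ) ^ s) u₁]
  congr 1
  ext u
  simp only [Set.indicator, mem_closedBall, dist_eq_norm, sub_zero]

/-- The integral over a compact open set of a locally constant weight times `‖g(u, t)‖^s` is
locally independent of `t` and rational in `q^{-s}` if this holds locally. -/
theorem exists_rational_integral_of_locallyRational {D : ℂ[X]} {Ω : Set (Fin n → K)}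
    (hΩ : IsCompact Ω) (hΩo : IsOpen Ω) {Φ : (Fin n → K) → T → ℂ}
    (hΦ : ∀ u ∈ Ω, ∀ᶠ p : (Fin n → K) × T in 𝓝 (u, t₁), Φ p.1 p.2 = Φ u t₁)
    (hg : ∀ t, ContinuousOn (fun u => g u t) Ω)
    (h : ∀ u ∈ Ω, Φ u t₁ = 0 ∨ LocallyRational μ D g u t₁) :
    ∃ R, RationalWithDenom (residueCard K) D R ∧ ∀ᶠ t in 𝓝 t₁, ∀ s : ℂ, 0 < s.re →
      ∫ u in Ω, Φ u t * ((‖g u t‖ : ℝ) : ℂ) ^ s ∂μ = R s := by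
  have key : ∀ u ∈ Ω, ∃ r, 0 < r ∧ closedBall u r ⊆ Ω ∧ ∃ R,
      RationalWithDenom (residueCard K) D R ∧ ∀ᶠ t in 𝓝 t₁, ∀ s : ℂ, 0 < s.re →
        IntegrableOn (fun u => Φ u t * ((‖g u t‖ : ℝ) : ℂ) ^ s) (closedBall u r) μ ∧
        ∫ u in closedBall u r, Φ u t * ((‖g u t‖ : ℝ) : ℂ) ^ s ∂μ = R s := by
    intro u hu
    have h1 := hΦ u hu
    rw [nhds_prod_eq] at h1
    obtain ⟨pa, ha, pb, hb, h1⟩ := Filter.eventually_prod_iff.1 h1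
    obtain ⟨ρ, hρ, hρa⟩ := nhds_basis_closedBall.mem_iff.1 ha
    obtain ⟨ρ', hρ', hρΩ⟩ := nhds_basis_closedBall.mem_iff.1 (hΩo.mem_nhds hu)
    have hcongr (r : ℝ) (hr : r ≤ min ρ ρ') (t : T) (ht : pb t) (s : ℂ) :
        Set.EqOn (fun u => Φ u t * ((‖g u t‖ : ℝ) : ℂ) ^ s)
          (fun v => Φ u t₁ * ((‖g v t‖ : ℝ) : ℂ) ^ s) (closedBall u r) := by
      intro v hv
      have := h1 (hρa (closedBall_subset_closedBall (hr.trans (min_le_left _ _)) hv)) ht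
      simp only [this]
    have hintegrable (r : ℝ) (hr : r ≤ min ρ ρ') (t : T) (ht : pb t) (s : ℂ) (hs : 0 < s.re) :
        IntegrableOn (fun u => Φ u t * ((‖g u t‖ : ℝ) : ℂ) ^ s) (closedBall u r) μ := by
      rw [integrableOn_congr_fun (hcongr r hr t ht s) isClosed_closedBall.measurableSet]
      refine ContinuousOn.integrableOn_compact (isCompact_closedBall _ _) ?_
      refine continuousOn_const.mul ?_
      exact (Complex.continuous_ofReal_cpow_const hs).comp_continuousOn ((hg t).norm.mono
        ((closedBall_subset_closedBall (hr.trans (min_le_right _ _))).trans hρΩ))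
    -- Where the weight vanishes nothing is required of g. This is what lets the support of Φ hide
    -- the parameters that lie far from the origin.
    rcases h u hu with h | h
    · refine ⟨min ρ ρ', by positivity,
        (closedBall_subset_closedBall (min_le_right _ _)).trans hρΩ, 0, RationalWithDenom.zero, ?_⟩
      filter_upwards [hb] with t ht s hs
      refine ⟨hintegrable _ le_rfl t ht s hs, ?_⟩
      rw [setIntegral_congr_fun isClosed_closedBall.measurableSet (hcongr _ le_rfl t ht s), h]
      simp
    · obtain ⟨r, hr, hrδ, R, hR, h⟩ := h (min ρ ρ') (by positivity)
      refine ⟨r, hr, (closedBall_subset_closedBall (hrδ.le.trans (min_le_right _ _))).trans hρΩ,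
        _, hR.const_mul (Φ u t₁), ?_⟩
      filter_upwards [hb, h] with t ht h s hs
      refine ⟨hintegrable r hrδ.le t ht s hs, ?_⟩
      rw [setIntegral_congr_fun isClosed_closedBall.measurableSet (hcongr r hrδ.le t ht s),
        integral_const_mul, h s hs]
  choose! r hr hrΩ R hR hev using key
  obtain ⟨F, hF, hcov⟩ := hΩ.elim_nhds_subcover (fun u => closedBall u (r u))
    fun u hu => closedBall_mem_nhds u (hr u hu)
  -- A finite subcover by balls refines to a partition, so the integral is exactly a finite sum of
  -- local ones.
  obtain ⟨F', hF', hdisj, hun⟩ := exists_disjoint_closedBall_subfamily r F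
  have hΩeq : Ω = ⋃ u ∈ F', closedBall u (r u) := by
    refine subset_antisymm (hun ▸ hcov) (Set.iUnion₂_subset fun u hu => hrΩ u (hF u (hF' hu)))
  refine ⟨∑ u ∈ F', R u, RationalWithDenom.sum _ fun u hu => hR u (hF u (hF' hu)), ?_⟩
  have : ∀ᶠ t in 𝓝 t₁, ∀ u ∈ F', ∀ s : ℂ, 0 < s.re →
      IntegrableOn (fun u => Φ u t * ((‖g u t‖ : ℝ) : ℂ) ^ s) (closedBall u (r u)) μ ∧
      ∫ u in closedBall u (r u), Φ u t * ((‖g u t‖ : ℝ) : ℂ) ^ s ∂μ = R u s := by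
    rw [Filter.eventually_all_finset]
    exact fun u hu => hev u (hF u (hF' hu))
  filter_upwards [this] with t ht s hs
  rw [hΩeq, integral_biUnion_finset _ (fun u _ => isClosed_closedBall.measurableSet) hdisj
    (fun u hu => (ht u hu s hs).1), Finset.sum_apply]
  exact Finset.sum_congr rfl fun u hu => (ht u hu s hs).2

end Families

/-! ### Sums over cones -/

section ConeSums

open Polynomial

/-- A locally constant function on `(ℕ ∪ {∞})^κ` only depends on the truncations of its arguments
at some `N`. -/
theorem IsLocallyConstant.exists_truncation {κ α : Type*} [Finite κ] {G : (κ → ℕ∞) → α}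
    (hG : IsLocallyConstant G) :
    ∃ N : ℕ, ∀ t : κ → ℕ, G (fun i => t i) = G fun i => (min (t i) N : ℕ) := by
  by_contra! h
  choose t ht using h
  -- The counterexamples t N and their truncations at N have the same limit along a free
  -- ultrafilter, because N tends to ∞. Local constancy at this limit contradicts the choice of t N.
  let U : Ultrafilter (κ → ℕ∞) := (Filter.hyperfilter ℕ).map fun N i => (t N i : ℕ∞)
  obtain ⟨x, -, hx⟩ := isCompact_univ.ultrafilter_le_nhds U (by simp)
  have h1 : Filter.Tendsto (fun N i => (t N i : ℕ∞)) (Filter.hyperfilter ℕ) (𝓝 x) := hx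
  have h2 : Filter.Tendsto (fun (N : ℕ) i => ((min (t N i) N : ℕ) : ℕ∞)) (Filter.hyperfilter ℕ)
      (𝓝 x) := by
    rw [tendsto_pi_nhds] at h1 ⊢
    intro i
    have h3 : Filter.Tendsto (fun N : ℕ => (N : ℕ∞)) (Filter.hyperfilter ℕ) (𝓝 ⊤) :=
      ENat.tendsto_natCast_nhds_top.mono_left Nat.hyperfilter_le_atTop
    have h4 := (h1 i).min h3
    rw [min_top_right] at h4
    exact h4.congr fun N => ((Nat.mono_cast (α := ℕ∞)).map_min).symm
  have h5 := IsLocallyConstant.eventually_eq hG x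
  obtain ⟨N, hN, hN'⟩ := ((h1.eventually h5).and (h2.eventually h5)).exists
  exact ht N (hN.trans hN'.symm)

theorem hasSum_prod_fin {r : ℕ} (f : Fin r → ℕ → ℂ) (hf : ∀ i, Summable fun k => ‖f i k‖) :
    (Summable fun t : Fin r → ℕ => ‖∏ i, f i (t i)‖) ∧
      HasSum (fun t : Fin r → ℕ => ∏ i, f i (t i)) (∏ i, ∑' k, f i k) := by
  induction r with
  | zero =>
    refine ⟨(hasSum_unique _).summable, ?_⟩
    simp
  | succ r ih =>
    obtain ⟨ih1, ih2⟩ := ih (fun i => f i.succ) fun i => hf i.succ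
    have h1 := Summable.mul_norm (hf 0) ih1
    have h2 := (hf 0).of_norm.hasSum.mul ih2 h1.of_norm
    have e : ∀ p : ℕ × (Fin r → ℕ), ∏ i, f i (Fin.consEquiv (fun _ => ℕ) p i) =
        f 0 p.1 * ∏ i, f i.succ (p.2 i) := fun p => by
      rw [Fin.prod_univ_succ]; simp [Fin.consEquiv]
    constructor
    · rw [← (Fin.consEquiv fun _ => ℕ).summable_iff]
      simpa only [Function.comp_def, e] using h1
    · rw [← (Fin.consEquiv fun _ => ℕ).hasSum_iff, Fin.prod_univ_succ]
      simpa only [Function.comp_def, e] using h2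

theorem hasSum_prod_pi {κ : Type*} [Fintype κ] (f : κ → ℕ → ℂ)
    (hf : ∀ i, Summable fun k => ‖f i k‖) :
    HasSum (fun t : κ → ℕ => ∏ i, f i (t i)) (∏ i, ∑' k, f i k) := by
  let e := (Fintype.equivFin κ).symm
  have h := (hasSum_prod_fin (fun j => f (e j)) fun j => hf (e j)).2
  rw [e.prod_comp (fun i => ∑' k, f i k)] at h
  rw [← (Equiv.arrowCongr e (Equiv.refl ℕ)).hasSum_iff]
  convert! h using 2 with t
  rw [Function.comp_apply, ← e.prod_comp]
  simp [Equiv.arrowCongr]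

/-- Group the t by their truncation t' at N. On each group H is constant and the sum is a product
over i: a single power if t'ᵢ < N, and the geometric tail starting at N if t'ᵢ = N. -/
theorem hasSum_prod_pow_mul_of_truncation {κ : Type*} [Fintype κ] [DecidableEq κ] (w : κ → ℂ)
    (hw : ∀ i, ‖w i‖ < 1) (N : ℕ) (H : (κ → ℕ) → ℂ) (hH : ∀ t, H t = H fun i => min (t i) N) :
    HasSum (fun t : κ → ℕ => (∏ i, w i ^ t i) * H t)
      (∑ t ∈ Fintype.piFinset fun _ : κ => Finset.range (N + 1),
        H t * ∏ i, if t i < N then w i ^ t i else w i ^ N * (1 - w i)⁻¹) := by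
  have h1 : ∀ t : κ → ℕ, (∏ i, w i ^ t i) * H t =
      ∑ t' ∈ Fintype.piFinset fun _ : κ => Finset.range (N + 1),
        H t' * ∏ i, if min (t i) N = t' i then w i ^ t i else 0 := by
    intro t
    rw [Finset.sum_eq_single fun i => min (t i) N]
    · simp [← hH t, mul_comm]
    · intro t' _ hne
      obtain ⟨i, hi⟩ := Function.ne_iff.1 hne
      rw [Finset.prod_eq_zero (Finset.mem_univ i) (if_neg (Ne.symm hi)), mul_zero]
    · intro h
      exact absurd (Fintype.mem_piFinset.2 fun i => by simp) h
  simp only [h1]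
  refine hasSum_sum fun t' ht' => HasSum.mul_left _ ?_
  have h2 : ∀ i, HasSum (fun k => if min k N = t' i then w i ^ k else 0)
      (if t' i < N then w i ^ t' i else w i ^ N * (1 - w i)⁻¹) := by
    intro i
    have hti : t' i ≤ N := Nat.lt_succ_iff.1 (Finset.mem_range.1 (Fintype.mem_piFinset.1 ht' i))
    split_ifs with h
    · convert! hasSum_ite_eq (t' i) (w i ^ t' i) using 2 with k
      by_cases hk : k = t' i
      · subst hk; simp [h.le]
      · rw [if_neg, if_neg hk]
        omega
    · have hN : t' i = N := by omega
      rw [hN]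
      rw [← hasSum_nat_add_iff' N]
      rw [Finset.sum_eq_zero, sub_zero]
      · convert! (hasSum_geometric_of_norm_lt_one (hw i)).mul_left (w i ^ N) using 2 with k
        rw [if_pos (by omega), pow_add, mul_comm]
      · intro k hk
        rw [Finset.mem_range] at hk
        rw [if_neg (by omega)]
  have h3 : ∀ i, Summable fun k => ‖if min k N = t' i then w i ^ k else 0‖ := fun i => by
    refine Summable.of_nonneg_of_le (fun k => norm_nonneg _) (fun k => ?_)
      (summable_geometric_of_norm_lt_one (x := ‖w i‖) (by simpa using hw i))
    split_ifs
    · simp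
    · simp
  have h4 := hasSum_prod_pi _ h3
  simpa only [(h2 _).tsum_eq] using h4

theorem RationalWithDenom.prod {q : ℕ} {κ : Type*} (t : Finset κ) {D : κ → ℂ[X]} {I : κ → ℂ → ℂ}
    (h : ∀ i ∈ t, RationalWithDenom q (D i) (I i)) :
    RationalWithDenom q (∏ i ∈ t, D i) (∏ i ∈ t, I i) := by
  classical
  induction t using Finset.induction_on with
  | empty => simpa using! RationalWithDenom.const (q := q) 1
  | insert i t hi ih =>
    rw [Finset.prod_insert hi, Finset.prod_insert hi]
    exact (h i (Finset.mem_insert_self i t)).mul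
      (ih fun j hj => h j (Finset.mem_insert_of_mem hj))

/-- The polynomial `1 - q^{-σ} X^d`. -/
noncomputable def poleFactor (q σ d : ℕ) : ℂ[X] := 1 - C (((q : ℂ)⁻¹) ^ σ) * X ^ d

theorem norm_natCast_cpow_neg_lt_one {q : ℕ} (hq : 1 < q) {s : ℂ} (hs : 0 < s.re) :
    ‖(q : ℂ) ^ (-s)‖ < 1 := by
  rw [Complex.norm_natCast_cpow_of_pos (by omega), Complex.neg_re]
  exact Real.rpow_lt_one_of_one_lt_of_neg (by exact_mod_cast hq) (by linarith)

theorem norm_inv_pow_mul_cpow_pow_lt_one {q : ℕ} (hq : 1 < q) {σ d : ℕ} (hσ : 0 < σ) {s : ℂ}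
    (hs : 0 < s.re) : ‖((q : ℂ)⁻¹) ^ σ * ((q : ℂ) ^ (-s)) ^ d‖ < 1 := by
  rw [norm_mul, norm_pow, norm_pow, norm_inv, Complex.norm_natCast]
  refine mul_lt_one_of_nonneg_of_lt_one_left (by positivity)
    (pow_lt_one₀ (by positivity) (inv_lt_one_of_one_lt₀ (by exact_mod_cast hq)) hσ.ne')
    (pow_le_one₀ (norm_nonneg _) (norm_natCast_cpow_neg_lt_one hq hs).le)

/-- Local constancy up to infinity makes G depend only on a truncation of t. The sum is then a
finite combination of products of powers and geometric series with ratios q^(-σᵢ - s dᵢ). -/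
theorem exists_rational_hasSum_cone {q : ℕ} (hq : 1 < q) {κ : Type*} [Fintype κ] (σ d : κ → ℕ)
    (hσ : ∀ i, 0 < σ i) {D : ℂ[X]} (G : (κ → ℕ∞) → ℂ → ℂ)
    (hG : ∀ t₁, ∃ R, RationalWithDenom q D R ∧ ∀ᶠ t in 𝓝 t₁, ∀ s : ℂ, 0 < s.re → G t s = R s) :
    ∃ Z, RationalWithDenom q (D * ∏ i, poleFactor q (σ i) (d i)) Z ∧ ∀ s : ℂ, 0 < s.re →
      HasSum (fun t : κ → ℕ => (∏ i, (((q : ℂ)⁻¹) ^ σ i * ((q : ℂ) ^ (-s)) ^ d i) ^ t i) *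
        G (fun i => t i) s) (Z s) := by
  classical
  -- The values are taken as functions of s on the half plane, so that one truncation bound serves
  -- all s.
  have hloc : IsLocallyConstant fun t (s : {s : ℂ // 0 < s.re}) => G t s := by
    rw [IsLocallyConstant.iff_eventually_eq]
    intro t₁
    obtain ⟨R, -, h⟩ := hG t₁
    have h₁ := h.self_of_nhds
    filter_upwards [h] with t ht
    ext s
    rw [ht s s.2, h₁ s s.2]
  obtain ⟨N, hN⟩ := hloc.exists_truncation
  refine ⟨_, ?_, fun s hs => hasSum_prod_pow_mul_of_truncation _
    (fun i => norm_inv_pow_mul_cpow_pow_lt_one hq (hσ i) hs) N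
    (fun t => G (fun i => t i) s) fun t => congrFun (hN t) ⟨s, hs⟩⟩
  have h1 : ∀ t : κ → ℕ, RationalWithDenom q D (G fun i => t i) := fun t => by
    obtain ⟨R, hR, h⟩ := hG fun i => t i
    exact hR.congr h.self_of_nhds
  have h2 : ∀ (i : κ) (k : ℕ), RationalWithDenom q (poleFactor q (σ i) (d i)) fun s =>
      if k < N then (((q : ℂ)⁻¹) ^ σ i * ((q : ℂ) ^ (-s)) ^ d i) ^ k
      else (((q : ℂ)⁻¹) ^ σ i * ((q : ℂ) ^ (-s)) ^ d i) ^ N *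
        (1 - ((q : ℂ)⁻¹) ^ σ i * ((q : ℂ) ^ (-s)) ^ d i)⁻¹ := by
    intro i k
    by_cases hk : k < N
    · refine ⟨(C (((q : ℂ)⁻¹) ^ σ i) * X ^ d i) ^ k * poleFactor q (σ i) (d i), 0, fun s _ => ?_⟩
      simp [hk]
    · refine ⟨(C (((q : ℂ)⁻¹) ^ σ i) * X ^ d i) ^ N, 0, fun s hs => ?_⟩
      have h3 : 1 - ((q : ℂ)⁻¹) ^ σ i * ((q : ℂ) ^ (-s)) ^ d i ≠ 0 := by
        intro h
        have := norm_inv_pow_mul_cpow_pow_lt_one (d := d i) hq (hσ i) hs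
        rw [← sub_eq_zero.1 h, norm_one] at this
        exact lt_irrefl _ this
      simp only [hk, if_false, poleFactor, pow_zero, mul_one, eval_sub, eval_one, eval_mul, eval_C,
        eval_pow, eval_X]
      rw [mul_assoc, inv_mul_cancel₀ h3, mul_one]
  refine (RationalWithDenom.sum (Fintype.piFinset fun _ : κ => Finset.range (N + 1)) fun t _ =>
    (h1 t).mul (RationalWithDenom.prod Finset.univ fun i _ => h2 i (t i))).congr fun s _ => ?_
  simp only [Finset.sum_apply, Pi.mul_apply, Finset.prod_apply]

end ConeSums

/-! ### Lexicographically minimal conic combinations -/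

section Triangulation

/-- The lexicographic order on tuples of reals. -/
def LexLt {N : ℕ} (x y : Fin N → ℝ) : Prop := ∃ i, x i < y i ∧ ∀ j < i, x j = y j

theorem LexLt.trichotomy {N : ℕ} {x y : Fin N → ℝ} (h : x ≠ y) : LexLt x y ∨ LexLt y x := by
  classical
  have hne : (Finset.univ.filter fun i => x i ≠ y i).Nonempty := by
    obtain ⟨i, hi⟩ := Function.ne_iff.1 h
    exact ⟨i, by simpa using hi⟩
  obtain ⟨i, hi⟩ : ∃ i, i = (Finset.univ.filter fun i => x i ≠ y i).min' hne := ⟨_, rfl⟩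
  have h1 : x i ≠ y i := by
    have := Finset.min'_mem _ hne
    rw [← hi] at this
    simpa using this
  have h2 : ∀ j < i, x j = y j := fun j hj => by
    by_contra hc
    have := Finset.min'_le (Finset.univ.filter fun i => x i ≠ y i) j (by simpa using hc)
    rw [← hi] at this
    exact absurd hj (not_lt.2 this)
  rcases lt_or_gt_of_ne h1 with h3 | h3
  · exact Or.inl ⟨i, h3, h2⟩
  · exact Or.inr ⟨i, h3, fun j hj => (h2 j hj).symm⟩

theorem LexLt.add_smul_sub {N : ℕ} {x y : Fin N → ℝ} (h : LexLt x y) (z : Fin N → ℝ) {ε : ℝ}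
    (hε : 0 < ε) : LexLt (z + ε • (x - y)) z := by
  obtain ⟨i, hi, hj⟩ := h
  refine ⟨i, ?_, fun j hji => ?_⟩
  · simp only [Pi.add_apply, Pi.smul_apply, Pi.sub_apply, smul_eq_mul]
    nlinarith
  · simp [hj j hji]

theorem IsCompact.exists_lexMin {N : ℕ} {C : Set (Fin N → ℝ)} (hC : IsCompact C)
    (hne : C.Nonempty) : ∃ x ∈ C, ∀ y ∈ C, ¬ LexLt y x := by
  -- Minimize one coordinate after the other. Membership of a point of C in C' depends only on its
  -- first k coordinates, which makes C' large enough for the next minimization.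
  have key : ∀ k ≤ N, ∃ C' ⊆ C, IsCompact C' ∧ C'.Nonempty ∧
      (∀ x ∈ C', ∀ y ∈ C, (∀ j : Fin N, (j : ℕ) < k → y j = x j) → y ∈ C') ∧
      ∀ x ∈ C', ∀ y ∈ C, ∀ i : Fin N, (i : ℕ) < k → (∀ j < i, y j = x j) → x i ≤ y i := by
    intro k
    induction k with
    | zero =>
      exact fun _ => ⟨C, subset_rfl, hC, hne, fun x _ y hy _ => hy,
        fun x _ y _ i hi => absurd hi (by omega)⟩
    | succ k ih =>
      intro hk
      obtain ⟨C', hC', hcomp, hne', hinv, hmin⟩ := ih (by omega)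
      have hcont : Continuous fun x : Fin N → ℝ => x ⟨k, hk⟩ := continuous_apply _
      obtain ⟨x₀, hx₀, hx₀min⟩ := hcomp.exists_isMinOn hne' hcont.continuousOn
      refine ⟨C' ∩ {x | x ⟨k, hk⟩ ≤ x₀ ⟨k, hk⟩}, Set.inter_subset_left.trans hC',
        hcomp.inter_right (isClosed_le hcont continuous_const),
        ⟨x₀, hx₀, le_refl (x₀ ⟨k, hk⟩)⟩, ?_, ?_⟩
      · rintro x ⟨hx, hxle⟩ y hy hyx
        refine ⟨hinv x hx y hy fun j hj => hyx j (by omega), ?_⟩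
        change y ⟨k, hk⟩ ≤ _
        rw [hyx ⟨k, hk⟩ (by simp)]
        exact hxle
      · rintro x ⟨hx, hxle⟩ y hy i hi hji
        rcases Nat.lt_succ_iff_lt_or_eq.1 hi with hi | hi
        · exact hmin x hx y hy i hi hji
        · obtain rfl : i = ⟨k, hk⟩ := Fin.ext hi
          exact hxle.out.trans (hx₀min (hinv x hx y hy fun j hj => hji j hj))
  obtain ⟨C', hC', -, ⟨x, hx⟩, -, hmin⟩ := key N le_rfl
  refine ⟨x, hC' hx, fun y hy ⟨i, hi, hji⟩ => ?_⟩
  exact absurd hi (not_lt.2 (hmin x hx y hy i i.2 hji))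

/-- The cone generated by finitely many vectors in an open half space has a triangulation without
new rays. -/
theorem exists_conic_triangulation {N : ℕ} {E : Type*} [NormedAddCommGroup E] [NormedSpace ℝ E]
    (a : Fin N → E) (ℓ : E →L[ℝ] ℝ) (hℓ : ∀ i, 1 ≤ ℓ (a i)) :
    ∃ 𝒮 : Set (Finset (Fin N)),
      (∀ x : E, (∃ c : Fin N → ℝ, 0 ≤ c ∧ ∑ i, c i • a i = x) →
        ∃ c : Fin N → ℝ, 0 ≤ c ∧ ∑ i, c i • a i = x ∧ (Finset.univ.filter fun i => c i ≠ 0) ∈ 𝒮) ∧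
      ∀ c c' : Fin N → ℝ, 0 ≤ c → 0 ≤ c' → (Finset.univ.filter fun i => c i ≠ 0) ∈ 𝒮 →
        (Finset.univ.filter fun i => c' i ≠ 0) ∈ 𝒮 → ∑ i, c i • a i = ∑ i, c' i • a i → c = c' := by
  classical
  let IsMin : (Fin N → ℝ) → Prop := fun c => 0 ≤ c ∧
    ∀ c' : Fin N → ℝ, 0 ≤ c' → ∑ i, c' i • a i = ∑ i, c i • a i → ¬ LexLt c' c
  -- Minimality passes to every c supported in the support of c₀: if c' beats c, then c₀ + ε (c' -
  -- c) beats c₀, and it is nonnegative for small ε. So minimality is a property of the support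
  -- alone.
  have hsupp {c c₀ : Fin N → ℝ} (hc₀ : IsMin c₀) (hc : 0 ≤ c)
      (hcc : ∀ i, c₀ i = 0 → c i = 0) : IsMin c := by
    refine ⟨hc, fun c' hc' hsum hlt => ?_⟩
    obtain ⟨ε, hε, hεc⟩ : ∃ ε : ℝ, 0 < ε ∧ ∀ i, ε * c i ≤ c₀ i := by
      have h1 : ∀ i, ∃ ε : ℝ, 0 < ε ∧ ε * c i ≤ c₀ i := fun i => by
        by_cases h : c₀ i = 0
        · exact ⟨1, one_pos, by rw [h, hcc i h, mul_zero]⟩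
        · have h2 : 0 < c₀ i := lt_of_le_of_ne (hc₀.1 i) (Ne.symm h)
          have h3 : 0 ≤ c i := hc i
          refine ⟨c₀ i / (c i + 1), by positivity, ?_⟩
          rw [div_mul_eq_mul_div, div_le_iff₀ (by positivity)]
          nlinarith
      choose ε hε hεc using h1
      by_cases hN : Nonempty (Fin N)
      · obtain ⟨i₀, -, hi₀⟩ := Finset.exists_min_image Finset.univ ε Finset.univ_nonempty
        exact ⟨ε i₀, hε i₀, fun i => (mul_le_mul_of_nonneg_right (hi₀ i (Finset.mem_univ i))
          (hc i)).trans (hεc i)⟩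
      · exact ⟨1, one_pos, fun i => absurd ⟨i⟩ hN⟩
    refine hc₀.2 (c₀ + ε • (c' - c)) ?_ ?_ (hlt.add_smul_sub c₀ hε)
    · intro i
      have h1 : 0 ≤ ε * c' i := mul_nonneg hε.le (hc' i)
      have h2 := hεc i
      simp only [Pi.zero_apply, Pi.add_apply, Pi.smul_apply, Pi.sub_apply, smul_eq_mul]
      linarith
    · simp only [Pi.add_apply, Pi.smul_apply, Pi.sub_apply, smul_eq_mul, add_smul, mul_smul,
        Finset.sum_add_distrib, ← Finset.smul_sum, sub_smul, Finset.sum_sub_distrib, hsum]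
      simp
  refine ⟨{S | ∃ c, IsMin c ∧ (Finset.univ.filter fun i => c i ≠ 0) = S}, ?_, ?_⟩
  · rintro x ⟨c₀, hc₀, hsum₀⟩
    let C : Set (Fin N → ℝ) := {c | 0 ≤ c ∧ ∑ i, c i • a i = x}
    -- Each coefficient is bounded by `ℓ x`, because every generator has `ℓ (a i) ≥ 1`.
    have hC : IsCompact C := by
      refine IsCompact.of_isClosed_subset (isCompact_Icc (a := (0 : Fin N → ℝ))
        (b := fun _ => ℓ x)) ?_ ?_
      · exact (isClosed_le continuous_const continuous_id).inter
          (isClosed_eq (by fun_prop) continuous_const)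
      · rintro c ⟨hc, hsum⟩
        refine ⟨hc, fun i => ?_⟩
        rw [← hsum, map_sum]
        simp only [map_smul, smul_eq_mul]
        calc c i ≤ c i * ℓ (a i) := le_mul_of_one_le_right (hc i) (hℓ i)
          _ ≤ ∑ i, c i * ℓ (a i) := Finset.single_le_sum (f := fun i => c i * ℓ (a i))
              (fun j _ => mul_nonneg (hc j) (zero_le_one.trans (hℓ j))) (Finset.mem_univ i)
    obtain ⟨c, ⟨hc, hsum⟩, hmin⟩ := hC.exists_lexMin ⟨c₀, hc₀, hsum₀⟩
    exact ⟨c, hc, hsum, c, ⟨hc, fun c' hc' hsum' => hmin c' ⟨hc', hsum'.trans hsum⟩⟩, rfl⟩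
  · rintro c c' hc hc' ⟨c₀, hmin, hS⟩ ⟨c₀', hmin', hS'⟩ hsum
    have hm : IsMin c := hsupp hmin hc fun i hi => by
      by_contra h
      have : i ∈ Finset.univ.filter fun i => c₀ i ≠ 0 := hS ▸ by simpa using h
      simp [hi] at this
    have hm' : IsMin c' := hsupp hmin' hc' fun i hi => by
      by_contra h
      have : i ∈ Finset.univ.filter fun i => c₀' i ≠ 0 := hS' ▸ by simpa using h
      simp [hi] at this
    by_contra hne
    rcases LexLt.trichotomy hne with h | h
    · exact hm'.2 c hc hsum h
    · exact hm.2 c' hc' hsum.symm h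

end Triangulation

/-! ### Rays of the normal fan -/

section Rays

variable {n : ℕ}

/-- The exponent `m` minimizes the functional `ξ` on `G₀`. -/
def IsTight (G₀ : Finset (Fin n →₀ ℕ)) (ξ : Fin n → ℝ) (m : Fin n →₀ ℕ) : Prop :=
  ∀ k ∈ G₀, dotProduct ξ (expPoint m) ≤ dotProduct ξ (expPoint k)

/-- `η` vanishes on the directions of the face on which `ξ` is minimal. -/
def TightAnnihilates (G₀ : Finset (Fin n →₀ ℕ)) (ξ η : Fin n → ℝ) : Prop :=
  (∀ j, ξ j = 0 → η j = 0) ∧ ∀ m ∈ G₀, ∀ k ∈ G₀, IsTight G₀ ξ m → IsTight G₀ ξ k →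
    dotProduct η (expPoint m) = dotProduct η (expPoint k)

/-- `ξ` spans a ray of the normal fan. -/
def IsRay (G₀ : Finset (Fin n →₀ ℕ)) (ξ : Fin n → ℝ) : Prop :=
  0 ≤ ξ ∧ ξ ≠ 0 ∧ ∀ η, TightAnnihilates G₀ ξ η → ∃ c : ℝ, η = c • ξ

/-- This is the ratio test of the simplex method: t is the least p i / (-w i) over the indices with
w i < 0. -/
theorem exists_first_hit {ι : Type*} [Fintype ι] (p w : ι → ℝ) (hp : 0 ≤ p)
    (hpw : ∀ i, p i = 0 → w i = 0) (hw : ∃ i, w i < 0) :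
    ∃ t > 0, (∀ i, 0 ≤ p i + t * w i) ∧ ∃ i, p i ≠ 0 ∧ p i + t * w i = 0 := by
  classical
  have hne : (Finset.univ.filter fun i => w i < 0).Nonempty := by
    obtain ⟨i, hi⟩ := hw
    exact ⟨i, by simpa using hi⟩
  obtain ⟨i, hi, hmin⟩ := Finset.exists_min_image _ (fun i => p i / (-w i)) hne
  simp only [Finset.mem_filter, Finset.mem_univ, true_and] at hi hmin
  have hpi : p i ≠ 0 := fun h => by rw [hpw i h] at hi; exact lt_irrefl _ hi
  have hpi' : 0 < p i := lt_of_le_of_ne (hp i) (Ne.symm hpi)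
  have hwi : 0 < -w i := by linarith
  refine ⟨p i / (-w i), by positivity, fun j => ?_, i, hpi, ?_⟩
  · rcases lt_or_ge (w j) 0 with hj | hj
    · have h1 := hmin j hj
      rw [le_div_iff₀ (by linarith)] at h1
      linarith
    · have h1 : 0 ≤ p j := hp j
      positivity
  · rw [div_neg, neg_mul, div_mul_cancel₀ _ (by linarith), add_neg_cancel]

theorem IsTight.smul {G₀ : Finset (Fin n →₀ ℕ)} {ξ : Fin n → ℝ} {m : Fin n →₀ ℕ}
    (h : IsTight G₀ ξ m) {c : ℝ} (hc : 0 ≤ c) : IsTight G₀ (c • ξ) m := fun m' hm' => by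
  simp only [smul_dotProduct, smul_eq_mul]
  exact mul_le_mul_of_nonneg_left (h m' hm') hc

theorem exists_isTight {G₀ : Finset (Fin n →₀ ℕ)} (hG₀ : G₀.Nonempty) (ξ : Fin n → ℝ) :
    ∃ m ∈ G₀, IsTight G₀ ξ m :=
  Finset.exists_min_image G₀ (fun m => dotProduct ξ (expPoint m)) hG₀

open Classical in
/-- The number of inequalities that are strict at `ξ`. -/
noncomputable def slackCount (G₀ : Finset (Fin n →₀ ℕ)) (ξ : Fin n → ℝ) : ℕ :=
  (G₀.filter fun m => ¬ IsTight G₀ ξ m).card + (Finset.univ.filter fun j => ξ j ≠ 0).card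

/-- Moving from ξ along v preserves all equalities, so one can go on until a strict inequality first
becomes an equality. The vanishing coordinate sum provides a negative coordinate of v, so this does
happen. -/
theorem exists_boundary_point {G₀ : Finset (Fin n →₀ ℕ)} (hG₀ : G₀.Nonempty) {ξ v : Fin n → ℝ}
    (hξ : 0 ≤ ξ) (hv : TightAnnihilates G₀ ξ v) (hsum : ∑ j, v j = 0) (hv0 : v ≠ 0) :
    ∃ t : ℝ, 0 < t ∧ 0 ≤ ξ + t • v ∧ (∀ m ∈ G₀, IsTight G₀ ξ m → IsTight G₀ (ξ + t • v) m) ∧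
      slackCount G₀ (ξ + t • v) < slackCount G₀ ξ := by
  classical
  obtain ⟨m₀, hm₀, hm₀t⟩ := exists_isTight hG₀ ξ
  have hneg : ∃ j, v j < 0 := by
    by_contra! h
    refine hv0 (funext fun j => ?_)
    exact (Finset.sum_eq_zero_iff_of_nonneg fun j _ => h j).1 hsum j (Finset.mem_univ j)
  -- These are the linear inequalities cutting out the cone of the fan: the tight exponent m₀ stays
  -- minimal and the coordinates stay nonnegative.
  let L : (Fin n → ℝ) → G₀ ⊕ Fin n → ℝ := fun η => Sum.elim
    (fun m => dotProduct η (expPoint m) - dotProduct η (expPoint m₀)) (fun j => η j)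
  have hL (t : ℝ) (i) : L (ξ + t • v) i = L ξ i + t * L v i := by
    rcases i with m | j
    · simp only [L, Sum.elim_inl, add_dotProduct, smul_dotProduct, smul_eq_mul]; ring
    · simp [L]
  have hLm (m : G₀) : L ξ (Sum.inl m) = 0 ↔ IsTight G₀ ξ m := by
    simp only [L, Sum.elim_inl]
    constructor
    · intro h m' hm'
      rw [sub_eq_zero.1 h]
      exact hm₀t m' hm'
    · intro h
      exact sub_eq_zero.2 (le_antisymm (h m₀ hm₀) (hm₀t m m.2))
  obtain ⟨t, ht, hpos, i, hi0, hi⟩ := exists_first_hit (L ξ) (L v)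
    (fun i => by
      rcases i with m | j
      · exact sub_nonneg.2 (hm₀t m m.2)
      · exact hξ j)
    (fun i hi => by
      rcases i with m | j
      · exact sub_eq_zero.2 (hv.2 m m.2 m₀ hm₀ ((hLm m).1 hi) hm₀t)
      · exact hv.1 j hi)
    (by
      obtain ⟨j, hj⟩ := hneg
      exact ⟨Sum.inr j, hj⟩)
  simp only [← hL] at hpos hi
  have hm₀' : IsTight G₀ (ξ + t • v) m₀ := fun m hm => sub_nonneg.1 (hpos (Sum.inl ⟨m, hm⟩))
  have hLm' (m : G₀) : L (ξ + t • v) (Sum.inl m) = 0 ↔ IsTight G₀ (ξ + t • v) m := by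
    simp only [L, Sum.elim_inl]
    constructor
    · intro h m' hm'
      rw [sub_eq_zero.1 h]
      exact hm₀' m' hm'
    · intro h
      exact sub_eq_zero.2 (le_antisymm (h m₀ hm₀) (hm₀' m m.2))
  have htight : ∀ m ∈ G₀, IsTight G₀ ξ m → IsTight G₀ (ξ + t • v) m := fun m hm h => by
    rw [← hLm' ⟨m, hm⟩, hL, (hLm ⟨m, hm⟩).2 h]
    have : L v (Sum.inl ⟨m, hm⟩) = 0 := sub_eq_zero.2 (hv.2 m hm m₀ hm₀ h hm₀t)
    rw [this, mul_zero, add_zero]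
  have hzero : ∀ j, ξ j = 0 → (ξ + t • v) j = 0 := fun j hj => by
    simp [hj, hv.1 j hj]
  refine ⟨t, ht, fun j => hpos (Sum.inr j), htight, ?_⟩
  have hs1 : (G₀.filter fun m => ¬ IsTight G₀ (ξ + t • v) m) ⊆
      G₀.filter fun m => ¬ IsTight G₀ ξ m := fun m hm => by
    rw [Finset.mem_filter] at hm ⊢
    exact ⟨hm.1, fun h => hm.2 (htight m hm.1 h)⟩
  have hs2 : (Finset.univ.filter fun j => (ξ + t • v) j ≠ 0) ⊆
      Finset.univ.filter fun j => ξ j ≠ 0 := fun j hj => by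
    rw [Finset.mem_filter] at hj ⊢
    exact ⟨hj.1, fun h => hj.2 (hzero j h)⟩
  unfold slackCount
  rcases i with m | j
  · refine add_lt_add_of_lt_of_le (Finset.card_lt_card ⟨hs1, fun h => ?_⟩) (Finset.card_le_card hs2)
    have h1 : (m : Fin n →₀ ℕ) ∈ G₀.filter fun m => ¬ IsTight G₀ ξ m :=
      Finset.mem_filter.2 ⟨m.2, fun h => hi0 ((hLm m).2 h)⟩
    exact (Finset.mem_filter.1 (h h1)).2 ((hLm' m).1 hi)
  · refine add_lt_add_of_le_of_lt (Finset.card_le_card hs1) (Finset.card_lt_card ⟨hs2, fun h => ?_⟩)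
    have h1 : j ∈ Finset.univ.filter fun j => ξ j ≠ 0 :=
      Finset.mem_filter.2 ⟨Finset.mem_univ j, hi0⟩
    exact (Finset.mem_filter.1 (h h1)).2 hi

/-- Every nonnegative vector is a conic combination of rays in its cone of the normal fan. -/
theorem exists_conic_combination_of_rays {G₀ : Finset (Fin n →₀ ℕ)} (hG₀ : G₀.Nonempty)
    {R : Type*} [Fintype R] (a : R → Fin n → ℝ)
    (ha : ∀ ρ, IsRay G₀ ρ → ∃ i, ∃ c : ℝ, 0 < c ∧ ρ = c • a i) (ξ : Fin n → ℝ) (hξ : 0 ≤ ξ) :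
    ∃ c : R → ℝ, 0 ≤ c ∧ ∑ i, c i • a i = ξ ∧
      ∀ i, c i ≠ 0 → ∀ m ∈ G₀, IsTight G₀ ξ m → IsTight G₀ (a i) m := by
  classical
  induction hk : slackCount G₀ ξ using Nat.strong_induction_on generalizing ξ with
  | _ k ih =>
    rcases eq_or_ne ξ 0 with rfl | hξ0
    · exact ⟨0, le_rfl, by simp, fun i hi => absurd rfl hi⟩
    by_cases hray : IsRay G₀ ξ
    · obtain ⟨i, c, hc, rfl⟩ := ha ξ hray
      refine ⟨Pi.single i c, Pi.single_nonneg.2 hc.le, ?_, fun i' hi' m hm hmt => ?_⟩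
      · rw [Finset.sum_eq_single i]
        · simp
        · intro b _ hb; simp [hb]
        · simp
      · have : i' = i := by by_contra h; simp [h] at hi'
        subst this
        have := hmt.smul (inv_nonneg.2 hc.le)
        rwa [smul_smul, inv_mul_cancel₀ hc.ne', one_smul] at this
    · obtain ⟨η, hη, hηc⟩ : ∃ η, TightAnnihilates G₀ ξ η ∧ ∀ c : ℝ, η ≠ c • ξ := by
        by_contra! h
        exact hray ⟨hξ, hξ0, h⟩
      have hσ : 0 < ∑ j, ξ j := by
        refine lt_of_le_of_ne (Finset.sum_nonneg fun j _ => hξ j) fun h => hξ0 (funext fun j => ?_)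
        exact (Finset.sum_eq_zero_iff_of_nonneg fun j _ => hξ j).1 h.symm j (Finset.mem_univ j)
      -- Subtracting this multiple of ξ makes the coordinate sum zero, so that the line through ξ
      -- leaves the cone in both directions.
      let c₀ := (∑ j, η j) / ∑ j, ξ j
      let v := η - c₀ • ξ
      have hv : TightAnnihilates G₀ ξ v := by
        refine ⟨fun j hj => by simp [v, hj, hη.1 j hj], fun m hm m' hm' hmt hmt' => ?_⟩
        have h1 : dotProduct ξ (expPoint m) = dotProduct ξ (expPoint m') :=
          le_antisymm (hmt m' hm') (hmt' m hm)
        simp only [v, sub_dotProduct, smul_dotProduct, hη.2 m hm m' hm' hmt hmt', h1]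
      have hvs : ∑ j, v j = 0 := by
        simp only [v, Pi.sub_apply, Pi.smul_apply, smul_eq_mul, Finset.sum_sub_distrib,
          ← Finset.mul_sum, c₀]
        field_simp
        simp
      have hv0 : v ≠ 0 := fun h => hηc c₀ (sub_eq_zero.1 h)
      obtain ⟨t, ht, hpos, htight, hlt⟩ := exists_boundary_point hG₀ hξ hv hvs hv0
      obtain ⟨t', ht', hpos', htight', hlt'⟩ := exists_boundary_point (v := -v) hG₀ hξ
        ⟨fun j hj => by simp [hv.1 j hj], fun m hm m' hm' h h' => by
          simp [neg_dotProduct, hv.2 m hm m' hm' h h']⟩ (by simp [hvs]) (neg_ne_zero.2 hv0)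
      obtain ⟨c, hc, hcs, hct⟩ := ih _ (hk ▸ hlt) _ hpos rfl
      obtain ⟨c', hc', hcs', hct'⟩ := ih _ (hk ▸ hlt') _ hpos' rfl
      -- With these weights ξ is the convex combination of the two boundary points ξ + t v and ξ -
      -- t' v.
      refine ⟨(t' / (t + t')) • c + (t / (t + t')) • c', ?_, ?_, fun i hi m hm hmt => ?_⟩
      · exact add_nonneg (smul_nonneg (by positivity) hc) (smul_nonneg (by positivity) hc')
      · simp only [Pi.add_apply, Pi.smul_apply, smul_eq_mul, add_smul, mul_smul,
          Finset.sum_add_distrib, ← Finset.smul_sum, hcs, hcs']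
        ext j
        simp only [Pi.add_apply, Pi.smul_apply, smul_eq_mul, Pi.neg_apply]
        field_simp
        ring
      · by_cases h1 : c i = 0
        · by_cases h2 : c' i = 0
          · simp [h1, h2] at hi
          · exact hct' i h2 m hm (htight' m hm hmt)
        · exact hct i h1 m hm (htight m hm hmt)

/-- Rays of the normal fan are rational. -/
theorem IsRay.exists_primitive {G₀ : Finset (Fin n →₀ ℕ)} {ρ : Fin n → ℝ} (hρ : IsRay G₀ ρ) :
    ∃ a : Fin n → ℕ, Finset.univ.gcd a = 1 ∧ ∃ c : ℝ, 0 < c ∧ ρ = c • fun j => (a j : ℝ) := by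
  obtain ⟨hpos, hne, hann⟩ := hρ
  obtain ⟨j₀, hj₀⟩ := Function.ne_iff.1 hne
  -- A ℚ-linear functional commutes with the pairing against integral exponents. So applying φ to
  -- the coordinates of ρ gives a rational vector satisfying the same equations, which is therefore
  -- a multiple of ρ.
  obtain ⟨φ, hφ⟩ : ∃ φ : ℝ →ₗ[ℚ] ℚ, φ (ρ j₀) ≠ 0 := by
    by_contra! h
    exact hj₀ ((Module.forall_dual_apply_eq_zero_iff ℚ (ρ j₀)).1 h)
  have hdot (m : Fin n →₀ ℕ) :
      dotProduct (fun j => (φ (ρ j) : ℝ)) (expPoint m) = (φ (dotProduct ρ (expPoint m)) : ℝ) := by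
    simp only [dotProduct, expPoint, map_sum]
    push_cast
    refine Finset.sum_congr rfl fun j _ => ?_
    rw [mul_comm (ρ j), ← nsmul_eq_mul, map_nsmul, nsmul_eq_mul]
    push_cast
    ring
  obtain ⟨c, hc⟩ := hann (fun j => (φ (ρ j) : ℝ)) ⟨fun j hj => by simp [hj],
    fun m hm m' hm' hmt hmt' => by
      rw [hdot, hdot, le_antisymm (hmt m' hm') (hmt' m hm)]⟩
  have hc0 : c ≠ 0 := by
    rintro rfl
    have := congrFun hc j₀
    simp only [zero_smul, Pi.zero_apply, Rat.cast_eq_zero] at this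
    exact hφ this
  -- The factor c may be negative, so absolute values are taken before clearing denominators.
  have habs (j : Fin n) : ((|φ (ρ j)| : ℚ) : ℝ) = |c| * ρ j := by
    have := congrFun hc j
    simp only [Pi.smul_apply, smul_eq_mul] at this
    rw [Rat.cast_abs, this, abs_mul, abs_of_nonneg (hpos j)]
  let D : ℕ := ∏ j, (φ (ρ j)).den
  have hD : 0 < D := Finset.prod_pos fun j _ => (φ (ρ j)).den_pos
  let N : Fin n → ℕ := fun j => (φ (ρ j)).num.natAbs * ∏ i ∈ Finset.univ.erase j, (φ (ρ i)).den
  have hN (j : Fin n) : (N j : ℝ) = D * (|c| * ρ j) := by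
    rw [← habs]
    have h1 : (N j : ℚ) = D * |φ (ρ j)| := by
      simp only [N, D]
      rw [← Finset.mul_prod_erase Finset.univ _ (Finset.mem_univ j)]
      have h2 : |φ (ρ j)| = (φ (ρ j)).num.natAbs / (φ (ρ j)).den := by
        conv_lhs => rw [← Rat.num_div_den (φ (ρ j))]
        rw [abs_div, Nat.abs_cast, Nat.cast_natAbs]
        push_cast
        rfl
      have h3 : ((φ (ρ j)).den : ℚ) ≠ 0 := by exact_mod_cast (φ (ρ j)).den_nz
      rw [h2]
      push_cast
      field_simp
    exact_mod_cast congrArg (fun x : ℚ => (x : ℝ)) h1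
  obtain ⟨a, ha, hgcd⟩ := Finset.extract_gcd N ⟨j₀, Finset.mem_univ j₀⟩
  have hg : 0 < Finset.univ.gcd N := by
    refine Nat.pos_of_ne_zero fun h => ?_
    have h1 := hN j₀
    rw [ha j₀ (Finset.mem_univ _), h, zero_mul, Nat.cast_zero] at h1
    have h2 : (D : ℝ) * (|c| * ρ j₀) ≠ 0 :=
      mul_ne_zero (by positivity) (mul_ne_zero (abs_ne_zero.2 hc0) hj₀)
    exact h2 h1.symm
  refine ⟨a, hgcd, Finset.univ.gcd N / (D * |c|), ?_, ?_⟩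
  · have := abs_pos.2 hc0
    positivity
  · ext j
    have h1 := hN j
    rw [ha j (Finset.mem_univ _)] at h1
    have h2 := abs_pos.2 hc0
    push_cast at h1
    simp only [Pi.smul_apply, smul_eq_mul]
    field_simp
    linarith

/-- A ray is determined up to scaling by its tight exponents and its zero coordinates, and
primitivity fixes the scale. -/
theorem finite_primitive_rays (G₀ : Finset (Fin n →₀ ℕ)) :
    {a : Fin n → ℕ | Finset.univ.gcd a = 1 ∧ IsRay G₀ fun j => (a j : ℝ)}.Finite := by
  classical
  refine Set.Finite.of_injOn (t := Set.univ) (f := fun a : Fin n → ℕ =>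
    (Finset.univ.filter fun m : G₀ => IsTight G₀ (fun j => (a j : ℝ)) m,
      Finset.univ.filter fun j => a j = 0)) (Set.mapsTo_univ _ _) ?_ Set.finite_univ
  rintro a ⟨hga, ha⟩ a' ⟨hga', ha'⟩ heq
  simp only [Prod.mk.injEq] at heq
  have h1 : TightAnnihilates G₀ (fun j => (a j : ℝ)) fun j => (a' j : ℝ) := by
    have htr : ∀ m ∈ G₀, IsTight G₀ (fun j => (a j : ℝ)) m →
        IsTight G₀ (fun j => (a' j : ℝ)) m := fun m hm h => by
      have : (⟨m, hm⟩ : G₀) ∈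
          Finset.univ.filter fun m : G₀ => IsTight G₀ (fun j => (a j : ℝ)) m := by
        simpa using h
      rw [heq.1] at this
      simpa using this
    refine ⟨fun j hj => ?_, fun m hm m' hm' h h' =>
      le_antisymm (htr m hm h m' hm') (htr m' hm' h' m hm)⟩
    have : j ∈ Finset.univ.filter fun j => a j = 0 := by simpa using hj
    rw [heq.2] at this
    simpa using this
  obtain ⟨c, hc⟩ := ha.2.2 _ h1
  have hcross (i j : Fin n) : a' i * a j = a i * a' j := by
    have hi := congrFun hc i
    have hj := congrFun hc j
    simp only [Pi.smul_apply, smul_eq_mul] at hi hj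
    have : (a' i : ℝ) * a j = a i * a' j := by rw [hi, hj]; ring
    exact_mod_cast this
  ext i
  have h2 : Finset.univ.gcd (fun j => a' i * a j) = Finset.univ.gcd fun j => a i * a' j :=
    Finset.gcd_congr rfl fun j _ => hcross i j
  rw [Finset.gcd_mul_left, Finset.gcd_mul_left, hga, hga'] at h2
  simpa using h2.symm

end Rays

/-! ### Newton polyhedra and their facets -/

section Facets

variable {n : ℕ}

/-- The pairing of a weight vector with an exponent. -/
def natPairing (ω : Fin n → ℕ) (m : Fin n →₀ ℕ) : ℕ := ∑ j, ω j * m j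

theorem pairing_expPoint (ω : Fin n → ℕ) (m : Fin n →₀ ℕ) :
    pairing ω (expPoint m) = natPairing ω m := by
  simp [pairing, expPoint, natPairing]

theorem dotProduct_expPoint (ω : Fin n → ℕ) (m : Fin n →₀ ℕ) :
    dotProduct (fun j => (ω j : ℝ)) (expPoint m) = natPairing ω m := pairing_expPoint ω m

theorem natPairing_mono (ω : Fin n → ℕ) {m m' : Fin n →₀ ℕ} (h : m ≤ m') :
    natPairing ω m ≤ natPairing ω m' :=
  Finset.sum_le_sum fun j _ => Nat.mul_le_mul_left _ (h j)

theorem natPairing_add (ω ω' : Fin n → ℕ) (m : Fin n →₀ ℕ) :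
    natPairing (ω + ω') m = natPairing ω m + natPairing ω' m := by
  simp [natPairing, add_mul, Finset.sum_add_distrib]

theorem natPairing_sum {κ : Type*} (s : Finset κ) (c : κ → ℕ) (a : κ → Fin n → ℕ)
    (m : Fin n →₀ ℕ) : natPairing (∑ i ∈ s, c i • a i) m = ∑ i ∈ s, c i * natPairing (a i) m := by
  simp only [natPairing, Finset.sum_apply, Pi.smul_apply, smul_eq_mul, Finset.sum_mul,
    Finset.mul_sum]
  rw [Finset.sum_comm]
  exact Finset.sum_congr rfl fun i _ => Finset.sum_congr rfl fun j _ => by ring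

/-- This is Dickson's lemma: the minimal exponents form an antichain in a well-quasi-order. -/
theorem exists_finset_generators (G : Set (Fin n →₀ ℕ)) :
    ∃ G₀ : Finset (Fin n →₀ ℕ), (G₀ : Set (Fin n →₀ ℕ)) ⊆ G ∧ ∀ m ∈ G, ∃ m₀ ∈ G₀, m₀ ≤ m := by
  have hfin : {m | Minimal (· ∈ G) m}.Finite :=
    WellQuasiOrderedLE.finite_of_isAntichain (setOfPred_minimal_antichain _)
  refine ⟨hfin.toFinset, fun m hm => ?_, fun m hm => ?_⟩
  · have : Minimal (· ∈ G) m := by simpa using hm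
    exact this.1
  · obtain ⟨m₀, hle, hmin⟩ := exists_minimal_le_of_wellFoundedLT (· ∈ G) m hm
    exact ⟨m₀, by simpa using hmin, hle⟩

variable {G : Set (Fin n →₀ ℕ)}

theorem expPoint_mem_newtonPolyhedron {m : Fin n →₀ ℕ} (hm : m ∈ G) {x : Fin n → ℝ}
    (hx : ∀ j, expPoint m j ≤ x j) : x ∈ newtonPolyhedron G :=
  subset_convexHull ℝ _ (Set.mem_biUnion hm hx)

theorem pairing_le_of_mem_newtonPolyhedron {ω : Fin n → ℕ} {m₀ : Fin n →₀ ℕ}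
    (hmin : ∀ m ∈ G, natPairing ω m₀ ≤ natPairing ω m) {y : Fin n → ℝ}
    (hy : y ∈ newtonPolyhedron G) : (natPairing ω m₀ : ℝ) ≤ pairing ω y := by
  have hconv : Convex ℝ {y : Fin n → ℝ | (natPairing ω m₀ : ℝ) ≤ pairing ω y} := by
    refine convex_halfSpace_ge (f := pairing ω) ⟨fun x y => ?_, fun c x => ?_⟩ _
    · simp [pairing, mul_add, Finset.sum_add_distrib]
    · simp only [pairing, Pi.smul_apply, smul_eq_mul, Finset.mul_sum]
      exact Finset.sum_congr rfl fun j _ => by ring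
  refine convexHull_min (Set.iUnion₂_subset fun m hm x hx => ?_) hconv hy
  have h1 : (natPairing ω m₀ : ℝ) ≤ natPairing ω m := by exact_mod_cast hmin m hm
  refine h1.trans ?_
  rw [← pairing_expPoint]
  exact Finset.sum_le_sum fun j _ => mul_le_mul_of_nonneg_left (hx j) (by positivity)

/-- The face of the Newton polyhedron on which `ω` is minimal. -/
def weightFace (G : Set (Fin n →₀ ℕ)) (ω : Fin n → ℕ) : Set (Fin n → ℝ) :=
  {x | x ∈ newtonPolyhedron G ∧ ∀ y ∈ newtonPolyhedron G, pairing ω x ≤ pairing ω y}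

theorem mem_weightFace_iff {ω : Fin n → ℕ} {m₀ : Fin n →₀ ℕ} (hm₀ : m₀ ∈ G)
    (hmin : ∀ m ∈ G, natPairing ω m₀ ≤ natPairing ω m) {x : Fin n → ℝ} :
    x ∈ weightFace G ω ↔ x ∈ newtonPolyhedron G ∧ pairing ω x = natPairing ω m₀ := by
  refine and_congr_right fun hx => ⟨fun h => le_antisymm ?_ ?_, fun h y hy => ?_⟩
  · rw [← pairing_expPoint]
    exact h _ (expPoint_mem_newtonPolyhedron hm₀ fun _ => le_rfl)
  · exact pairing_le_of_mem_newtonPolyhedron hmin hx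
  · rw [h]
    exact pairing_le_of_mem_newtonPolyhedron hmin hy

theorem isFace_weightFace {ω : Fin n → ℕ} {m₀ : Fin n →₀ ℕ} (hm₀ : m₀ ∈ G)
    (hmin : ∀ m ∈ G, natPairing ω m₀ ≤ natPairing ω m) :
    IsFace (newtonPolyhedron G) (weightFace G ω) := by
  refine ⟨⟨expPoint m₀, (mem_weightFace_iff hm₀ hmin).2
    ⟨expPoint_mem_newtonPolyhedron hm₀ fun _ => le_rfl, pairing_expPoint _ _⟩⟩, fun _ => ?_⟩
  refine ⟨-∑ j, (ω j : ℝ) • ContinuousLinearMap.proj (R := ℝ) (φ := fun _ : Fin n => ℝ) j, ?_⟩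
  ext x
  have h (x : Fin n → ℝ) :
      (-∑ j, (ω j : ℝ) • ContinuousLinearMap.proj (R := ℝ) (φ := fun _ : Fin n => ℝ) j) x =
        -pairing ω x := by
    simp [pairing]
  simp only [weightFace, Set.mem_ofPred_eq, h, neg_le_neg_iff]

theorem minPairing_eq {ω : Fin n → ℕ} {m₀ : Fin n →₀ ℕ} (hm₀ : m₀ ∈ G)
    (hmin : ∀ m ∈ G, natPairing ω m₀ ≤ natPairing ω m) :
    minPairing (newtonPolyhedron G) ω = natPairing ω m₀ := by
  refine IsLeast.csInf_eq ⟨⟨expPoint m₀, expPoint_mem_newtonPolyhedron hm₀ fun _ => le_rfl,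
    pairing_expPoint _ _⟩, ?_⟩
  rintro _ ⟨y, hy, rfl⟩
  exact pairing_le_of_mem_newtonPolyhedron hmin hy

/-- Weights are nonnegative, so the generators below the exponents already decide minimality. -/
theorem isTight_natCast_iff {G₀ : Finset (Fin n →₀ ℕ)} (h₀ : (G₀ : Set (Fin n →₀ ℕ)) ⊆ G)
    (hG₀ : ∀ m ∈ G, ∃ m₀ ∈ G₀, m₀ ≤ m) (ω : Fin n → ℕ) (m₀ : Fin n →₀ ℕ) :
    IsTight G₀ (fun j => (ω j : ℝ)) m₀ ↔ ∀ m ∈ G, natPairing ω m₀ ≤ natPairing ω m := by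
  simp only [IsTight, dotProduct_expPoint, Nat.cast_le]
  refine ⟨fun h m hm => ?_, fun h m hm => h m (h₀ hm)⟩
  obtain ⟨m', hm', hle⟩ := hG₀ m hm
  exact (h m' hm').trans (natPairing_mono ω hle)

/-- A functional constant on the face of a satisfies the equations in the definition of a ray, hence
is a multiple of a. The directions of the face thus have a one-dimensional annihilator, which makes
the face a facet. -/
theorem IsRay.mem_facetNormals {G₀ : Finset (Fin n →₀ ℕ)} (h₀ : (G₀ : Set (Fin n →₀ ℕ)) ⊆ G)
    (hG₀ : ∀ m ∈ G, ∃ m₀ ∈ G₀, m₀ ≤ m) (hne : G₀.Nonempty) {a : Fin n → ℕ}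
    (hgcd : Finset.univ.gcd a = 1) (ha : IsRay G₀ fun j => (a j : ℝ)) :
    a ∈ facetNormals (newtonPolyhedron G) := by
  obtain ⟨m₀, hm₀, hm₀t⟩ := exists_isTight hne fun j => (a j : ℝ)
  have hmin := (isTight_natCast_iff h₀ hG₀ a m₀).1 hm₀t
  refine ⟨hgcd, weightFace G a, ⟨isFace_weightFace (h₀ hm₀) hmin, ?_⟩, fun x hx y hy =>
    le_antisymm (hx.2 y hy.1) (hy.2 x hx.1)⟩
  let ψ : (Fin n → ℝ) →ₗ[ℝ] ℝ := ∑ j, (a j : ℝ) • LinearMap.proj j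
  have hψ (x) : ψ x = pairing a x := by simp [ψ, pairing]
  have hψ0 : ψ ≠ 0 := by
    intro h
    refine ha.2.1 (funext fun j => ?_)
    have := LinearMap.congr_fun h (Pi.single j 1)
    rw [hψ] at this
    simpa [pairing, Pi.single_apply] using this
  have hann : (vectorSpan ℝ (weightFace G a)).dualAnnihilator = Submodule.span ℝ {ψ} := by
    apply le_antisymm
    · intro χ hχ
      rw [Submodule.mem_dualAnnihilator] at hχ
      have hχd (x : Fin n → ℝ) : χ x = dotProduct (fun j => χ (Pi.single j 1)) x := by
        conv_lhs => rw [← Finset.univ_sum_single x]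
        rw [map_sum]
        refine Finset.sum_congr rfl fun j _ => ?_
        have : Pi.single j (x j) = x j • Pi.single (M := fun _ => ℝ) j 1 := by
          rw [← Pi.single_smul]; simp
        rw [this, map_smul, smul_eq_mul, mul_comm]
      have hmem {m : Fin n →₀ ℕ} (hm : m ∈ G₀) (h : IsTight G₀ (fun j => (a j : ℝ)) m) :
          expPoint m ∈ weightFace G a :=
        (mem_weightFace_iff (h₀ hm) ((isTight_natCast_iff h₀ hG₀ a m).1 h)).2
          ⟨expPoint_mem_newtonPolyhedron (h₀ hm) fun _ => le_rfl, pairing_expPoint _ _⟩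
      have hdiff {x y : Fin n → ℝ} (hx : x ∈ weightFace G a) (hy : y ∈ weightFace G a) :
          χ x = χ y := by
        have := hχ (x - y) (vsub_mem_vectorSpan ℝ hx hy)
        rwa [map_sub, sub_eq_zero] at this
      obtain ⟨c, hc⟩ := ha.2.2 (fun j => χ (Pi.single j 1)) ⟨fun j hj => by
        have hj' : a j = 0 := by simpa using hj
        -- Where a vanishes, the face is unbounded in the j-th direction, which forces the
        -- functional to vanish there.
        have h1 : expPoint m₀ + Pi.single j 1 ∈ weightFace G a := by
          refine (mem_weightFace_iff (h₀ hm₀) hmin).2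
            ⟨expPoint_mem_newtonPolyhedron (h₀ hm₀) fun i => ?_, ?_⟩
          · have : (0 : ℝ) ≤ Pi.single (M := fun _ => ℝ) j 1 i := by
              rw [Pi.single_apply]; split_ifs <;> norm_num
            simpa using this
          · rw [← pairing_expPoint]
            simp [pairing, mul_add, Finset.sum_add_distrib, Pi.single_apply, hj']
        have h2 := hdiff h1 (hmem hm₀ hm₀t)
        rw [map_add] at h2
        simpa using h2, fun m hm m' hm' h h' => by
          rw [← hχd, ← hχd]; exact hdiff (hmem hm h) (hmem hm' h')⟩
      refine Submodule.mem_span_singleton.2 ⟨c, LinearMap.ext fun x => ?_⟩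
      rw [hχd, hc, smul_dotProduct, LinearMap.smul_apply, hψ]
      rfl
    · rw [Submodule.span_singleton_le_iff_mem, Submodule.mem_dualAnnihilator]
      intro v hv
      have : vectorSpan ℝ (weightFace G a) ≤ LinearMap.ker ψ := by
        rw [vectorSpan, Submodule.span_le]
        rintro _ ⟨x, hx, y, hy, rfl⟩
        change ψ (x - y) = 0
        rw [map_sub, hψ, hψ, sub_eq_zero]
        exact le_antisymm (hx.2 y hy.1) (hy.2 x hx.1)
      exact this hv
  have h1 := Subspace.finrank_add_finrank_dualAnnihilator_eq (vectorSpan ℝ (weightFace G a))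
  rw [hann, finrank_span_singleton hψ0] at h1
  simpa using h1

end Facets

/-! ### Decomposition of `ℕⁿ` into translated simplicial cones -/

section ConeDecomposition

variable {n : ℕ}

/-- A partition of `ℕⁿ` into finitely many sets `b + ∑ ℕ a_i` with `a_i` normal to facets of the
Newton polyhedron, such that `b` and all `a_i` are minimal at a common exponent `v`. -/
structure ConeDecomposition (G : Set (Fin n →₀ ℕ)) where
  ι : Type
  κ : ι → Type
  [fintypeι : Fintype ι]
  [fintypeκ : ∀ c, Fintype (κ c)]
  a : ∀ c, κ c → Fin n → ℕ
  b : ι → Fin n → ℕ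
  v : ι → Fin n →₀ ℕ
  bijective : Function.Bijective fun p : Σ c, (κ c → ℕ) => b p.1 + ∑ i, p.2 i • a p.1 i
  mem_facetNormals : ∀ c i, a c i ∈ facetNormals (newtonPolyhedron G)
  v_mem : ∀ c, v c ∈ G
  b_min : ∀ c, ∀ m ∈ G, natPairing (b c) (v c) ≤ natPairing (b c) m
  a_min : ∀ c i, ∀ m ∈ G, natPairing (a c i) (v c) ≤ natPairing (a c i) m

theorem IsRay.of_smul {G₀ : Finset (Fin n →₀ ℕ)} {ξ : Fin n → ℝ} {c : ℝ} (hc : 0 < c)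
    (h : IsRay G₀ (c • ξ)) : IsRay G₀ ξ := by
  obtain ⟨hpos, hne, hann⟩ := h
  have hξ : ξ = c⁻¹ • (c • ξ) := by rw [smul_smul, inv_mul_cancel₀ hc.ne', one_smul]
  refine ⟨?_, fun h0 => hne (by rw [h0, smul_zero]), fun η hη => ?_⟩
  · rw [hξ]
    exact smul_nonneg (inv_nonneg.2 hc.le) hpos
  · obtain ⟨c', hc'⟩ := hann η ⟨fun j hj => hη.1 j (by simpa [hc.ne'] using hj),
      fun m hm m' hm' h h' => hη.2 m hm m' hm'
        (hξ ▸ h.smul (inv_nonneg.2 hc.le)) (hξ ▸ h'.smul (inv_nonneg.2 hc.le))⟩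
    exact ⟨c' * c, by rw [hc', smul_smul]⟩

theorem sum_smul_dotProduct {N : ℕ} (c : Fin N → ℝ) (a : Fin N → Fin n → ℝ) (x : Fin n → ℝ) :
    dotProduct (∑ i, c i • a i) x = ∑ i, c i * dotProduct (a i) x := by
  rw [sum_dotProduct]
  simp only [smul_dotProduct, smul_eq_mul]

/-- Triangulation of the normal fan: every point of `ℕⁿ` is in a unique way a conic combination of
rays with support in a certain family of simplicial cones of the normal fan. -/
theorem exists_fan_triangulation {G₀ : Finset (Fin n →₀ ℕ)} (hG₀ : G₀.Nonempty) {N : ℕ}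
    (a : Fin N → Fin n → ℕ) (ha : ∀ i, a i ≠ 0)
    (hray : ∀ ρ, IsRay G₀ ρ → ∃ i, ∃ c : ℝ, 0 < c ∧ ρ = c • fun j => (a i j : ℝ)) :
    ∃ 𝒮 : Set (Finset (Fin N)),
      (∀ S ∈ 𝒮, ∃ m ∈ G₀, ∀ i ∈ S, IsTight G₀ (fun j => (a i j : ℝ)) m) ∧
      (∀ k : Fin n → ℕ, ∃ c : Fin N → ℝ, 0 ≤ c ∧
        (∑ i, c i • fun j => (a i j : ℝ)) = (fun j => (k j : ℝ)) ∧
        (Finset.univ.filter fun i => c i ≠ 0) ∈ 𝒮) ∧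
      ∀ c c' : Fin N → ℝ, 0 ≤ c → 0 ≤ c' → (Finset.univ.filter fun i => c i ≠ 0) ∈ 𝒮 →
        (Finset.univ.filter fun i => c' i ≠ 0) ∈ 𝒮 →
        (∑ i, c i • fun j => (a i j : ℝ)) = (∑ i, c' i • fun j => (a i j : ℝ)) → c = c' := by
  choose mt hmt hmtt using fun i => exists_isTight hG₀ fun j => (a i j : ℝ)
  let r : Fin N → Fin n → ℝ := fun i j => a i j
  -- Each ray is lifted to the height of its minimal pairing. For a conic combination c and an
  -- exponent m in `G₀`, the height ∑ cᵢ dᵢ is at most the pairing of the combination with m, with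
  -- equality only if all rays used are tight at m. Triangulating the lifted rays therefore refines
  -- the normal fan.
  let d : Fin N → ℝ := fun i => dotProduct (r i) (expPoint (mt i))
  have hd {i : Fin N} {m : Fin n →₀ ℕ} (hm : m ∈ G₀) (h : IsTight G₀ (r i) m) :
      dotProduct (r i) (expPoint m) = d i :=
    le_antisymm (h _ (hmt i)) (hmtt i m hm)
  let ℓ : (Fin n → ℝ) × ℝ →L[ℝ] ℝ :=
    (∑ j, ContinuousLinearMap.proj (R := ℝ) (φ := fun _ : Fin n => ℝ) j).comp
      (ContinuousLinearMap.fst ℝ (Fin n → ℝ) ℝ)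
  have hℓ (i : Fin N) : 1 ≤ ℓ (r i, d i) := by
    have h1 : ℓ (r i, d i) = ((∑ j, a i j : ℕ) : ℝ) := by simp [ℓ, r]
    rw [h1]
    have h2 : 0 < ∑ j, a i j := by
      obtain ⟨j, hj⟩ := Function.ne_iff.1 (ha i)
      exact Finset.sum_pos' (fun _ _ => Nat.zero_le _)
        ⟨j, Finset.mem_univ j, Nat.pos_of_ne_zero hj⟩
    exact_mod_cast h2
  obtain ⟨𝒮, h𝒮, huniq⟩ := exists_conic_triangulation (fun i => (r i, d i)) ℓ hℓ
  have hpair (c : Fin N → ℝ) :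
      ∑ i, c i • (r i, d i) = (∑ i, c i • r i, ∑ i, c i * d i) := by
    simp only [Prod.smul_mk, smul_eq_mul]
    ext <;> simp [Prod.fst_sum, Prod.snd_sum]
  have hsum {c : Fin N → ℝ} {m : Fin n →₀ ℕ} (hm : m ∈ G₀)
      (h : ∀ i, c i ≠ 0 → IsTight G₀ (r i) m) :
      ∑ i, c i * d i = dotProduct (∑ i, c i • r i) (expPoint m) := by
    rw [sum_smul_dotProduct]
    refine Finset.sum_congr rfl fun i _ => ?_
    by_cases hi : c i = 0
    · simp [hi]
    · rw [hd hm (h i hi)]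
  have hle {c : Fin N → ℝ} (hc : 0 ≤ c) {m : Fin n →₀ ℕ} (hm : m ∈ G₀) :
      ∑ i, c i * d i ≤ dotProduct (∑ i, c i • r i) (expPoint m) := by
    rw [sum_smul_dotProduct]
    exact Finset.sum_le_sum fun i _ => mul_le_mul_of_nonneg_left (hmtt i m hm) (hc i)
  refine ⟨{S | S ∈ 𝒮 ∧ ∃ m ∈ G₀, ∀ i ∈ S, IsTight G₀ (r i) m}, fun S hS => hS.2, fun k => ?_, ?_⟩
  · obtain ⟨m, hm, hmk⟩ := exists_isTight hG₀ fun j => (k j : ℝ)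
    obtain ⟨c₀, hc₀, hs₀, ht₀⟩ := exists_conic_combination_of_rays hG₀ r hray
      (fun j => (k j : ℝ)) (fun j => Nat.cast_nonneg _)
    -- The greatest height possible above k, which forces all rays used to be tight at m.
    obtain ⟨c, hc, hs, hS⟩ := h𝒮 (fun j => (k j : ℝ), dotProduct (fun j => (k j : ℝ)) (expPoint m))
      ⟨c₀, hc₀, by rw [hpair, hs₀, hsum hm fun i hi => ht₀ i hi m hm hmk, hs₀]⟩
    rw [hpair, Prod.mk.injEq] at hs
    refine ⟨c, hc, hs.1, hS, m, hm, fun i hi => ?_⟩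
    rw [Finset.mem_filter] at hi
    have h1 : ∑ i, c i * (dotProduct (r i) (expPoint m) - d i) = 0 := by
      simp only [mul_sub, Finset.sum_sub_distrib]
      rw [← sum_smul_dotProduct, hs.1, hs.2, sub_self]
    have h2 := (Finset.sum_eq_zero_iff_of_nonneg fun i _ =>
      mul_nonneg (hc i) (sub_nonneg.2 (hmtt i m hm))).1 h1 i (Finset.mem_univ i)
    have h3 := sub_eq_zero.1 ((mul_eq_zero.1 h2).resolve_left hi.2)
    intro m' hm'
    rw [h3]
    exact hmtt i m' hm'
  · rintro c c' hc hc' ⟨hS, m, hm, hmS⟩ ⟨hS', m', hm', hmS'⟩ heq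
    refine huniq c c' hc hc' hS hS' ?_
    have heq' : ∑ i, c i • r i = ∑ i, c' i • r i := heq
    rw [hpair, hpair, heq', Prod.mk.injEq]
    refine ⟨rfl, ?_⟩
    have h1 := hsum hm fun i hi => hmS i (by simpa using hi)
    have h2 := hsum hm' fun i hi => hmS' i (by simpa using hi)
    -- Each of the two heights is attained at its own exponent and bounds the other from above.
    refine le_antisymm ?_ ?_
    · rw [h2, ← heq']; exact hle hc hm'
    · rw [h1, heq']; exact hle hc' hm

/-- In a simplicial cone of the triangulated fan split the positive coordinates as cᵢ = βᵢ + tᵢ with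
βᵢ in (0, 1] and tᵢ in ℕ. The point b = ∑ βᵢ aᵢ is again integral, and only finitely many b occur.
Since b need not be 0, the cones need not be unimodular. -/
theorem nonempty_coneDecomposition {G : Set (Fin n →₀ ℕ)} (hG : G.Nonempty) :
    Nonempty (ConeDecomposition G) := by
  classical
  obtain ⟨G₀, h₀, hG₀⟩ := exists_finset_generators G
  have hne : G₀.Nonempty := by
    obtain ⟨m, hm⟩ := hG
    obtain ⟨m₀, hm₀, -⟩ := hG₀ m hm
    exact ⟨m₀, hm₀⟩
  let 𝓡 := (finite_primitive_rays G₀).toFinset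
  let a : Fin 𝓡.card → Fin n → ℕ := fun i => (𝓡.equivFin.symm i : Fin n → ℕ)
  have haR (i) : Finset.univ.gcd (a i) = 1 ∧ IsRay G₀ fun j => (a i j : ℝ) := by
    have := (𝓡.equivFin.symm i).2
    exact (finite_primitive_rays G₀).mem_toFinset.1 this
  have ha0 (i) : a i ≠ 0 := fun h => by
    have := (haR i).1
    rw [h] at this
    have h0 : Finset.univ.gcd (0 : Fin n → ℕ) = 0 := Finset.gcd_eq_zero_iff.2 fun _ _ => rfl
    omega
  obtain ⟨𝒮, htight, hex, huniq⟩ := exists_fan_triangulation hne a ha0 fun ρ hρ => by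
    obtain ⟨α, hα, c, hc, rfl⟩ := hρ.exists_primitive
    have hmem : α ∈ 𝓡 := (finite_primitive_rays G₀).mem_toFinset.2 ⟨hα, hρ.of_smul hc⟩
    exact ⟨𝓡.equivFin ⟨α, hmem⟩, c, hc, by simp [a]⟩
  choose! w hw hwt using htight
  -- The interval (0, 1] rather than [0, 1) keeps all points in the relative interior of the cone on
  -- S, so different supports give disjoint pieces.
  let IsBox : Finset (Fin 𝓡.card) → (Fin n → ℕ) → (Fin 𝓡.card → ℝ) → Prop := fun S b β =>
    (∀ i, β i ≠ 0 ↔ i ∈ S) ∧ (∀ i, 0 ≤ β i ∧ β i ≤ 1) ∧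
      (∑ i, β i • fun j => (a i j : ℝ)) = fun j => (b j : ℝ)
  let I : Type := {p : Finset (Fin 𝓡.card) × (Fin n → ℕ) // p.1 ∈ 𝒮 ∧ ∃ β, IsBox p.1 p.2 β}
  have hIfin : Finite I := by
    have : {p : Finset (Fin 𝓡.card) × (Fin n → ℕ) | p.1 ∈ 𝒮 ∧ ∃ β, IsBox p.1 p.2 β}.Finite := by
      refine (Set.finite_univ.prod (Set.finite_Iic (∑ i, a i))).subset ?_
      rintro ⟨S, b⟩ ⟨-, β, -, hβ, hb⟩
      refine ⟨Set.mem_univ _, fun j => ?_⟩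
      have h1 := congrFun hb j
      simp only [Finset.sum_apply, Pi.smul_apply, smul_eq_mul] at h1
      have h2 : (b j : ℝ) ≤ ((∑ i, a i) j : ℕ) := by
        rw [← h1, Finset.sum_apply, Nat.cast_sum]
        exact Finset.sum_le_sum fun i _ => mul_le_of_le_one_left (by positivity) (hβ i).2
      exact_mod_cast h2
    exact this.to_subtype
  have hIfintype : Fintype I := Fintype.ofFinite I
  let ext (S : Finset (Fin 𝓡.card)) (t : {i // i ∈ S} → ℕ) : Fin 𝓡.card → ℕ := fun i =>
    if h : i ∈ S then t ⟨i, h⟩ else 0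
  have hext (S : Finset (Fin 𝓡.card)) (t : {i // i ∈ S} → ℕ) :
      ∑ i, t i • a i.1 = ∑ i, ext S t i • a i := by
    rw [← Finset.sum_subset (Finset.subset_univ S) fun i _ hi => by simp [ext, hi],
      ← Finset.sum_coe_sort S]
    exact Finset.sum_congr rfl fun i _ => by simp [ext]
  have hcast (b : Fin n → ℕ) (t : Fin 𝓡.card → ℕ) (β : Fin 𝓡.card → ℝ) :
      ((∑ i, β i • fun j => (a i j : ℝ)) = fun j => (b j : ℝ)) ↔
      (∑ i, (β i + t i) • fun j => (a i j : ℝ)) = fun j => ((b + ∑ i, t i • a i) j : ℝ) := by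
    simp only [funext_iff, Finset.sum_apply, Pi.smul_apply, smul_eq_mul, Pi.add_apply,
      Nat.cast_add, Nat.cast_sum, Nat.cast_mul, add_mul, Finset.sum_add_distrib, add_left_inj]
  have hsupp {S : Finset (Fin 𝓡.card)} {b : Fin n → ℕ} {β : Fin 𝓡.card → ℝ} (hβ : IsBox S b β)
      (t : {i // i ∈ S} → ℕ) : (Finset.univ.filter fun i => β i + ext S t i ≠ 0) = S := by
    ext i
    simp only [Finset.mem_filter, Finset.mem_univ, true_and]
    by_cases hi : i ∈ S
    · have h1 : 0 < β i := lt_of_le_of_ne (hβ.2.1 i).1 (Ne.symm ((hβ.1 i).2 hi))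
      have : β i + ext S t i ≠ 0 := by positivity
      simp [this, hi]
    · have h1 : β i = 0 := by by_contra h; exact hi ((hβ.1 i).1 h)
      simp [h1, ext, hi]
  have hbij : Function.Bijective fun p : Σ c : I, ({i // i ∈ c.1.1} → ℕ) =>
      p.1.1.2 + ∑ i, p.2 i • a i.1 := by
    constructor
    · rintro ⟨⟨⟨S, b⟩, hS, β, hβ⟩, t⟩ ⟨⟨⟨S', b'⟩, hS', β', hβ'⟩, t'⟩ heq
      dsimp only at heq hS hS' hβ hβ' t t'
      rw [hext, hext] at heq
      have h1 := (hcast b (ext S t) β).1 hβ.2.2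
      have h2 := (hcast b' (ext S' t') β').1 hβ'.2.2
      have h3 : (fun i => β i + (ext S t i : ℝ)) = fun i => β' i + (ext S' t' i : ℝ) := by
        refine huniq _ _ (fun i => add_nonneg (hβ.2.1 i).1 (Nat.cast_nonneg _))
          (fun i => add_nonneg (hβ'.2.1 i).1 (Nat.cast_nonneg _)) ?_ ?_ ?_
        · rw [hsupp hβ]; exact hS
        · rw [hsupp hβ']; exact hS'
        · rw [h1, h2, heq]
      obtain rfl : S = S' := by
        rw [← hsupp hβ t, ← hsupp hβ' t']
        exact Finset.filter_congr fun i _ => by rw [congrFun h3 i]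
      -- Two numbers in (0, 1] differ by less than 1, so the integer parts agree.
      have h4 : ext S t = ext S t' := by
        ext i
        by_cases hi : i ∈ S
        · have p1 : 0 < β i := lt_of_le_of_ne (hβ.2.1 i).1 (Ne.symm ((hβ.1 i).2 hi))
          have p2 : 0 < β' i := lt_of_le_of_ne (hβ'.2.1 i).1 (Ne.symm ((hβ'.1 i).2 hi))
          have p3 := (hβ.2.1 i).2
          have p4 := (hβ'.2.1 i).2
          have p5 := congrFun h3 i
          have p6 : (ext S t i : ℝ) < ext S t' i + 1 := by linarith
          have p7 : (ext S t' i : ℝ) < ext S t i + 1 := by linarith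
          norm_cast at p6 p7
          omega
        · simp [ext, hi]
      have h5 : t = t' := by
        funext i
        have := congrFun h4 i
        simpa [ext] using this
      subst h5
      obtain rfl : b = b' := add_right_cancel heq
      rfl
    · intro k
      obtain ⟨c, hc, hck, hcS⟩ := hex k
      -- The largest natural number below cᵢ. Truncated subtraction gives the required value 0 when
      -- cᵢ = 0.
      let T : Fin 𝓡.card → ℕ := fun i => ⌈c i⌉₊ - 1
      have hT (i) (hi : c i ≠ 0) : (T i : ℝ) < c i ∧ c i ≤ T i + 1 := by
        have h1 : 0 < c i := lt_of_le_of_ne (hc i) (Ne.symm hi)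
        have h2 : T i + 1 = ⌈c i⌉₊ := Nat.sub_add_cancel (Nat.ceil_pos.2 h1)
        constructor
        · exact Nat.lt_ceil.1 (by omega)
        · have h3 := Nat.le_ceil (c i)
          rw [← h2] at h3
          exact_mod_cast h3
      have hT0 (i) (hi : c i = 0) : T i = 0 := by simp [T, hi]
      have hTle (i) : (T i : ℝ) ≤ c i := by
        by_cases hi : c i = 0
        · rw [hT0 i hi, hi, Nat.cast_zero]
        · exact (hT i hi).1.le
      have hkT (j : Fin n) : (∑ i, T i • a i) j ≤ k j := by
        have h1 := congrFun hck j
        simp only [Finset.sum_apply, Pi.smul_apply, smul_eq_mul] at h1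
        have h2 : (((∑ i, T i • a i) j : ℕ) : ℝ) ≤ k j := by
          rw [← h1, Finset.sum_apply, Nat.cast_sum]
          refine Finset.sum_le_sum fun i _ => ?_
          simp only [Pi.smul_apply, smul_eq_mul, Nat.cast_mul]
          exact mul_le_mul_of_nonneg_right (hTle i) (Nat.cast_nonneg _)
        exact_mod_cast h2
      have hkb : (fun j => k j - (∑ i, T i • a i) j) + ∑ i, T i • a i = k :=
        funext fun j => Nat.sub_add_cancel (hkT j)
      have hbox : IsBox (Finset.univ.filter fun i => c i ≠ 0)
          (fun j => k j - (∑ i, T i • a i) j) fun i => c i - T i := by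
        refine ⟨fun i => ?_, fun i => ?_, ?_⟩
        · simp only [Finset.mem_filter, Finset.mem_univ, true_and]
          by_cases hi : c i = 0
          · simp [hi, hT0 i hi]
          · have := (hT i hi).1
            simp only [ne_eq, hi, not_false_eq_true, iff_true]
            intro h
            linarith
        · by_cases hi : c i = 0
          · simp [hi, hT0 i hi]
          · have := hT i hi
            constructor <;> linarith
        · rw [hcast _ T, hkb]
          simpa only [sub_add_cancel] using hck
      refine ⟨⟨⟨(_, _), hcS, _, hbox⟩, fun i => T i.1⟩, ?_⟩
      have : ext (Finset.univ.filter fun i => c i ≠ 0) (fun i => T i.1) = T := by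
        ext i
        by_cases hi : c i = 0
        · simp [ext, hi, hT0 i hi]
        · simp [ext, hi]
      have h6 := hext (Finset.univ.filter fun i => c i ≠ 0) fun i => T i.1
      rw [this] at h6
      exact (congrArg ((fun j => k j - (∑ i, T i • a i) j) + ·) h6).trans hkb
  refine ⟨{ ι := I, κ := fun c => {i // i ∈ c.1.1}, a := fun c i => a i.1, b := fun c => c.1.2,
            v := fun c => w c.1.1, bijective := hbij, mem_facetNormals := ?_, v_mem := ?_,
            b_min := ?_, a_min := ?_ }⟩
  · exact fun c i => (haR i.1).2.mem_facetNormals h₀ hG₀ hne (haR i.1).1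
  · exact fun c => h₀ (hw _ c.2.1)
  · rintro ⟨⟨S, b⟩, hS, β, hβ⟩
    have h1 : (fun j => (b j : ℝ)) = ∑ i, β i • fun j => (a i j : ℝ) := hβ.2.2.symm
    dsimp only
    rw [← isTight_natCast_iff h₀ hG₀, h1]
    intro m hm
    rw [sum_smul_dotProduct, sum_smul_dotProduct]
    refine Finset.sum_le_sum fun i _ => ?_
    by_cases hi : i ∈ S
    · exact mul_le_mul_of_nonneg_left (hwt S hS i hi m hm) (hβ.2.1 i).1
    · have : β i = 0 := by by_contra h; exact hi ((hβ.1 i).1 h)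
      simp [this]
  · exact fun c i => (isTight_natCast_iff h₀ hG₀ _ _).1 (hwt _ c.2.1 i.1 i.2)

end ConeDecomposition

/-! ### Power series with coefficients tending to zero -/

section PowerSums

open Filter

variable {K : Type*} [NontriviallyNormedField K] [IsUltrametricDist K] {n l : ℕ}

/-- The monomial `u^m`. -/
def monom (u : Fin n → K) (m : Fin n →₀ ℕ) : K := ∏ j, u j ^ m j

/-- The closed unit polydisc. -/
def polydisc (K : Type*) [NontriviallyNormedField K] (n : ℕ) : Set (Fin n → K) :=
  {u | ∀ j, ‖u j‖ ≤ 1}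

theorem isOpen_polydisc : IsOpen (polydisc K n) := by
  have : polydisc K n = Metric.closedBall 0 1 := by
    ext u
    rw [mem_closedBall_zero_iff, pi_norm_le_iff_of_nonneg zero_le_one]
    rfl
  rw [this]
  exact IsUltrametricDist.isOpen_closedBall _ one_ne_zero

theorem norm_monom_le_one {u : Fin n → K} (hu : u ∈ polydisc K n) (m : Fin n →₀ ℕ) :
    ‖monom u m‖ ≤ 1 := by
  rw [monom, norm_prod]
  refine Finset.prod_le_one (fun _ _ => norm_nonneg _) fun j _ => ?_
  rw [norm_pow]
  exact pow_le_one₀ (norm_nonneg _) (hu j)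

theorem norm_mul_sub_mul_le {x y x' y' : K} {δ : ℝ} (hy : ‖y‖ ≤ 1) (hx' : ‖x'‖ ≤ 1)
    (h : ‖x - x'‖ ≤ δ) (h' : ‖y - y'‖ ≤ δ) : ‖x * y - x' * y'‖ ≤ δ := by
  have hδ : 0 ≤ δ := (norm_nonneg _).trans h
  have : x * y - x' * y' = (x - x') * y + x' * (y - y') := by ring
  rw [this]
  refine (IsUltrametricDist.norm_add_le_max _ _).trans (max_le ?_ ?_)
  · rw [norm_mul]
    nlinarith [norm_nonneg y, norm_nonneg (x - x')]
  · rw [norm_mul]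
    nlinarith [norm_nonneg x', norm_nonneg (y - y')]

theorem norm_pow_sub_pow_le {x y : K} (hx : ‖x‖ ≤ 1) (hy : ‖y‖ ≤ 1) (k : ℕ) :
    ‖x ^ k - y ^ k‖ ≤ ‖x - y‖ := by
  induction k with
  | zero => simp
  | succ k ih =>
    rw [pow_succ, pow_succ]
    refine norm_mul_sub_mul_le hx ?_ ih le_rfl
    rw [norm_pow]
    exact pow_le_one₀ (norm_nonneg _) hy

theorem norm_prod_sub_prod_le {ι : Type*} (s : Finset ι) {x y : ι → K} (hx : ∀ i, ‖x i‖ ≤ 1)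
    (hy : ∀ i, ‖y i‖ ≤ 1) {δ : ℝ} (hδ : 0 ≤ δ) (h : ∀ i, ‖x i - y i‖ ≤ δ) :
    ‖∏ i ∈ s, x i - ∏ i ∈ s, y i‖ ≤ δ := by
  classical
  induction s using Finset.induction_on with
  | empty => simpa
  | insert i s hi ih =>
    rw [Finset.prod_insert hi, Finset.prod_insert hi]
    refine norm_mul_sub_mul_le ?_ (hy i) (h i) ih
    rw [norm_prod]
    exact Finset.prod_le_one (fun _ _ => norm_nonneg _) fun j _ => hx j

theorem norm_monom_sub_monom_le {u u' : Fin n → K} (hu : u ∈ polydisc K n)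
    (hu' : u' ∈ polydisc K n) (m : Fin n →₀ ℕ) : ‖monom u m - monom u' m‖ ≤ ‖u - u'‖ := by
  have hp (x : Fin n → K) (hx : x ∈ polydisc K n) (j : Fin n) : ‖x j ^ m j‖ ≤ 1 := by
    rw [norm_pow]
    exact pow_le_one₀ (norm_nonneg _) (hx j)
  refine norm_prod_sub_prod_le _ (hp u hu) (hp u' hu') (norm_nonneg _) fun j => ?_
  exact (norm_pow_sub_pow_le (hu j) (hu' j) _).trans (norm_le_pi_norm (u - u') j)

/-- The sum `∑ u^m c_m` of a power series with coefficients in `K^l`. -/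
noncomputable def powSum (c : (Fin n →₀ ℕ) → Fin l → K) (u : Fin n → K) : Fin l → K :=
  ∑' m, monom u m • c m

variable [CompleteSpace K]

theorem summable_monom_smul {c : (Fin n →₀ ℕ) → Fin l → K} (hc : Tendsto c cofinite (𝓝 0))
    {u : Fin n → K} (hu : u ∈ polydisc K n) : Summable fun m => monom u m • c m := by
  have := IsUltrametricDist.nonarchimedeanAddGroup (M := Fin l → K)
  refine NonarchimedeanAddGroup.summable_of_tendsto_cofinite_zero ?_
  rw [tendsto_zero_iff_norm_tendsto_zero] at hc ⊢
  refine squeeze_zero (fun _ => norm_nonneg _) (fun m => ?_) hc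
  rw [norm_smul]
  exact mul_le_of_le_one_left (norm_nonneg _) (norm_monom_le_one hu m)

theorem powSum_sub {c c' : (Fin n →₀ ℕ) → Fin l → K} (hc : Tendsto c cofinite (𝓝 0))
    (hc' : Tendsto c' cofinite (𝓝 0)) {u : Fin n → K} (hu : u ∈ polydisc K n) :
    powSum c u - powSum c' u = powSum (c - c') u := by
  rw [powSum, powSum, ← (summable_monom_smul hc hu).tsum_sub (summable_monom_smul hc' hu)]
  simp only [powSum, Pi.sub_apply, smul_sub]

theorem norm_powSum_le {c : (Fin n →₀ ℕ) → Fin l → K} {δ : ℝ} (hδ : 0 ≤ δ) (h : ∀ m, ‖c m‖ ≤ δ)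
    {u : Fin n → K} (hu : u ∈ polydisc K n) : ‖powSum c u‖ ≤ δ := by
  refine IsUltrametricDist.norm_tsum_le_of_forall_le_of_nonneg hδ fun m => ?_
  rw [norm_smul]
  exact (mul_le_of_le_one_left (norm_nonneg _) (norm_monom_le_one hu m)).trans (h m)

/-- Monomials are 1-Lipschitz on the unit polydisc, so the size of the coefficients bounds the
Lipschitz constant. Closeness of coefficients thus controls difference quotients, without any
estimate of derivatives. -/
theorem norm_powSum_sub_powSum_le {c : (Fin n →₀ ℕ) → Fin l → K} (hc : Tendsto c cofinite (𝓝 0))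
    {δ : ℝ} (hδ : 0 ≤ δ) (h : ∀ m, ‖c m‖ ≤ δ) {u u' : Fin n → K} (hu : u ∈ polydisc K n)
    (hu' : u' ∈ polydisc K n) : ‖powSum c u - powSum c u'‖ ≤ δ * ‖u - u'‖ := by
  rw [powSum, powSum, ← (summable_monom_smul hc hu).tsum_sub (summable_monom_smul hc hu')]
  refine IsUltrametricDist.norm_tsum_le_of_forall_le_of_nonneg (by positivity) fun m => ?_
  rw [← sub_smul, norm_smul, mul_comm]
  gcongr
  · exact h m
  · exact norm_monom_sub_monom_le hu hu' m

theorem exists_bound_of_tendsto_cofinite {c : (Fin n →₀ ℕ) → Fin l → K}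
    (hc : Tendsto c cofinite (𝓝 0)) : ∃ δ : ℝ, 0 ≤ δ ∧ ∀ m, ‖c m‖ ≤ δ := by
  obtain ⟨δ, hδ⟩ := hc.norm.bddAbove_range_of_cofinite
  exact ⟨δ, (norm_nonneg _).trans (hδ ⟨0, rfl⟩), fun m => hδ ⟨m, rfl⟩⟩

theorem continuousOn_powSum {c : (Fin n →₀ ℕ) → Fin l → K} (hc : Tendsto c cofinite (𝓝 0)) :
    ContinuousOn (powSum c) (polydisc K n) := by
  obtain ⟨δ, hδ, h⟩ := exists_bound_of_tendsto_cofinite hc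
  refine LipschitzOnWith.continuousOn (K := ⟨δ, hδ⟩) (LipschitzOnWith.of_dist_le_mul
    fun u hu u' hu' => ?_)
  rw [dist_eq_norm, dist_eq_norm]
  exact norm_powSum_sub_powSum_le hc hδ h hu hu'

theorem exists_continuous_rightInverse (A : (Fin n → K) →L[K] (Fin l → K))
    (hsurj : Function.Surjective A) :
    ∃ σ : (Fin l → K) →L[K] (Fin n → K), ∀ v, A (σ v) = v := by
  obtain ⟨σ₀, hσ₀⟩ := A.toLinearMap.exists_rightInverse_of_surjective
    (LinearMap.range_eq_top.2 hsurj)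
  exact ⟨LinearMap.toContinuousLinearMap σ₀, fun v => LinearMap.congr_fun hσ₀ v⟩

section Family

variable {T : Type*} [TopologicalSpace T] {c : T → (Fin n →₀ ℕ) → Fin l → K}
  (hc : ∀ t, Tendsto (c t) cofinite (𝓝 0)) {t₁ : T}
  (hct : ∀ δ > 0, ∀ᶠ t in 𝓝 t₁, ∀ m, ‖c t m - c t₁ m‖ ≤ δ) {u₁ : Fin n → K}
  (hu₁ : u₁ ∈ polydisc K n)

include hc hct hu₁

theorem tendsto_powSum :
    Tendsto (fun p : (Fin n → K) × T => powSum (c p.2) p.1) (𝓝 (u₁, t₁))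
      (𝓝 (powSum (c t₁) u₁)) := by
  rw [Metric.tendsto_nhds]
  intro ε hε
  have h1 := (continuousOn_powSum (hc t₁)).continuousAt (isOpen_polydisc.mem_nhds hu₁)
  have h2 := Metric.tendsto_nhds.1 h1 ε hε
  rw [nhds_prod_eq]
  filter_upwards [(h2.and (isOpen_polydisc.mem_nhds hu₁)).prod_mk (hct (ε / 2) (by positivity))]
    with p ⟨⟨hp1, hpu⟩, hp2⟩
  refine (dist_triangle_max _ (powSum (c t₁) p.1) _).trans_lt (max_lt ?_ hp1)
  rw [dist_eq_norm, powSum_sub (hc _) (hc _) hpu]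
  exact (norm_powSum_le (by positivity) hp2 hpu).trans_lt (by linarith)

/-- Coefficients uniformly within ε of those at t₁ change the map by an ε-Lipschitz error, so strict
differentiability at t₁ gives one linear approximation valid for all nearby t. -/
theorem uniformlySubmersiveAt_powSum {A : (Fin n → K) →L[K] (Fin l → K)}
    (hA : HasStrictFDerivAt (powSum (c t₁)) A u₁) (hsurj : Function.Surjective A) :
    UniformlySubmersiveAt (fun u t => powSum (c t) u) u₁ t₁ := by
  obtain ⟨σ, hσ⟩ := exists_continuous_rightInverse A hsurj
  -- Chosen so that `‖σ‖ * ε ≤ 1 / 2`.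
  let ε : ℝ := (2 * (‖σ‖ + 1))⁻¹
  have hε : 0 < ε := by positivity
  have h1 := hA.isLittleO.def hε
  rw [nhds_prod_eq] at h1
  obtain ⟨O, hO, hO1⟩ := Filter.mem_prod_self_iff.1 h1
  refine ⟨A, σ, 1 / 2, hσ, by norm_num, O ∩ polydisc K n,
    Filter.inter_mem hO (isOpen_polydisc.mem_nhds hu₁), ?_⟩
  filter_upwards [hct ε hε] with t ht u hu u' hu'
  have h2 : ‖powSum (c t₁) u - powSum (c t₁) u' - A (u - u')‖ ≤ ε * ‖u - u'‖ := by
    have h := hO1 (show (u, u') ∈ O ×ˢ O from ⟨hu.1, hu'.1⟩)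
    simpa only [Set.mem_ofPred_eq] using h
  have hcd : Tendsto (c t - c t₁) cofinite (𝓝 0) := by
    have h := (hc t).sub (hc t₁)
    rw [sub_zero] at h
    exact h
  have h3 := norm_powSum_sub_powSum_le hcd hε.le ht hu.2 hu'.2
  rw [← powSum_sub (hc t) (hc t₁) hu.2, ← powSum_sub (hc t) (hc t₁) hu'.2] at h3
  have h4 : powSum (c t) u - powSum (c t) u' - A (u - u') =
      (powSum (c t) u - powSum (c t₁) u - (powSum (c t) u' - powSum (c t₁) u')) +
        (powSum (c t₁) u - powSum (c t₁) u' - A (u - u')) := by abel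
  have h5 : ‖powSum (c t) u - powSum (c t) u' - A (u - u')‖ ≤ ε * ‖u - u'‖ := by
    rw [h4]
    exact (IsUltrametricDist.norm_add_le_max _ _).trans (max_le h3 h2)
  refine (σ.le_opNorm _).trans ((mul_le_mul_of_nonneg_left h5 (norm_nonneg _)).trans ?_)
  rw [← mul_assoc]
  refine mul_le_mul_of_nonneg_right ?_ (norm_nonneg _)
  simp only [ε]
  rw [← div_eq_mul_inv, div_le_div_iff₀ (by positivity) (by norm_num)]
  linarith [norm_nonneg σ]

end Family

end PowerSums

/-! ### Faces of the Newton polyhedron and the corresponding parts of a mapping -/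

section FaceParts

variable {n l : ℕ}

theorem natPairing_le_of_pos {ω : Fin n → ℕ} (hω : ∀ j, 0 < ω j) (m : Fin n →₀ ℕ) (j : Fin n) :
    m j ≤ natPairing ω m :=
  (Nat.le_mul_of_pos_left _ (hω j)).trans
    (Finset.single_le_sum (f := fun j => ω j * m j) (fun _ _ => Nat.zero_le _)
      (Finset.mem_univ j))

theorem finite_natPairing_eq {ω : Fin n → ℕ} (hω : ∀ j, 0 < ω j) (d : ℕ) :
    {m : Fin n →₀ ℕ | natPairing ω m = d}.Finite := by
  refine (Set.finite_Iic (Finsupp.equivFunOnFinite.symm fun _ : Fin n => d)).subset fun m hm j => ?_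
  have hm' : natPairing ω m = d := hm
  simpa [hm'] using natPairing_le_of_pos hω m j

theorem pairing_smul_add_smul (ω : Fin n → ℕ) (x y : Fin n → ℝ) (α β : ℝ) :
    pairing ω (α • x + β • y) = α * pairing ω x + β * pairing ω y := by
  simp only [pairing, Pi.add_apply, Pi.smul_apply, smul_eq_mul, Finset.mul_sum,
    ← Finset.sum_add_distrib]
  exact Finset.sum_congr rfl fun j _ => by ring

/-- The face on which a weight vector with positive entries is minimal is compact. -/
theorem isCompact_weightFace {G : Set (Fin n →₀ ℕ)} {ω : Fin n → ℕ} (hω : ∀ j, 0 < ω j)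
    {m₀ : Fin n →₀ ℕ} (hm₀ : m₀ ∈ G) (hmin : ∀ m ∈ G, natPairing ω m₀ ≤ natPairing ω m) :
    IsCompact (weightFace G ω) := by
  set E : Set (Fin n → ℝ) := expPoint '' {m | m ∈ G ∧ natPairing ω m = natPairing ω m₀} with hE
  have hEfin : E.Finite :=
    ((finite_natPairing_eq hω (natPairing ω m₀)).subset fun m hm => hm.2).image _
  set d : ℝ := (natPairing ω m₀ : ℝ) with hd
  have hhull : ∀ x ∈ convexHull ℝ E, pairing ω x = d := by
    have hconv : Convex ℝ {x : Fin n → ℝ | pairing ω x = d} := by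
      intro x hx y hy α β _ _ hαβ
      have hx' : pairing ω x = d := hx
      have hy' : pairing ω y = d := hy
      change pairing ω _ = d
      rw [pairing_smul_add_smul, hx', hy', ← add_mul, hαβ, one_mul]
    refine fun x hx => convexHull_min ?_ hconv hx
    rintro _ ⟨m, hm, rfl⟩
    change pairing ω _ = d
    rw [pairing_expPoint, hm.2]
  -- The right side is convex because the hull of the finite set E lies in the bounding hyperplane
  -- of the open half space. Positivity of ω confines the points of minimal weight in each orthant m
  -- + ℝ₊ⁿ to m itself.
  have hsub : newtonPolyhedron G ⊆ {x | d < pairing ω x} ∪ convexHull ℝ E := by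
    refine convexHull_min (Set.iUnion₂_subset fun m hm x hx => ?_) ?_
    · have hnn (j) : 0 ≤ (ω j : ℝ) * (x j - expPoint m j) :=
        mul_nonneg (by positivity) (sub_nonneg.2 (hx j))
      have hsum : pairing ω x = natPairing ω m + ∑ j, (ω j : ℝ) * (x j - expPoint m j) := by
        rw [← pairing_expPoint, pairing, pairing, ← Finset.sum_add_distrib]
        exact Finset.sum_congr rfl fun j _ => by ring
      have h1 : d ≤ natPairing ω m := by
        rw [hd]
        exact_mod_cast hmin m hm
      have h2 := Finset.sum_nonneg fun j (_ : j ∈ Finset.univ) => hnn j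
      rcases (show d ≤ pairing ω x by linarith).lt_or_eq with h | h
      · exact Or.inl h
      · right
        have h3 : ∑ j, (ω j : ℝ) * (x j - expPoint m j) = 0 := by linarith
        have h4 : (natPairing ω m : ℝ) = natPairing ω m₀ := by linarith
        rw [Finset.sum_eq_zero_iff_of_nonneg fun j _ => hnn j] at h3
        have hx' : x = expPoint m := by
          ext j
          have hωj : (ω j : ℝ) ≠ 0 := by exact_mod_cast (hω j).ne'
          exact sub_eq_zero.1 ((mul_eq_zero.1 (h3 j (Finset.mem_univ j))).resolve_left hωj)
        rw [hx']
        exact subset_convexHull ℝ E ⟨m, ⟨hm, by exact_mod_cast h4⟩, rfl⟩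
    · intro x hx y hy α β hα hβ hαβ
      have hge (z : Fin n → ℝ) (hz : z ∈ {x | d < pairing ω x} ∪ convexHull ℝ E) :
          d ≤ pairing ω z := hz.elim (fun h => le_of_lt h) fun h => (hhull z h).ge
      rcases hα.eq_or_lt with rfl | hα
      · obtain rfl : β = 1 := by linarith
        simpa using! hy
      rcases hβ.eq_or_lt with rfl | hβ
      · obtain rfl : α = 1 := by linarith
        simpa using! hx
      by_cases hboth : x ∈ convexHull ℝ E ∧ y ∈ convexHull ℝ E
      · exact Or.inr (convex_convexHull ℝ E hboth.1 hboth.2 hα.le hβ.le hαβ)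
      · left
        change d < pairing ω _
        rw [pairing_smul_add_smul]
        have hd' : d = α * d + β * d := by rw [← add_mul, hαβ, one_mul]
        rw [hd']
        rcases not_and_or.1 hboth with h | h
        · exact add_lt_add_of_lt_of_le (mul_lt_mul_of_pos_left (hx.resolve_right h) hα)
            (mul_le_mul_of_nonneg_left (hge y hy) hβ.le)
        · exact add_lt_add_of_le_of_lt (mul_le_mul_of_nonneg_left (hge x hx) hα.le)
            (mul_lt_mul_of_pos_left (hy.resolve_right h) hβ)
  have heq : weightFace G ω = convexHull ℝ E := by
    ext x
    rw [mem_weightFace_iff hm₀ hmin]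
    refine ⟨fun ⟨hx, hxd⟩ => (hsub hx).resolve_left fun h => (ne_of_gt h) hxd,
      fun hx => ⟨convexHull_min ?_ (convex_convexHull ℝ _) hx, hhull x hx⟩⟩
    rintro _ ⟨m, hm, rfl⟩
    exact expPoint_mem_newtonPolyhedron hm.1 fun _ => le_rfl
  rw [heq]
  exact hEfin.isCompact_convexHull ℝ

/-! ### Face parts, quasi-homogeneity and the rank condition -/

section Algebra

variable {K : Type*} [Field K]

open Classical in
-- Finiteness matters: otherwise the `finsum` defining the face part takes its default value 0.
theorem coeff_facePart {g : MvPowerSeries (Fin n) K} {τ : Set (Fin n → ℝ)}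
    (hfin : {m | expPoint m ∈ τ ∧ MvPowerSeries.coeff m g ≠ 0}.Finite) (m : Fin n →₀ ℕ) :
    MvPolynomial.coeff m (facePart g τ) =
      if expPoint m ∈ τ then MvPowerSeries.coeff m g else 0 := by
  have hs : (Function.support fun m : Fin n →₀ ℕ => if expPoint m ∈ τ then
      MvPolynomial.monomial m (MvPowerSeries.coeff m g) else 0).Finite := by
    refine hfin.subset fun m hm => ?_
    rw [Function.mem_support] at hm
    split_ifs at hm with h
    · exact ⟨h, fun h0 => hm (by rw [h0, map_zero])⟩
    · exact absurd rfl hm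
  have := map_finsum (MvPolynomial.lcoeff K m).toAddMonoidHom hs
  simp only [LinearMap.toAddMonoidHom_coe, MvPolynomial.lcoeff_apply] at this
  rw [facePart, this, finsum_eq_single _ m]
  · split_ifs <;> simp
  · intro m' hm'
    split_ifs
    · rw [MvPolynomial.coeff_monomial, if_neg hm']
    · simp

open Classical in
theorem eval_facePart {g : MvPowerSeries (Fin n) K} {τ : Set (Fin n → ℝ)}
    (hfin : {m | expPoint m ∈ τ ∧ MvPowerSeries.coeff m g ≠ 0}.Finite) (z : Fin n → K) :
    MvPolynomial.eval z (facePart g τ) =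
      ∑ᶠ m : Fin n →₀ ℕ, if expPoint m ∈ τ then MvPowerSeries.coeff m g * ∏ j, z j ^ m j else 0 := by
  rw [MvPolynomial.eval_eq', finsum_eq_sum_of_support_subset (s := (facePart g τ).support)]
  · refine Finset.sum_congr rfl fun m _ => ?_
    rw [coeff_facePart hfin]
    split_ifs <;> simp
  · intro m hm
    rw [Function.mem_support] at hm
    rw [Finset.mem_coe, MvPolynomial.mem_support_iff, coeff_facePart hfin]
    split_ifs at hm ⊢ with h
    · exact left_ne_zero_of_mul hm
    · exact absurd rfl hm

theorem isWeightedHomogeneous_facePart {g : MvPowerSeries (Fin n) K} {τ : Set (Fin n → ℝ)}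
    (hfin : {m | expPoint m ∈ τ ∧ MvPowerSeries.coeff m g ≠ 0}.Finite) {ω : Fin n → ℕ} {d : ℕ}
    (hτ : ∀ m, expPoint m ∈ τ → natPairing ω m = d) :
    MvPolynomial.IsWeightedHomogeneous ω (facePart g τ) d := by
  classical
  intro m hm
  rw [coeff_facePart hfin] at hm
  split_ifs at hm with h
  · rw [← hτ m h, Finsupp.weight_apply, Finsupp.sum_fintype _ _ (by simp)]
    exact Finset.sum_congr rfl fun j _ => by rw [smul_eq_mul, mul_comm]
  · exact absurd rfl hm

theorem mulVec_injective_of_rank_eq {J : Matrix (Fin l) (Fin n) K} (h : J.rank = n) :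
    Function.Injective J.mulVec := by
  have h1 := J.mulVecLin.finrank_range_add_finrank_ker
  rw [Module.finrank_fin_fun] at h1
  have h2 : Module.finrank K J.mulVecLin.range = n := h
  have h3 : Module.finrank K J.mulVecLin.ker = 0 := by omega
  exact LinearMap.ker_eq_bot.1 (Submodule.finrank_eq_zero.1 h3)

theorem mulVec_surjective_of_rank_eq {J : Matrix (Fin l) (Fin n) K} (h : J.rank = l) :
    Function.Surjective J.mulVec := by
  have h2 : Module.finrank K J.mulVecLin.range = l := h
  have h3 : J.mulVecLin.range = ⊤ :=
    Submodule.eq_top_of_finrank_eq (by rw [h2, Module.finrank_fin_fun])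
  exact LinearMap.range_eq_top.1 h3

/-- If `n ≤ l`, the rank condition on a face on which a nonzero weight vector is constant says that
the components of the corresponding part have no common zero in the torus. -/
theorem NonDegenerateOn.exists_eval_ne_zero [CharZero K] {F : Fin l → MvPowerSeries (Fin n) K}
    {τ : Set (Fin n → ℝ)} (h : NonDegenerateOn F τ) (hnl : n ≤ l)
    (hfin : ∀ i, {m | expPoint m ∈ τ ∧ MvPowerSeries.coeff m (F i) ≠ 0}.Finite) {ω : Fin n → ℕ}
    (hω : ω ≠ 0) {d : ℕ} (hτ : ∀ m, expPoint m ∈ τ → natPairing ω m = d) {z : Fin n → K}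
    (hz : ∀ j, z j ≠ 0) : ∃ i, MvPolynomial.eval z (facePart (F i) τ) ≠ 0 := by
  by_contra! h0
  have hrank := h z hz h0
  rw [min_eq_right hnl] at hrank
  have hinj := mulVec_injective_of_rank_eq hrank
  refine hω (funext fun j => ?_)
  -- By Euler's identity for weight ω, this vector lies in the kernel of the Jacobian at a common
  -- zero. Characteristic zero then turns its vanishing into ω = 0.
  have hzero : (fun j => (ω j : K) * z j) = 0 := by
    refine hinj ?_
    rw [Matrix.mulVec_zero]
    ext i
    have he := congrArg (MvPolynomial.eval z)
      (isWeightedHomogeneous_facePart (hfin i) hτ).sum_weight_X_mul_pderiv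
    simp only [map_sum, nsmul_eq_mul, map_mul, map_natCast, MvPolynomial.eval_X, h0 i, mul_zero]
      at he
    rw [Pi.zero_apply, ← he]
    rw [Matrix.mulVec, dotProduct]
    refine Finset.sum_congr rfl fun j _ => ?_
    rw [Matrix.of_apply]
    ring
  have := congrFun hzero j
  exact_mod_cast (mul_eq_zero.1 this).resolve_right (hz j)

end Algebra

/-! ### Derivatives of polynomial mappings -/

section Derivative

variable {K : Type*} [NontriviallyNormedField K]

theorem hasStrictFDerivAt_eval (P : MvPolynomial (Fin n) K) (z : Fin n → K) :
    HasStrictFDerivAt (fun z => MvPolynomial.eval z P)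
      (∑ j, MvPolynomial.eval z (MvPolynomial.pderiv j P) •
        (ContinuousLinearMap.proj j : (Fin n → K) →L[K] K)) z := by
  induction P using MvPolynomial.induction_on with
  | C a =>
    refine ((hasStrictFDerivAt_const (𝕜 := K) a z).congr_fderiv
      (ContinuousLinearMap.ext fun w => ?_)).congr_of_eventuallyEq
      (Filter.Eventually.of_forall fun z => by simp)
    simp
  | add P Q hP hQ =>
    refine ((hP.add hQ).congr_fderiv (ContinuousLinearMap.ext fun w => ?_)).congr_of_eventuallyEq
      (Filter.Eventually.of_forall fun z => by simp)
    simp [add_mul, Finset.sum_add_distrib]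
  | mul_X P j hP =>
    refine ((hP.mul (hasStrictFDerivAt_apply j z)).congr_fderiv
      (ContinuousLinearMap.ext fun w => ?_)).congr_of_eventuallyEq
      (Filter.Eventually.of_forall fun z => by simp)
    have h1 (i : Fin n) : MvPolynomial.eval z (MvPolynomial.pderiv i (P * MvPolynomial.X j)) * w i =
        z j * (MvPolynomial.eval z (MvPolynomial.pderiv i P) * w i) +
          if i = j then MvPolynomial.eval z P * w j else 0 := by
      rw [MvPolynomial.pderiv_mul, MvPolynomial.pderiv_X]
      split_ifs with h
      · subst h
        simp
        ring
      · simp [Ne.symm h]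
        ring
    simp only [add_apply, smul_apply, _root_.sum_apply, ContinuousLinearMap.proj_apply, smul_eq_mul,
      h1, Finset.sum_add_distrib, Finset.mul_sum, Finset.sum_ite_eq', Finset.mem_univ, if_true]
    ring

/-- The Jacobian matrix of a mapping with polynomial components. -/
noncomputable def jacobian (P : Fin l → MvPolynomial (Fin n) K) (z : Fin n → K) : Matrix (Fin l) (Fin n) K :=
  Matrix.of fun i j => MvPolynomial.eval z (MvPolynomial.pderiv j (P i))

theorem hasStrictFDerivAt_eval_scaled (P : Fin l → MvPolynomial (Fin n) K) (κ : K)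
    (d u : Fin n → K) :
    ∃ A : (Fin n → K) →L[K] (Fin l → K),
      HasStrictFDerivAt (fun u => κ • fun i => MvPolynomial.eval (d * u) (P i)) A u ∧
      ∀ w, A w = κ • (jacobian P (d * u)).mulVec (d * w) := by
  let L : (Fin n → K) →L[K] (Fin n → K) :=
    ContinuousLinearMap.pi fun j => d j • ContinuousLinearMap.proj j
  have hL (w) : L w = d * w := by
    ext j
    simp [L]
  let B : (Fin n → K) →L[K] (Fin l → K) := ContinuousLinearMap.pi fun i =>
    ∑ j, MvPolynomial.eval (d * u) (MvPolynomial.pderiv j (P i)) •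
      (ContinuousLinearMap.proj j : (Fin n → K) →L[K] K)
  have hB : HasStrictFDerivAt (fun z i => MvPolynomial.eval z (P i)) B (L u) := by
    rw [hL]
    exact hasStrictFDerivAt_pi.2 fun i => hasStrictFDerivAt_eval (P i) (d * u)
  refine ⟨κ • B.comp L, ?_, fun w => ?_⟩
  · have := (hB.comp u L.hasStrictFDerivAt).const_smul κ
    refine this.congr_of_eventuallyEq (Filter.Eventually.of_forall fun w => ?_)
    simp only [Pi.smul_apply]
    rw [hL]
  · ext i
    simp [B, hL, jacobian, Matrix.mulVec, dotProduct]

end Derivative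

end FaceParts

/-! ### The family of power series attached to a cone -/

section ConeFamily

open Filter

variable {K : Type*} [NontriviallyNormedField K]

/-- The power `ϖ^t` for `t ∈ ℕ ∪ {∞}`, where `ϖ^∞ = 0`. -/
noncomputable def unifPow (ϖ : K) (t : ℕ∞) : K := if t = ⊤ then 0 else ϖ ^ t.toNat

theorem unifPow_natCast (ϖ : K) (k : ℕ) : unifPow ϖ (k : ℕ∞) = ϖ ^ k := by
  simp [unifPow]

theorem norm_unifPow_le_one {ϖ : K} (hϖ : ‖ϖ‖ < 1) (t : ℕ∞) : ‖unifPow ϖ t‖ ≤ 1 := by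
  rw [unifPow]
  split_ifs
  · simp
  · rw [norm_pow]
    exact pow_le_one₀ (norm_nonneg _) hϖ.le

/-- Finite points of ℕ ∪ {∞} are isolated, and at ∞ the powers of ϖ tend to 0. -/
theorem continuous_unifPow {ϖ : K} (hϖ : ‖ϖ‖ < 1) : Continuous (unifPow ϖ) := by
  rw [continuous_iff_continuousAt]
  intro t
  rcases eq_or_ne t ⊤ with rfl | ht
  · have h0 : unifPow ϖ ⊤ = 0 := by simp [unifPow]
    rw [ContinuousAt, h0, Metric.tendsto_nhds]
    intro ε hε
    obtain ⟨N, hN⟩ := exists_pow_lt_of_lt_one hε hϖ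
    filter_upwards [ENat.tendsto_nhds_top_iff_natCast_lt.1 tendsto_id N] with t ht
    rw [dist_zero_right, unifPow]
    split_ifs with h
    · simpa
    · lift t to ℕ using h
      rw [ENat.toNat_natCast, norm_pow]
      have : N ≤ t := by exact_mod_cast (show (N : ℕ∞) < t from ht).le
      exact (pow_le_pow_of_le_one (norm_nonneg _) hϖ.le this).trans_lt hN
  · rw [ContinuousAt, ENat.nhds_eq_pure ht]
    exact tendsto_pure_nhds _ _

variable {n l : ℕ} {κ : Type*} [Fintype κ] {a : κ → Fin n → ℕ} {b : Fin n → ℕ} {v : Fin n →₀ ℕ}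

/-- The factor `ϖ^{⟨b, m - v⟩} ∏ᵢ ϖ^{tᵢ ⟨aᵢ, m - v⟩}`. -/
noncomputable def coneFactor (ϖ : K) (a : κ → Fin n → ℕ) (b : Fin n → ℕ) (v : Fin n →₀ ℕ)
    (t : κ → ℕ∞) (m : Fin n →₀ ℕ) : K :=
  ϖ ^ (natPairing b m - natPairing b v) *
    ∏ i, unifPow ϖ (t i) ^ (natPairing (a i) m - natPairing (a i) v)

/-- The point `b + ∑ tᵢ aᵢ` of a cone, the sum being taken over the `i` with `tᵢ ≠ ∞`. -/
def coneExp (a : κ → Fin n → ℕ) (b : Fin n → ℕ) (t : κ → ℕ∞) : Fin n → ℕ :=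
  b + ∑ i, (t i).toNat • a i

open Classical in
/-- The sum of the `aᵢ` with `tᵢ = ∞`. -/
noncomputable def topWeight (a : κ → Fin n → ℕ) (t : κ → ℕ∞) : Fin n → ℕ :=
  ∑ i, (if t i = ⊤ then 1 else 0) • a i

theorem natPairing_coneExp (t : κ → ℕ∞) (m : Fin n →₀ ℕ) :
    natPairing (coneExp a b t) m = natPairing b m + ∑ i, (t i).toNat * natPairing (a i) m := by
  rw [coneExp, natPairing_add, natPairing_sum]

theorem natPairing_topWeight_le {t : κ → ℕ∞} {m : Fin n →₀ ℕ}
    (ha : ∀ i, natPairing (a i) v ≤ natPairing (a i) m) :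
    natPairing (topWeight a t) v ≤ natPairing (topWeight a t) m := by
  classical
  rw [topWeight, natPairing_sum, natPairing_sum]
  exact Finset.sum_le_sum fun i _ => Nat.mul_le_mul_left _ (ha i)

/-- As v minimizes each aᵢ, equality for the sum forces equality for every summand: the face of
`topWeight` is the intersection of the faces of the aᵢ with tᵢ = ∞. -/
theorem natPairing_topWeight_eq_iff {t : κ → ℕ∞} {m : Fin n →₀ ℕ}
    (ha : ∀ i, natPairing (a i) v ≤ natPairing (a i) m) :
    natPairing (topWeight a t) m = natPairing (topWeight a t) v ↔
      ∀ i, t i = ⊤ → natPairing (a i) m = natPairing (a i) v := by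
  classical
  rw [topWeight, natPairing_sum, natPairing_sum, eq_comm,
    Finset.sum_eq_sum_iff_of_le fun i _ => Nat.mul_le_mul_left _ (ha i)]
  refine ⟨fun h i hi => ?_, fun h i _ => ?_⟩
  · have := h i (Finset.mem_univ i)
    simpa [hi, eq_comm] using this
  · split_ifs with hi
    · rw [h i hi]
    · simp

theorem topWeight_pos {t : κ → ℕ∞} {j : Fin n} {i : κ} (hi : t i = ⊤) (hij : 0 < a i j) :
    0 < topWeight a t j := by
  classical
  rw [topWeight, Finset.sum_apply]
  refine Finset.sum_pos' (fun _ _ => Nat.zero_le _) ⟨i, Finset.mem_univ i, ?_⟩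
  simpa [hi] using hij

theorem norm_coneFactor_le_one {ϖ : K} (hϖ : ‖ϖ‖ < 1) (t : κ → ℕ∞) (m : Fin n →₀ ℕ) :
    ‖coneFactor ϖ a b v t m‖ ≤ 1 := by
  rw [coneFactor, norm_mul, norm_prod, norm_pow]
  refine mul_le_one₀ (pow_le_one₀ (norm_nonneg _) hϖ.le)
    (Finset.prod_nonneg fun _ _ => norm_nonneg _)
    (Finset.prod_le_one (fun _ _ => norm_nonneg _) fun i _ => ?_)
  rw [norm_pow]
  exact pow_le_one₀ (norm_nonneg _) (norm_unifPow_le_one hϖ _)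

theorem continuous_coneFactor {ϖ : K} (hϖ : ‖ϖ‖ < 1) (m : Fin n →₀ ℕ) :
    Continuous fun t => coneFactor ϖ a b v t m := by
  unfold coneFactor
  refine continuous_const.mul (continuous_finsetProd _ fun i _ => ?_)
  exact ((continuous_unifPow hϖ).comp (continuous_apply i)).pow _

open Classical in
theorem pow_mul_unifPow_pow (ϖ : K) (t : ℕ∞) {x y : ℕ} (h : x ≤ y) :
    ϖ ^ (t.toNat * x) * unifPow ϖ t ^ (y - x) =
      if t = ⊤ → y = x then ϖ ^ (t.toNat * y) else 0 := by
  rcases eq_or_ne t ⊤ with rfl | ht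
  · rcases h.eq_or_lt with rfl | h
    · simp
    · simp [unifPow, h.ne', Nat.sub_ne_zero_of_lt h]
  · simp only [unifPow, ht, if_false, false_imp_iff, if_true]
    rw [← pow_mul, ← pow_add, ← mul_add, Nat.add_sub_cancel' h]

open Classical in
-- For such m the truncated subtractions are genuine. An index with tᵢ = ∞ contributes 0 to the
-- power ⟨aᵢ, m - v⟩, that is 1 if m lies on the face of aᵢ and 0 otherwise.
theorem pow_mul_coneFactor (ϖ : K) (t : κ → ℕ∞) {m : Fin n →₀ ℕ}
    (hb : natPairing b v ≤ natPairing b m) (ha : ∀ i, natPairing (a i) v ≤ natPairing (a i) m) :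
    ϖ ^ natPairing (coneExp a b t) v * coneFactor ϖ a b v t m =
      if natPairing (topWeight a t) m = natPairing (topWeight a t) v then
        ϖ ^ natPairing (coneExp a b t) m else 0 := by
  rw [natPairing_coneExp, natPairing_coneExp, pow_add, coneFactor, mul_mul_mul_comm, ← pow_add,
    Nat.add_sub_cancel' hb, ← Finset.prod_pow_eq_pow_sum, ← Finset.prod_mul_distrib,
    Finset.prod_congr rfl fun i _ => pow_mul_unifPow_pow ϖ (t i) (ha i), pow_add,
    ← Finset.prod_pow_eq_pow_sum]
  split_ifs with h
  · rw [natPairing_topWeight_eq_iff ha] at h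
    rw [Finset.prod_congr rfl fun i _ => if_pos (h i)]
  · rw [natPairing_topWeight_eq_iff ha] at h
    obtain ⟨i, hi⟩ := not_forall.1 h
    rw [Finset.prod_eq_zero (Finset.mem_univ i) (if_neg hi), mul_zero]

theorem monom_pow_mul (ϖ : K) (k : Fin n → ℕ) (u : Fin n → K) (m : Fin n →₀ ℕ) :
    monom ((fun j => ϖ ^ k j) * u) m = ϖ ^ natPairing k m * monom u m := by
  simp only [monom, natPairing, Pi.mul_apply, mul_pow, Finset.prod_mul_distrib, ← pow_mul,
    Finset.prod_pow_eq_pow_sum]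

/-- The coefficients of the power series attached to a cone. -/
noncomputable def coneCoeff (ϖ : K) (a : κ → Fin n → ℕ) (b : Fin n → ℕ) (v : Fin n →₀ ℕ)
    (c : (Fin n →₀ ℕ) → Fin l → K) (t : κ → ℕ∞) (m : Fin n →₀ ℕ) : Fin l → K :=
  coneFactor ϖ a b v t m • c m

theorem tendsto_coneCoeff {ϖ : K} (hϖ : ‖ϖ‖ < 1) {c : (Fin n →₀ ℕ) → Fin l → K}
    (hc : Tendsto c cofinite (𝓝 0)) (t : κ → ℕ∞) :
    Tendsto (coneCoeff ϖ a b v c t) cofinite (𝓝 0) := by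
  rw [tendsto_zero_iff_norm_tendsto_zero] at hc ⊢
  refine squeeze_zero (fun _ => norm_nonneg _) (fun m => ?_) hc
  rw [coneCoeff, norm_smul]
  exact mul_le_of_le_one_left (norm_nonneg _) (norm_coneFactor_le_one hϖ t m)

/-- Uniformity in m: all but finitely many coefficients are small for every t, because the cone
factors have norm at most 1, and each of the remaining ones is continuous in t. -/
theorem eventually_norm_coneCoeff_sub_le [IsUltrametricDist K] {ϖ : K} (hϖ : ‖ϖ‖ < 1)
    {c : (Fin n →₀ ℕ) → Fin l → K} (hc : Tendsto c cofinite (𝓝 0)) (t₁ : κ → ℕ∞) :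
    ∀ δ > 0, ∀ᶠ t in 𝓝 t₁, ∀ m,
      ‖coneCoeff ϖ a b v c t m - coneCoeff ϖ a b v c t₁ m‖ ≤ δ := by
  intro δ hδ
  have hE : {m | ¬ ‖c m‖ < δ}.Finite := by
    have := (tendsto_zero_iff_norm_tendsto_zero.1 hc).eventually (gt_mem_nhds hδ)
    exact this
  have h1 : ∀ᶠ t in 𝓝 t₁, ∀ m ∈ {m | ¬ ‖c m‖ < δ},
      ‖coneCoeff ϖ a b v c t m - coneCoeff ϖ a b v c t₁ m‖ ≤ δ := by
    refine (eventually_all_finite hE).2 fun m _ => ?_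
    have hcont : Continuous fun t => coneCoeff ϖ a b v c t m :=
      (continuous_coneFactor hϖ m).smul continuous_const
    filter_upwards [hcont.continuousAt (Metric.ball_mem_nhds _ hδ)] with t ht
    rw [← dist_eq_norm]
    exact (Metric.mem_ball.1 ht).le
  filter_upwards [h1] with t ht m
  by_cases hm : ‖c m‖ < δ
  · have hle (t : κ → ℕ∞) : ‖coneCoeff ϖ a b v c t m‖ ≤ ‖c m‖ := by
      rw [coneCoeff, norm_smul]
      exact mul_le_of_le_one_left (norm_nonneg _) (norm_coneFactor_le_one hϖ t m)
    exact (norm_sub_le_max' _ _).trans (max_le ((hle t).trans hm.le) ((hle t₁).trans hm.le))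
  · exact ht m hm

section Family

variable [IsUltrametricDist K] [CompleteSpace K] {ϖ : K} (hϖ : ‖ϖ‖ < 1) (hϖ0 : ϖ ≠ 0)
  {F : Fin l → MvPowerSeries (Fin n) K}

/-- The coefficients of the power series `F(ϖ^M x)`. -/
def scaledCoeff (ϖ : K) (M : ℕ) (F : Fin l → MvPowerSeries (Fin n) K) (m : Fin n →₀ ℕ) :
    Fin l → K :=
  fun i => ϖ ^ natPairing (fun _ => M) m * MvPowerSeries.coeff m (F i)

/-- The exponents that occur in one of the components of `F`. -/
def exponents (F : Fin l → MvPowerSeries (Fin n) K) : Set (Fin n →₀ ℕ) :=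
  {m | ∃ i, MvPowerSeries.coeff m (F i) ≠ 0}

variable {M : ℕ} (hF : Tendsto (scaledCoeff ϖ M F) cofinite (𝓝 0))
  (hb : ∀ m ∈ exponents F, natPairing b v ≤ natPairing b m)
  (ha : ∀ i, ∀ m ∈ exponents F, natPairing (a i) v ≤ natPairing (a i) m)

include hb ha in
open Classical in
theorem pow_mul_coneCoeff_apply (t : κ → ℕ∞) (u : Fin n → K) (m : Fin n →₀ ℕ) (i : Fin l) :
    ϖ ^ natPairing (coneExp a b t) v *
        (monom u m * coneCoeff ϖ a b v (scaledCoeff ϖ M F) t m i) =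
      if natPairing (topWeight a t) m = natPairing (topWeight a t) v then
        MvPowerSeries.coeff m (F i) * monom ((fun j => ϖ ^ (M + coneExp a b t j)) * u) m
      else 0 := by
  by_cases hm : MvPowerSeries.coeff m (F i) = 0
  · simp [coneCoeff, scaledCoeff, hm]
  · have h1 := pow_mul_coneFactor ϖ t (hb m ⟨i, hm⟩) fun i' => ha i' m ⟨i, hm⟩
    have h2 : ϖ ^ natPairing (coneExp a b t) v *
        (monom u m * coneCoeff ϖ a b v (scaledCoeff ϖ M F) t m i) =
        (ϖ ^ natPairing (coneExp a b t) v * coneFactor ϖ a b v t m) *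
          (monom u m * (ϖ ^ natPairing (fun _ => M) m * MvPowerSeries.coeff m (F i))) := by
      simp only [coneCoeff, scaledCoeff, Pi.smul_apply, smul_eq_mul]
      ring
    have h3 : natPairing (fun j => M + coneExp a b t j) m =
        natPairing (fun _ => M) m + natPairing (coneExp a b t) m := natPairing_add _ _ _
    rw [h2, h1, monom_pow_mul ϖ (fun j => M + coneExp a b t j), h3, pow_add]
    split_ifs
    · ring
    · rw [zero_mul]

include hϖ hF in
theorem hasSum_powSum_apply (t : κ → ℕ∞) {u : Fin n → K} (hu : u ∈ polydisc K n) (i : Fin l) :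
    HasSum (fun m => monom u m * coneCoeff ϖ a b v (scaledCoeff ϖ M F) t m i)
      (powSum (coneCoeff ϖ a b v (scaledCoeff ϖ M F) t) u i) := by
  have h := (summable_monom_smul (tendsto_coneCoeff hϖ hF t (a := a) (b := b) (v := v)) hu).hasSum
  exact Pi.hasSum.1 h i

include hϖ hF hb ha in
-- This extracts the common factor ϖ^⟨k,v⟩ from f on a shell. At finite parameters `topWeight` is 0,
-- so no monomial is lost.
theorem pow_smul_powSum_of_hasSum {k : κ → ℕ} {u : Fin n → K} (hu : u ∈ polydisc K n)
    {y : Fin l → K}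
    (hy : ∀ i, HasSum (fun m : Fin n →₀ ℕ => MvPowerSeries.coeff m (F i) *
      m.prod fun j e => (ϖ ^ (M + coneExp a b (fun i => (k i : ℕ∞)) j) * u j) ^ e) (y i)) :
    y = ϖ ^ natPairing (coneExp a b fun i => (k i : ℕ∞)) v •
      powSum (coneCoeff ϖ a b v (scaledCoeff ϖ M F) fun i => (k i : ℕ∞)) u := by
  ext i
  refine (hy i).unique ?_
  rw [Pi.smul_apply, smul_eq_mul]
  convert! (hasSum_powSum_apply hϖ hF (fun i => (k i : ℕ∞)) hu i).mul_left
    (ϖ ^ natPairing (coneExp a b fun i => (k i : ℕ∞)) v) using 2 with m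
  rw [pow_mul_coneCoeff_apply hb ha, if_pos, Finsupp.prod_fintype _ _ (by simp)]
  · rfl
  · simp [topWeight, natPairing]

include hϖ hF hb ha in
-- The infinite entries of t select the face, and the finite ones only rescale the point and the
-- value. So the rank condition, imposed at all points of the torus, speaks about every member of
-- the family.
theorem pow_smul_powSum_eq_eval (hv : v ∈ exponents F) (t : κ → ℕ∞)
    (hfin : ∀ i, {m | expPoint m ∈ weightFace (exponents F) (topWeight a t) ∧
      MvPowerSeries.coeff m (F i) ≠ 0}.Finite) {u : Fin n → K} (hu : u ∈ polydisc K n) :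
    ϖ ^ natPairing (coneExp a b t) v •
        powSum (coneCoeff ϖ a b v (scaledCoeff ϖ M F) t) u =
      fun i => MvPolynomial.eval ((fun j => ϖ ^ (M + coneExp a b t j)) * u)
        (facePart (F i) (weightFace (exponents F) (topWeight a t))) := by
  classical
  ext i
  rw [Pi.smul_apply, smul_eq_mul,
    ← ((hasSum_powSum_apply hϖ hF t hu i).mul_left (ϖ ^ natPairing (coneExp a b t) v)).tsum_eq,
    eval_facePart (hfin i)]
  have hterm (m) : ϖ ^ natPairing (coneExp a b t) v *
        (monom u m * coneCoeff ϖ a b v (scaledCoeff ϖ M F) t m i) =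
      if expPoint m ∈ weightFace (exponents F) (topWeight a t) then
        MvPowerSeries.coeff m (F i) *
          ∏ j, ((fun j => ϖ ^ (M + coneExp a b t j)) * u) j ^ m j else 0 := by
    rw [pow_mul_coneCoeff_apply hb ha, ← monom]
    by_cases hm : MvPowerSeries.coeff m (F i) = 0
    · simp [hm]
    · congr 1
      rw [mem_weightFace_iff hv fun m hm => natPairing_topWeight_le fun i => ha i m hm,
        pairing_expPoint, Nat.cast_inj, eq_iff_iff]
      exact ⟨fun h => ⟨expPoint_mem_newtonPolyhedron (show m ∈ exponents F from ⟨i, hm⟩) fun _ => le_rfl, h⟩, fun h => h.2⟩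
  simp only [hterm]
  refine tsum_eq_finsum ((hfin i).subset fun m hm => ?_)
  rw [Function.mem_support] at hm
  split_ifs at hm with h
  · exact ⟨h, left_ne_zero_of_mul hm⟩
  · exact absurd rfl hm

end Family

end ConeFamily

/-! ### Local behaviour of the family attached to a cone -/

section ConeLocal

open Filter Polynomial MeasureTheory

variable {K : Type*} [NontriviallyNormedField K] [IsUltrametricDist K] [ProperSpace K] {n l : ℕ}

/-- The points all of whose coordinates are units. -/
def unitTorus (K : Type*) [NontriviallyNormedField K] (n : ℕ) : Set (Fin n → K) :=
  {u | ∀ j, ‖u j‖ = 1}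

theorem unitTorus_subset_polydisc : unitTorus K n ⊆ polydisc K n := fun _ hu j => (hu j).le

theorem unitTorus_eq_pi : unitTorus K n = Set.univ.pi fun _ => Metric.sphere (0 : K) 1 := by
  ext u
  simp [unitTorus]

theorem isCompact_unitTorus : IsCompact (unitTorus K n) := by
  rw [unitTorus_eq_pi]
  exact isCompact_univ_pi fun _ => isCompact_sphere 0 1

theorem isOpen_unitTorus : IsOpen (unitTorus K n) := by
  rw [unitTorus_eq_pi]
  exact isOpen_set_pi Set.finite_univ fun _ _ => IsUltrametricDist.isOpen_sphere 0 one_ne_zero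

variable {κ : Type*} [Fintype κ] {a : κ → Fin n → ℕ} {b : Fin n → ℕ} {v : Fin n →₀ ℕ}
  {ϖ : K} (hϖ : ‖ϖ‖ < 1) (hϖ0 : ϖ ≠ 0) {F : Fin l → MvPowerSeries (Fin n) K}
  {M : ℕ} (hF : Tendsto (scaledCoeff ϖ M F) cofinite (𝓝 0)) (hv : v ∈ exponents F)
  (hb : ∀ m ∈ exponents F, natPairing b v ≤ natPairing b m)
  (ha : ∀ i, ∀ m ∈ exponents F, natPairing (a i) v ≤ natPairing (a i) m)
  {t₁ : κ → ℕ∞}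
  (hfin : ∀ i, {m | expPoint m ∈ weightFace (exponents F) (topWeight a t₁) ∧
      MvPowerSeries.coeff m (F i) ≠ 0}.Finite)
  (hnd : NonDegenerateOn F (weightFace (exponents F) (topWeight a t₁))) {u₁ : Fin n → K}
  (hu₁ : u₁ ∈ unitTorus K n)

include hϖ hϖ0 hF hv hb ha hfin hnd hu₁

/-- At a zero in the torus, the limit of the family is differentiable, with derivative of maximal
rank. -/
theorem hasStrictFDerivAt_powSum_of_eq_zero
    (h0 : powSum (coneCoeff ϖ a b v (scaledCoeff ϖ M F) t₁) u₁ = 0) :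
    ∃ A : (Fin n → K) →L[K] (Fin l → K),
      HasStrictFDerivAt (powSum (coneCoeff ϖ a b v (scaledCoeff ϖ M F) t₁)) A u₁ ∧
      (l ≤ n → Function.Surjective A) ∧ (n ≤ l → Function.Injective A) := by
  set d : Fin n → K := fun j => ϖ ^ (M + coneExp a b t₁ j) with hd
  have hd0 (j) : d j ≠ 0 := pow_ne_zero _ hϖ0
  set e : K := ϖ ^ natPairing (coneExp a b t₁) v with he
  have he0 : e ≠ 0 := pow_ne_zero _ hϖ0
  set P := fun i => facePart (F i) (weightFace (exponents F) (topWeight a t₁)) with hP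
  have heq {u} (hu : u ∈ polydisc K n) :
      powSum (coneCoeff ϖ a b v (scaledCoeff ϖ M F) t₁) u =
        e⁻¹ • fun i => MvPolynomial.eval (d * u) (P i) := by
    rw [← pow_smul_powSum_eq_eval hϖ hF hb ha hv t₁ hfin hu, smul_smul, ← he, inv_mul_cancel₀ he0,
      one_smul]
  have hup := unitTorus_subset_polydisc hu₁
  obtain ⟨A, hA, hAw⟩ := hasStrictFDerivAt_eval_scaled P e⁻¹ d u₁
  have hz (j) : (d * u₁) j ≠ 0 := mul_ne_zero (hd0 j) fun h => by
    have := hu₁ j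
    rw [h, norm_zero] at this
    exact zero_ne_one this
  have hrank : (jacobian P (d * u₁)).rank = min l n := by
    refine hnd _ hz fun i => ?_
    have h1 := heq hup
    rw [h0, eq_comm, smul_eq_zero_iff_right (inv_ne_zero he0)] at h1
    exact congrFun h1 i
  have hdw (w : Fin n → K) : d * (d⁻¹ * w) = w := by
    ext j
    simp [mul_inv_cancel_left₀ (hd0 j)]
  refine ⟨A, hA.congr_of_eventuallyEq ?_, fun hln y => ?_, fun hnl w w' hww => ?_⟩
  · filter_upwards [isOpen_polydisc.mem_nhds hup] with u hu
    exact (heq hu).symm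
  · rw [min_eq_left hln] at hrank
    obtain ⟨w, hw⟩ := mulVec_surjective_of_rank_eq hrank (e • y)
    refine ⟨d⁻¹ * w, ?_⟩
    rw [hAw, hdw, hw, smul_smul, inv_mul_cancel₀ he0, one_smul]
  · rw [min_eq_right hnl] at hrank
    rw [hAw, hAw] at hww
    have h1 := mulVec_injective_of_rank_eq hrank (smul_right_injective _ (inv_ne_zero he0) hww)
    ext j
    exact mul_left_cancel₀ (hd0 j) (congrFun h1 j)

/-- The limit is proportional to a face part that is quasi-homogeneous for the nonzero weight
`topWeight`, so Euler's identity excludes a zero in the torus. -/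
theorem powSum_ne_zero_of_topWeight_ne_zero [CharZero K] (hnl : n ≤ l)
    (hω : topWeight a t₁ ≠ 0) :
    powSum (coneCoeff ϖ a b v (scaledCoeff ϖ M F) t₁) u₁ ≠ 0 := by
  intro h0
  have hz (j) : ((fun j => ϖ ^ (M + coneExp a b t₁ j)) * u₁) j ≠ 0 :=
    mul_ne_zero (pow_ne_zero _ hϖ0) fun h => by
      have := hu₁ j
      rw [h, norm_zero] at this
      exact zero_ne_one this
  have hτ (m : Fin n →₀ ℕ) (hm : expPoint m ∈ weightFace (exponents F) (topWeight a t₁)) :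
      natPairing (topWeight a t₁) m = natPairing (topWeight a t₁) v := by
    have h2 := ((mem_weightFace_iff hv
      fun m hm => natPairing_topWeight_le fun i => ha i m hm).1 hm).2
    rw [pairing_expPoint] at h2
    exact_mod_cast h2
  obtain ⟨i, hi⟩ := hnd.exists_eval_ne_zero hnl hfin hω hτ hz
  have h1 := congrFun (pow_smul_powSum_eq_eval hϖ hF hb ha hv t₁ hfin
    (unitTorus_subset_polydisc hu₁)) i
  rw [h0, smul_zero] at h1
  exact hi h1.symm

theorem uniformlySubmersiveAt_coneFamily (hln : l ≤ n)
    (h0 : powSum (coneCoeff ϖ a b v (scaledCoeff ϖ M F) t₁) u₁ = 0) :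
    UniformlySubmersiveAt (fun u t => powSum (coneCoeff ϖ a b v (scaledCoeff ϖ M F) t) u) u₁ t₁ := by
  obtain ⟨A, hA, hs, -⟩ :=
    hasStrictFDerivAt_powSum_of_eq_zero hϖ hϖ0 hF hv hb ha hfin hnd hu₁ h0
  exact uniformlySubmersiveAt_powSum (tendsto_coneCoeff hϖ hF)
    (eventually_norm_coneCoeff_sub_le hϖ hF t₁) (unitTorus_subset_polydisc hu₁) hA (hs hln)

end ConeLocal

/-! ### Local rationality of the family at a nonzero value and at a submersive zero -/

section ConeLocallyRational

open Filter Polynomial MeasureTheory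

variable {K : Type*} [NontriviallyNormedField K] [IsUltrametricDist K] [ProperSpace K]
  [MeasurableSpace K] [BorelSpace K] {n l : ℕ} (hK : IsNormalizedNorm K)
  (μ : Measure (Fin n → K)) [μ.IsAddHaarMeasure]
  {κ : Type*} [Fintype κ] {a : κ → Fin n → ℕ} {b : Fin n → ℕ} {v : Fin n →₀ ℕ}
  {ϖ : K} (hϖ : ‖ϖ‖ < 1) {c : (Fin n →₀ ℕ) → Fin l → K}
  (hc : Tendsto c cofinite (𝓝 0)) {t₁ : κ → ℕ∞} {u₁ : Fin n → K}
  (hu₁ : u₁ ∈ unitTorus K n)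

include hK hϖ hc hu₁

theorem locallyRational_coneFamily_of_ne_zero
    (h0 : powSum (coneCoeff ϖ a b v c t₁) u₁ ≠ 0) :
    LocallyRational μ 1 (fun u t => powSum (coneCoeff ϖ a b v c t) u) u₁ t₁ :=
  locallyRational_of_ne_zero hK μ (tendsto_powSum (tendsto_coneCoeff hϖ hc)
    (eventually_norm_coneCoeff_sub_le hϖ hc t₁) (unitTorus_subset_polydisc hu₁)) h0

theorem locallyRational_coneFamily_of_submersive
    (h0 : powSum (coneCoeff ϖ a b v c t₁) u₁ = 0)
    (hs : UniformlySubmersiveAt (fun u t => powSum (coneCoeff ϖ a b v c t) u) u₁ t₁) :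
    LocallyRational μ (1 - C (((residueCard K : ℂ)⁻¹) ^ l) * X)
      (fun u t => powSum (coneCoeff ϖ a b v c t) u) u₁ t₁ := by
  refine locallyRational_of_submersive (g := fun u t => powSum (coneCoeff ϖ a b v c t) u)
    hK μ ?_ h0 hs
  have h1 : Tendsto (fun p : (Fin n → K) × (κ → ℕ∞) => powSum (coneCoeff ϖ a b v c p.2) p.1)
      (𝓝 (u₁, t₁)) (𝓝 (powSum (coneCoeff ϖ a b v c t₁) u₁)) :=
    tendsto_powSum (tendsto_coneCoeff hϖ hc) (eventually_norm_coneCoeff_sub_le hϖ hc t₁)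
      (unitTorus_subset_polydisc hu₁)
  have h2 : ContinuousAt (fun t : κ → ℕ∞ => (u₁, t)) t₁ := by fun_prop
  exact Tendsto.comp (f := fun t : κ → ℕ∞ => (u₁, t))
    (g := fun p : (Fin n → K) × (κ → ℕ∞) => powSum (coneCoeff ϖ a b v c p.2) p.1) h1 h2

end ConeLocallyRational

/-! ### Decomposition of the integral into shells -/

section Shells

open Filter Polynomial MeasureTheory

variable {K : Type*} [NontriviallyNormedField K] [IsUltrametricDist K] {n l : ℕ}

/-- The polydisc of radius `‖ϖ‖^M`. -/
def smallBox (ϖ : K) (n M : ℕ) : Set (Fin n → K) := {x | ∀ j, ‖x j‖ ≤ ‖ϖ‖ ^ M}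

/-- The set of the points with prescribed absolute values `‖xⱼ‖ = ‖ϖ‖^(M + kⱼ)`. -/
def shell (ϖ : K) (M : ℕ) (k : Fin n → ℕ) : Set (Fin n → K) := {x | ∀ j, ‖x j‖ = ‖ϖ‖ ^ (M + k j)}

theorem smallBox_eq_closedBall (ϖ : K) (n M : ℕ) :
    smallBox ϖ n M = Metric.closedBall 0 (‖ϖ‖ ^ M) := by
  ext x
  rw [mem_closedBall_zero_iff, pi_norm_le_iff_of_nonneg (by positivity)]
  rfl

variable [ProperSpace K]

theorem isCompact_smallBox (ϖ : K) (n M : ℕ) : IsCompact (smallBox ϖ n M) := by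
  rw [smallBox_eq_closedBall]
  exact isCompact_closedBall 0 _

theorem isClosed_shell (ϖ : K) (M : ℕ) (k : Fin n → ℕ) : IsClosed (shell ϖ M k) := by
  simp only [shell, Set.ofPred_forall]
  exact isClosed_iInter fun j => isClosed_eq (continuous_apply j).norm continuous_const

theorem pairwise_disjoint_shell {ϖ : K} (hϖ : ‖ϖ‖ < 1) (hϖ0 : ϖ ≠ 0) (M : ℕ) :
    Pairwise (Function.onFun Disjoint fun k : Fin n → ℕ => shell ϖ M k) := by
  intro k k' hkk
  refine Set.disjoint_left.2 fun x hx hx' => hkk (funext fun j => ?_)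
  have h : ‖ϖ‖ ^ (M + k j) = ‖ϖ‖ ^ (M + k' j) := (hx j).symm.trans (hx' j)
  have := pow_right_injective₀ (norm_pos_iff.2 hϖ0) hϖ.ne h
  simpa using this

theorem iUnion_shell (hK : IsNormalizedNorm K) {ϖ : K} (hϖ : ‖ϖ‖ = (residueCard K : ℝ)⁻¹) (M : ℕ) :
    ⋃ k : Fin n → ℕ, shell ϖ M k = smallBox ϖ n M ∩ {x | ∀ j, x j ≠ 0} := by
  have hq : (1 : ℝ) < residueCard K := by exact_mod_cast one_lt_residueCard hK
  ext x
  simp only [Set.mem_iUnion, Set.mem_inter_iff]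
  constructor
  · rintro ⟨k, hk⟩
    refine ⟨fun j => ?_, fun j h0 => ?_⟩
    · rw [hk j, pow_add]
      exact mul_le_of_le_one_right (by positivity)
        (pow_le_one₀ (norm_nonneg _) (by rw [hϖ]; exact inv_le_one_of_one_le₀ hq.le))
    · have := hk j
      rw [h0, norm_zero, hϖ] at this
      have h2 : (0 : ℝ) < ((residueCard K : ℝ)⁻¹) ^ (M + k j) := by positivity
      exact h2.ne this
  · rintro ⟨hx, hx0⟩
    have key (j) : ∃ k : ℕ, ‖x j‖ = ‖ϖ‖ ^ (M + k) := by
      obtain ⟨e, he⟩ := (hK ‖x j‖).1 ⟨x j, hx0 j, rfl⟩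
      have hle := hx j
      rw [he, hϖ, inv_pow, ← zpow_natCast, ← zpow_neg, zpow_le_zpow_iff_right₀ hq] at hle
      refine ⟨(-e - M).toNat, ?_⟩
      rw [he, hϖ, inv_pow, ← zpow_natCast, ← zpow_neg]
      congr 1
      omega
    choose k hk using key
    exact ⟨k, hk⟩

theorem integrable_zetaIntegrand [MeasurableSpace K] [BorelSpace K] {μ : Measure (Fin n → K)}
    [IsFiniteMeasureOnCompacts μ] {Φ : (Fin n → K) → ℂ} (hΦ : IsLocallyConstant Φ)
    {f : (Fin n → K) → (Fin l → K)} {B : Set (Fin n → K)} (hB : IsCompact B)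
    (hΦB : Function.support Φ ⊆ B) (hf : ContinuousOn f B) {s : ℂ} (hs : 0 < s.re) :
    Integrable (zetaIntegrand Φ f s) μ := by
  rw [← integrableOn_iff_integrable_of_support_subset (s := B)]
  · refine ContinuousOn.integrableOn_compact hB (hΦ.continuous.continuousOn.mul ?_)
    rw [continuousOn_iff_continuous_domRestrict] at hf ⊢
    exact continuous_norm_cpow hf hs
  · exact (Function.support_mul_subset_left _ _).trans hΦB

/-- The shells are disjoint and fill the box up to the coordinate hyperplanes, which are null. -/
theorem hasSum_setIntegral_shell [MeasurableSpace K] [BorelSpace K] (hK : IsNormalizedNorm K)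
    {μ : Measure (Fin n → K)} [μ.IsAddHaarMeasure] (hμ : μ {x | ∀ j, ‖x j‖ ≤ 1} = 1)
    {ϖ : K} (hϖ : ‖ϖ‖ = (residueCard K : ℝ)⁻¹) {M : ℕ} {φ : (Fin n → K) → ℂ}
    (hφ : Integrable φ μ) (hsupp : Function.support φ ⊆ smallBox ϖ n M) :
    HasSum (fun k : Fin n → ℕ => ∫ x in shell ϖ M k, φ x ∂μ) (∫ x, φ x ∂μ) := by
  have hq : (1 : ℝ) < residueCard K := by exact_mod_cast one_lt_residueCard hK
  have h1 : ‖ϖ‖ < 1 := by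
    rw [hϖ]
    exact inv_lt_one_of_one_lt₀ hq
  have h0 : ϖ ≠ 0 := norm_pos_iff.1 (by rw [hϖ]; positivity)
  have h := hasSum_integral_iUnion (μ := μ) (f := φ)
    (fun k => (isClosed_shell ϖ M k).measurableSet) (pairwise_disjoint_shell h1 h0 M)
    hφ.integrableOn
  convert! h using 1
  rw [← setIntegral_eq_integral_of_forall_compl_eq_zero (s := smallBox ϖ n M)
    fun x hx => Function.notMem_support.1 fun hx' => hx (hsupp hx')]
  refine setIntegral_congr_set ?_
  rw [iUnion_shell hK hϖ]
  have hne : ∀ᵐ x ∂μ, ∀ j, x j ≠ 0 :=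
    ae_all_iff.2 fun j => measure_eq_zero_iff_ae_notMem.1 (measure_coordinate_eq_zero μ hμ j)
  filter_upwards [hne] with x hx
  exact propext ⟨fun h => ⟨h, hx⟩, fun h => h.1⟩

/-- The point with coordinates `ϖ^(M + bⱼ) ∏ᵢ ϖ^(tᵢ aᵢⱼ) uⱼ`. -/
noncomputable def conePoint {κ : Type*} [Fintype κ] (ϖ : K) (M : ℕ) (a : κ → Fin n → ℕ)
    (b : Fin n → ℕ) (t : κ → ℕ∞) (u : Fin n → K) : Fin n → K :=
  fun j => ϖ ^ (M + b j) * (∏ i, unifPow ϖ (t i) ^ a i j) * u j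

section Cone

variable {κ : Type*} [Fintype κ] {a : κ → Fin n → ℕ} {b : Fin n → ℕ} {v : Fin n →₀ ℕ}

theorem conePoint_natCast (ϖ : K) (M : ℕ) (t : κ → ℕ) (u : Fin n → K) :
    conePoint ϖ M a b (fun i => (t i : ℕ∞)) u =
      fun j => ϖ ^ (M + coneExp a b (fun i => (t i : ℕ∞)) j) * u j := by
  ext j
  simp only [conePoint, unifPow_natCast, coneExp, Pi.add_apply, Finset.sum_apply, Pi.smul_apply,
    ENat.toNat_natCast, smul_eq_mul, ← pow_mul, Finset.prod_pow_eq_pow_sum, ← pow_add, add_assoc]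

theorem continuous_conePoint {ϖ : K} (hϖ : ‖ϖ‖ < 1) (M : ℕ) :
    Continuous fun p : (Fin n → K) × (κ → ℕ∞) => conePoint ϖ M a b p.2 p.1 := by
  refine continuous_pi fun j => ?_
  refine (continuous_const.mul (continuous_finsetProd _ fun i _ => ?_)).mul
    ((continuous_apply j).comp continuous_fst)
  exact ((continuous_unifPow hϖ).comp ((continuous_apply i).comp continuous_snd)).pow _

theorem coordSum_coneExp (t : κ → ℕ) :
    coordSum (coneExp a b fun i => (t i : ℕ∞)) = coordSum b + ∑ i, t i * coordSum (a i) := by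
  simp only [coordSum, coneExp, Pi.add_apply, Finset.sum_apply, Pi.smul_apply,
    ENat.toNat_natCast, smul_eq_mul, Finset.sum_add_distrib, Finset.mul_sum]
  rw [Finset.sum_comm]

variable [MeasurableSpace K] [BorelSpace K] (hK : IsNormalizedNorm K)
  (μ : Measure (Fin n → K)) [μ.IsAddHaarMeasure] {ϖ : K}
  (hϖ : ‖ϖ‖ = (residueCard K : ℝ)⁻¹)

include hK hϖ

theorem setIntegral_shell (M : ℕ) (k : Fin n → ℕ) (φ : (Fin n → K) → ℂ) :
    ∫ x in shell ϖ M k, φ x ∂μ = ((residueCard K : ℂ)⁻¹) ^ (n * M + coordSum k) *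
      ∫ u in unitTorus K n, φ (fun j => ϖ ^ (M + k j) * u j) ∂μ := by
  have hq : 0 < (residueCard K : ℝ) := residueCard_pos_real hK
  have h0 : ϖ ≠ 0 := norm_pos_iff.1 (by rw [hϖ]; positivity)
  set T := diagEquiv (fun j => ϖ ^ (M + k j)) fun j => pow_ne_zero _ h0 with hT
  have hTu (u) : T u = fun j => ϖ ^ (M + k j) * u j := funext fun j => by rw [hT, diagEquiv_apply]
  rw [setIntegral_eq_haarScale_mul μ T (isClosed_shell ϖ M k).measurableSet]
  have hpre : T ⁻¹' shell ϖ M k = unitTorus K n := by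
    ext u
    rw [Set.mem_preimage, hTu]
    refine forall_congr' fun j => ?_
    rw [norm_mul, norm_pow]
    have : ‖ϖ‖ ^ (M + k j) ≠ 0 := pow_ne_zero _ (norm_ne_zero_iff.2 h0)
    constructor
    · intro h
      exact mul_left_cancel₀ this (h.trans (mul_one _).symm)
    · intro h
      rw [h, mul_one]
  have hscale : (((haarScale T : NNReal) : ℝ) : ℂ) =
      ((residueCard K : ℂ)⁻¹) ^ (n * M + coordSum k) := by
    rw [hT, haarScale_diagEquiv hK]
    simp only [norm_pow, hϖ, Finset.prod_pow_eq_pow_sum, Finset.sum_add_distrib, coordSum]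
    push_cast
    simp
  rw [hpre, hscale]
  simp only [hTu]

variable {F : Fin l → MvPowerSeries (Fin n) K} {M : ℕ}
  (hF : Tendsto (scaledCoeff ϖ M F) cofinite (𝓝 0))
  (hb : ∀ m ∈ exponents F, natPairing b v ≤ natPairing b m)
  (ha : ∀ i, ∀ m ∈ exponents F, natPairing (a i) v ≤ natPairing (a i) m)
  {f : (Fin n → K) → (Fin l → K)}
  (hf : ∀ x ∈ smallBox ϖ n M, ∀ i, HasSum (fun m : Fin n →₀ ℕ =>
    MvPowerSeries.coeff m (F i) * m.prod fun j e => x j ^ e) (f x i))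

include hF hb ha hf

/-- The Jacobian q^(-nM - σ(k)) and the extracted factor q^(-s⟨k,v⟩) have exponents affine in t, so
they split into powers indexed by the generators. Only the torus integral retains a further
dependence on t. -/
theorem setIntegral_shell_coneExp (Φ : (Fin n → K) → ℂ) (t : κ → ℕ) {s : ℂ} :
    ∫ x in shell ϖ M (coneExp a b fun i => (t i : ℕ∞)), zetaIntegrand Φ f s x ∂μ =
      ((residueCard K : ℂ)⁻¹) ^ (n * M + coordSum b) *
        ((residueCard K : ℂ) ^ (-s)) ^ natPairing b v *
      ((∏ i, (((residueCard K : ℂ)⁻¹) ^ coordSum (a i) *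
        ((residueCard K : ℂ) ^ (-s)) ^ natPairing (a i) v) ^ t i) *
      ∫ u in unitTorus K n, Φ (conePoint ϖ M a b (fun i => (t i : ℕ∞)) u) *
        ((‖powSum (coneCoeff ϖ a b v (scaledCoeff ϖ M F) fun i => (t i : ℕ∞)) u‖ : ℝ) : ℂ) ^ s
          ∂μ) := by
  have hq := one_lt_residueCard hK
  have hqr : (1 : ℝ) < residueCard K := by exact_mod_cast hq
  have h1 : ‖ϖ‖ < 1 := by
    rw [hϖ]
    exact inv_lt_one_of_one_lt₀ hqr
  set k := coneExp a b fun i => (t i : ℕ∞) with hk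
  have hintegrable : ∫ u in unitTorus K n, zetaIntegrand Φ f s (fun j => ϖ ^ (M + k j) * u j) ∂μ =
      ((residueCard K : ℂ) ^ (-s)) ^ natPairing k v *
      ∫ u in unitTorus K n, Φ (conePoint ϖ M a b (fun i => (t i : ℕ∞)) u) *
        ((‖powSum (coneCoeff ϖ a b v (scaledCoeff ϖ M F) fun i => (t i : ℕ∞)) u‖ : ℝ) : ℂ) ^ s
          ∂μ := by
    rw [← integral_const_mul]
    refine setIntegral_congr_fun isOpen_unitTorus.measurableSet fun u hu => ?_
    have hup := unitTorus_subset_polydisc hu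
    have hbox : (fun j => ϖ ^ (M + k j) * u j) ∈ smallBox ϖ n M := fun j => by
      rw [norm_mul, hu j, mul_one, norm_pow, pow_add]
      exact mul_le_of_le_one_right (by positivity) (pow_le_one₀ (norm_nonneg _) h1.le)
    have hfx := pow_smul_powSum_of_hasSum h1 hF hb ha (k := t) hup (hf _ hbox)
    have hpow : ((‖ϖ‖ ^ natPairing k v : ℝ) : ℂ) ^ s =
        ((residueCard K : ℂ) ^ (-s)) ^ natPairing k v := by
      have := ofReal_zpow_cpow hq (-(natPairing k v : ℤ)) s
      rw [neg_neg, zpow_natCast, zpow_neg, zpow_natCast, ← inv_pow] at this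
      rw [hϖ, this]
    simp only [zetaIntegrand]
    rw [hfx, norm_smul, norm_pow, ← hk, Complex.ofReal_mul,
      Complex.mul_cpow_ofReal_nonneg (by positivity) (norm_nonneg _), hpow, conePoint_natCast,
      ← hk]
    ring
  rw [setIntegral_shell hK μ hϖ, hintegrable, hk, coordSum_coneExp, natPairing_coneExp]
  simp only [ENat.toNat_natCast, mul_pow, Finset.prod_mul_distrib, ← pow_mul, pow_add,
    ← Finset.prod_pow_eq_pow_sum, mul_comm (coordSum _), mul_comm (natPairing (a _) v)]
  ring

/-- The integral over one cone of shells. -/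
theorem exists_rational_hasSum_shell (hσ : ∀ i, 0 < coordSum (a i)) {Φ : (Fin n → K) → ℂ}
    (hΦ : IsLocallyConstant Φ) {D : ℂ[X]}
    (h : ∀ t₁ : κ → ℕ∞, ∀ u ∈ unitTorus K n, Φ (conePoint ϖ M a b t₁ u) = 0 ∨
      LocallyRational μ D (fun u t => powSum (coneCoeff ϖ a b v (scaledCoeff ϖ M F) t) u) u t₁) :
    ∃ Z, RationalWithDenom (residueCard K)
        (D * ∏ i, poleFactor (residueCard K) (coordSum (a i)) (natPairing (a i) v)) Z ∧
      ∀ s : ℂ, 0 < s.re → HasSum (fun t : κ → ℕ =>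
        ∫ x in shell ϖ M (coneExp a b fun i => (t i : ℕ∞)), zetaIntegrand Φ f s x ∂μ) (Z s) := by
  have hqr : (1 : ℝ) < residueCard K := by exact_mod_cast one_lt_residueCard hK
  have h1 : ‖ϖ‖ < 1 := by
    rw [hϖ]
    exact inv_lt_one_of_one_lt₀ hqr
  obtain ⟨Z, hZ, hsum⟩ := exists_rational_hasSum_cone (one_lt_residueCard hK)
    (fun i => coordSum (a i)) (fun i => natPairing (a i) v) hσ (D := D)
    (fun t s => ∫ u in unitTorus K n, Φ (conePoint ϖ M a b t u) *
      ((‖powSum (coneCoeff ϖ a b v (scaledCoeff ϖ M F) t) u‖ : ℝ) : ℂ) ^ s ∂μ)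
    fun t₁ => exists_rational_integral_of_locallyRational
      (g := fun u t => powSum (coneCoeff ϖ a b v (scaledCoeff ϖ M F) t) u)
      (Φ := fun u t => Φ (conePoint ϖ M a b t u)) hK μ isCompact_unitTorus isOpen_unitTorus
      -- The point of the shell extends continuously to infinite parameters, so the weight is
      -- locally constant in (u, t).
      (fun u _ => ((hΦ.comp_continuous (continuous_conePoint h1 M)).eventually_eq (u, t₁)))
      (fun t => (continuousOn_powSum (tendsto_coneCoeff h1 hF t)).mono unitTorus_subset_polydisc)
      (h t₁)
  refine ⟨fun s => ((residueCard K : ℂ)⁻¹) ^ (n * M + coordSum b) *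
    (((residueCard K : ℂ) ^ (-s)) ^ natPairing b v * Z s), ?_, fun s hs => ?_⟩
  · have := ((RationalWithDenom.pow (natPairing b v)).mul hZ).const_mul
      (((residueCard K : ℂ)⁻¹) ^ (n * M + coordSum b))
    rw [one_mul] at this
    exact this
  · have := (hsum s hs).mul_left (((residueCard K : ℂ)⁻¹) ^ (n * M + coordSum b) *
      ((residueCard K : ℂ) ^ (-s)) ^ natPairing b v)
    rw [mul_assoc] at this
    simp only [setIntegral_shell_coneExp hK μ hϖ hF hb ha hf]
    exact this

end Cone

end Shells

/-! ### Rationality of the zeta function -/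

section Rationality

open Filter Polynomial MeasureTheory

attribute [instance] ConeDecomposition.fintypeι ConeDecomposition.fintypeκ

theorem coordSum_pos_of_gcd_eq_one {n : ℕ} {ξ : Fin n → ℕ} (h : Finset.univ.gcd ξ = 1) :
    0 < coordSum ξ := by
  rw [coordSum, Nat.pos_iff_ne_zero]
  intro h0
  rw [Finset.sum_eq_zero_iff] at h0
  rw [Finset.gcd_eq_zero_iff.2 h0] at h
  exact zero_ne_one h

variable {K : Type*} [NontriviallyNormedField K] [IsUltrametricDist K] [ProperSpace K]
  [MeasurableSpace K] [BorelSpace K] {n l : ℕ}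

/-- The product of the factors `1 - q^{-σ(a)} X^{d(a)}` over the normal vectors `a` occurring in a
cone decomposition. -/
noncomputable def ConeDecomposition.denom {G : Set (Fin n →₀ ℕ)} (C : ConeDecomposition G) (q : ℕ) :
    ℂ[X] :=
  ∏ c, ∏ i, poleFactor q (coordSum (C.a c i)) (natPairing (C.a c i) (C.v c))

/-- The sum over all shells is regrouped along the cone decomposition. Each of the finitely many
cones has a rational sum whose denominator divides the common one. -/
theorem rationalWithDenom_integral_zetaIntegrand (hK : IsNormalizedNorm K)
    {μ : Measure (Fin n → K)} [μ.IsAddHaarMeasure] (hμ : μ {x | ∀ j, ‖x j‖ ≤ 1} = 1)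
    {ϖ : K} (hϖ : ‖ϖ‖ = (residueCard K : ℝ)⁻¹) {F : Fin l → MvPowerSeries (Fin n) K} {M : ℕ}
    (hF : Tendsto (scaledCoeff ϖ M F) cofinite (𝓝 0))
    {f : (Fin n → K) → (Fin l → K)}
    (hf : ∀ x ∈ smallBox ϖ n M, ∀ i, HasSum (fun m : Fin n →₀ ℕ =>
      MvPowerSeries.coeff m (F i) * m.prod fun j e => x j ^ e) (f x i))
    {Φ : (Fin n → K) → ℂ} (hΦ : IsLocallyConstant Φ)
    (hsupp : Function.support Φ ⊆ smallBox ϖ n M)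
    (hintegrable : ∀ s : ℂ, 0 < s.re → Integrable (zetaIntegrand Φ f s) μ)
    (C : ConeDecomposition (exponents F)) {D : ℂ[X]}
    (h : ∀ c, ∀ t₁ : C.κ c → ℕ∞, ∀ u ∈ unitTorus K n,
      Φ (conePoint ϖ M (C.a c) (C.b c) t₁ u) = 0 ∨
      LocallyRational μ D (fun u t =>
        powSum (coneCoeff ϖ (C.a c) (C.b c) (C.v c) (scaledCoeff ϖ M F) t) u) u t₁) :
    RationalWithDenom (residueCard K) (D * C.denom (residueCard K))
      (fun s => ∫ x, zetaIntegrand Φ f s x ∂μ) := by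
  choose Z hZ hsum using fun c => exists_rational_hasSum_shell hK μ hϖ hF (C.b_min c) (C.a_min c) hf
    (fun i => coordSum_pos_of_gcd_eq_one (C.mem_facetNormals c i).1) hΦ (h c)
  refine (RationalWithDenom.sum Finset.univ (I := Z) fun c _ => (hZ c).of_dvd ?_).congr
    fun s hs => ?_
  · exact mul_dvd_mul_left _ (Finset.dvd_prod_of_mem _ (Finset.mem_univ c))
  · have h1 := hasSum_setIntegral_shell hK hμ hϖ (hintegrable s hs)
      ((Function.support_mul_subset_left _ _).trans hsupp)
    have h2 := (Equiv.ofBijective _ C.bijective).hasSum_iff.2 h1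
    have h3 := h2.sigma (g := fun c => Z c s) fun c => by
      convert! hsum c s hs using 4
    rw [Finset.sum_apply]
    exact h3.unique (hasSum_fintype _)

end Rationality

/-! ### Poles -/

section Poles

open Filter Polynomial MeasureTheory

theorem cpow_neg_eq_exp {q : ℕ} (hq : 1 < q) (s : ℂ) :
    (q : ℂ) ^ (-s) = Complex.exp (-(s * (Real.log q : ℂ))) := by
  have hq0 : (q : ℂ) ≠ 0 := by
    exact_mod_cast (by omega : q ≠ 0)
  rw [Complex.cpow_def_of_ne_zero hq0, Complex.natCast_log]
  congr 1
  ring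

theorem exists_int_of_eval_poleFactor_eq_zero {q : ℕ} (hq : 1 < q) {σ d : ℕ} {s : ℂ}
    (h : (poleFactor q σ d).eval ((q : ℂ) ^ (-s)) = 0) :
    ∃ k : ℤ, ((σ : ℂ) + s * d) * (Real.log q : ℂ) = k * (2 * Real.pi * Complex.I) := by
  have hq0 : (0 : ℝ) < q := by exact_mod_cast (by omega : 0 < q)
  have hinv : ((q : ℂ)⁻¹) = Complex.exp (-(Real.log q : ℂ)) := by
    rw [Complex.exp_neg, ← Complex.ofReal_exp, Real.exp_log hq0]
    simp
  rw [poleFactor] at h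
  simp only [eval_sub, eval_one, eval_mul, eval_C, eval_pow, eval_X] at h
  rw [cpow_neg_eq_exp hq, hinv, ← Complex.exp_nat_mul, ← Complex.exp_nat_mul, ← Complex.exp_add,
    sub_eq_zero, eq_comm, Complex.exp_eq_one_iff] at h
  obtain ⟨k, hk⟩ := h
  refine ⟨-k, ?_⟩
  rw [Int.cast_neg]
  linear_combination -hk

/-- A zero would require σ + d Re s = 0. For d = 0 the factor is a nonzero constant, which is why
normals with d(ξ) = 0 give no poles. -/
theorem eval_poleFactor_ne_zero {q : ℕ} (hq : 1 < q) {σ d : ℕ} (hσd : 0 < σ ∨ 0 < d) {s : ℂ}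
    (hs : 0 < s.re ∨ d = 0) : (poleFactor q σ d).eval ((q : ℂ) ^ (-s)) ≠ 0 := by
  intro h
  obtain ⟨k, hk⟩ := exists_int_of_eval_poleFactor_eq_zero hq h
  have hlog : 0 < Real.log q := Real.log_pos (by exact_mod_cast hq)
  have hre := congrArg Complex.re hk
  simp [-Complex.natCast_log] at hre
  rcases hre with hre | hre
  · rcases hs with hs | hd
    · rcases hσd with h | h
      · have : (0 : ℝ) < σ := by exact_mod_cast h
        nlinarith [mul_nonneg hs.le (Nat.cast_nonneg (α := ℝ) d)]
      · have : (0 : ℝ) < d := by exact_mod_cast h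
        nlinarith [mul_pos hs this, Nat.cast_nonneg (α := ℝ) σ]
    · subst hd
      have : (σ : ℝ) = 0 := by simpa using hre
      have : σ = 0 := by exact_mod_cast this
      omega
  · rcases hre with h | h | h
    · omega
    · rw [h] at hq; simp at hq
    · norm_cast at h

theorem mem_codimPoles_of_eval_eq_zero {q : ℕ} (hq : 1 < q) {r : ℕ} {s : ℂ}
    (h : (poleFactor q r 1).eval ((q : ℂ) ^ (-s)) = 0) : s ∈ codimPoles q r := by
  obtain ⟨k, hk⟩ := exists_int_of_eval_poleFactor_eq_zero hq h
  have hlog : (Real.log q : ℂ) ≠ 0 := by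
    exact_mod_cast (Real.log_pos (by exact_mod_cast hq)).ne'
  refine ⟨k, ?_⟩
  rw [eq_neg_add_iff_add_eq, eq_div_iff hlog]
  rw [Nat.cast_one, mul_one] at hk
  linear_combination hk

theorem ConeDecomposition.mem_facetPoles_of_eval_eq_zero {n : ℕ} {G : Set (Fin n →₀ ℕ)}
    (C : ConeDecomposition G) {q : ℕ} (hq : 1 < q) {s : ℂ}
    (h : (C.denom q).eval ((q : ℂ) ^ (-s)) = 0) : s ∈ facetPoles q (newtonPolyhedron G) := by
  simp only [ConeDecomposition.denom, eval_prod, Finset.prod_eq_zero_iff, Finset.mem_univ,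
    true_and] at h
  obtain ⟨c, i, h⟩ := h
  have hσ := coordSum_pos_of_gcd_eq_one (C.mem_facetNormals c i).1
  have hmin := minPairing_eq (C.v_mem c) (C.a_min c i)
  have hd : natPairing (C.a c i) (C.v c) ≠ 0 := fun hd =>
    eval_poleFactor_ne_zero hq (Or.inl hσ) (Or.inr hd) h
  obtain ⟨k, hk⟩ := exists_int_of_eval_poleFactor_eq_zero hq h
  have hlog : (Real.log q : ℂ) ≠ 0 := by
    exact_mod_cast (Real.log_pos (by exact_mod_cast hq)).ne'
  have hdc : (natPairing (C.a c i) (C.v c) : ℂ) ≠ 0 := by exact_mod_cast hd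
  refine ⟨C.a c i, C.mem_facetNormals c i, ?_, k, ?_⟩
  · rw [hmin]
    exact_mod_cast hd
  · rw [hmin, Complex.ofReal_natCast, ← neg_div, div_add_div _ _ hdc (mul_ne_zero hdc hlog),
      eq_div_iff (mul_ne_zero hdc (mul_ne_zero hdc hlog))]
    linear_combination (natPairing (C.a c i) (C.v c) : ℂ) * hk

theorem ConeDecomposition.eval_denom_ne_zero {n : ℕ} {G : Set (Fin n →₀ ℕ)}
    (C : ConeDecomposition G) {q : ℕ} (hq : 1 < q) {s : ℂ} (hs : 0 < s.re) :
    (C.denom q).eval ((q : ℂ) ^ (-s)) ≠ 0 := by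
  simp only [ConeDecomposition.denom, eval_prod]
  exact Finset.prod_ne_zero_iff.2 fun c _ => Finset.prod_ne_zero_iff.2 fun i _ =>
    eval_poleFactor_ne_zero hq (Or.inl (coordSum_pos_of_gcd_eq_one (C.mem_facetNormals c i).1))
      (Or.inl hs)

variable {K : Type*} [NontriviallyNormedField K] [IsUltrametricDist K] [MeasurableSpace K] {n l : ℕ}
  {μ : Measure (Fin n → K)} {Φ : (Fin n → K) → ℂ} {f : (Fin n → K) → (Fin l → K)}

theorem ZetaPolesIn.mono {S S' : Set ℂ} (h : ZetaPolesIn μ Φ f S) (hS : S ⊆ S') :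
    ZetaPolesIn μ Φ f S' := by
  obtain ⟨h1, Z, h2, h3, h4, h5⟩ := h
  exact ⟨h1, Z, h2, h3, h4, fun s hs => hS (h5 s hs)⟩

/-- The reduced denominator divides `X ^ e * D`, and X does not vanish at q^(-s). So poles can occur
only where D vanishes, and the continuation agrees with the integral on the right half plane. -/
theorem zetaPolesIn_of_rationalWithDenom (hK : IsNormalizedNorm K) {S : Set ℂ} {D : ℂ[X]}
    (hintegrable : ∀ s : ℂ, 0 < s.re → Integrable (zetaIntegrand Φ f s) μ)
    (hrat : RationalWithDenom (residueCard K) D fun s => ∫ x, zetaIntegrand Φ f s x ∂μ)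
    (hD : ∀ s : ℂ, 0 < s.re → D.eval ((residueCard K : ℂ) ^ (-s)) ≠ 0)
    (hS : ∀ s : ℂ, D.eval ((residueCard K : ℂ) ^ (-s)) = 0 → s ∈ S) : ZetaPolesIn μ Φ f S := by
  have hq := one_lt_residueCard hK
  set q := residueCard K with hqdef
  have hx0 (s : ℂ) : (q : ℂ) ^ (-s) ≠ 0 := by
    rw [cpow_neg_eq_exp hq]
    exact Complex.exp_ne_zero _
  obtain ⟨P, e, hP⟩ := hrat
  have hQ : X ^ e * D ≠ 0 := by
    refine mul_ne_zero (pow_ne_zero _ X_ne_zero) fun h0 => hD 1 (by simp) ?_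
    rw [h0, eval_zero]
  set R : RatFunc ℂ := algebraMap ℂ[X] (RatFunc ℂ) P / algebraMap ℂ[X] (RatFunc ℂ) (X ^ e * D)
    with hR
  have hden : R.denom ∣ X ^ e * D := RatFunc.denom_div_dvd _ _
  have hnum : R.num * (X ^ e * D) = P * R.denom := (RatFunc.num_mul_eq_mul_denom_iff hQ).2 rfl
  have hanal (p : ℂ[X]) (s : ℂ) : AnalyticAt ℂ (fun s : ℂ => p.eval ((q : ℂ) ^ (-s))) s := by
    have h1 : Differentiable ℂ fun s : ℂ => p.eval ((q : ℂ) ^ (-s)) := by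
      have : (fun s : ℂ => p.eval ((q : ℂ) ^ (-s))) =
          fun s => p.eval (Complex.exp (-(s * (Real.log q : ℂ)))) :=
        funext fun s => by rw [cpow_neg_eq_exp hq]
      rw [this]
      exact p.differentiable.comp (by fun_prop)
    exact h1.analyticAt s
  have hZ (s : ℂ) : R.eval (RingHom.id ℂ) ((q : ℂ) ^ (-s)) =
      R.num.eval ((q : ℂ) ^ (-s)) / R.denom.eval ((q : ℂ) ^ (-s)) := by
    rw [RatFunc.eval, eval₂_id, eval₂_id]
  have hdz (s : ℂ) (h : R.denom.eval ((q : ℂ) ^ (-s)) = 0) :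
      D.eval ((q : ℂ) ^ (-s)) = 0 := by
    have := eval_eq_zero_of_dvd_of_eval_eq_zero hden h
    rw [eval_mul, eval_pow, eval_X] at this
    exact (mul_eq_zero.1 this).resolve_left (pow_ne_zero _ (hx0 s))
  refine ⟨hintegrable, fun s => R.eval (RingHom.id ℂ) ((q : ℂ) ^ (-s)), fun s => ?_, ⟨R, fun s => rfl⟩,
    fun s hs => ?_, fun s hs => ?_⟩
  · simp only [hZ]
    exact (hanal _ s).meromorphicAt.div (hanal _ s).meromorphicAt
  · have hd : R.denom.eval ((q : ℂ) ^ (-s)) ≠ 0 := fun h => hD s hs (hdz s h)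
    have h1 := congrArg (eval ((q : ℂ) ^ (-s))) hnum
    rw [eval_mul, eval_mul, eval_mul, eval_pow, eval_X, ← hP s hs] at h1
    simp only [hZ]
    rw [div_eq_iff hd]
    refine mul_right_cancel₀ (mul_ne_zero (pow_ne_zero e (hx0 s)) (hD s hs)) (h1.trans ?_)
    ring
  · refine hS s (by_contra fun h => ?_)
    have hd : R.denom.eval ((q : ℂ) ^ (-s)) ≠ 0 := fun h' => h (hdz s h')
    simp only [hZ] at hs
    exact not_lt.2 ((hanal R.num s).div (hanal R.denom s) hd).meromorphicOrderAt_nonneg hs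

end Poles

/-! ### Local rationality for polynomial mappings and for analytic mappings -/

section LocalRationality

open Filter Polynomial MeasureTheory

variable {K : Type*} [NontriviallyNormedField K] [IsUltrametricDist K] [ProperSpace K] [CharZero K]
  [MeasurableSpace K] [BorelSpace K] {n l : ℕ} (hK : IsNormalizedNorm K)
  (μ : Measure (Fin n → K)) [μ.IsAddHaarMeasure]
  {κ : Type*} [Fintype κ] {a : κ → Fin n → ℕ} {b : Fin n → ℕ} {v : Fin n →₀ ℕ}
  {ϖ : K} (hϖ : ‖ϖ‖ < 1) (hϖ0 : ϖ ≠ 0) {F : Fin l → MvPowerSeries (Fin n) K}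
  {M : ℕ} (hF : Tendsto (scaledCoeff ϖ M F) cofinite (𝓝 0)) (hv : v ∈ exponents F)
  (hb : ∀ m ∈ exponents F, natPairing b v ≤ natPairing b m)
  (ha : ∀ i, ∀ m ∈ exponents F, natPairing (a i) v ≤ natPairing (a i) m)

/-- The same linear map and the same neighbourhood serve all nearby base points. This openness feeds
the compactness argument for analytic mappings. -/
theorem UniformlySubmersiveAt.eventually {T : Type*} [TopologicalSpace T]
    {g : (Fin n → K) → T → (Fin l → K)} {u₁ : Fin n → K} {t₁ : T}
    (h : UniformlySubmersiveAt g u₁ t₁) :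
    ∀ᶠ p : T × (Fin n → K) in 𝓝 (t₁, u₁), UniformlySubmersiveAt g p.2 p.1 := by
  obtain ⟨A, σ, c, hσ, hc, O, hO, h⟩ := h
  rw [nhds_prod_eq]
  filter_upwards [h.eventually_nhds.prod_mk (eventually_mem_nhds_iff.2 hO)] with p hp
  exact ⟨A, σ, c, hσ, hc, O, hp.2, hp.1⟩

theorem one_sub_C_mul_X_eq_poleFactor (q r : ℕ) :
    (1 - C (((q : ℂ)⁻¹) ^ r) * X : ℂ[X]) = poleFactor q r 1 := by
  rw [poleFactor, pow_one]

section Polynomials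

variable {t₁ : κ → ℕ∞}
  (hfin : ∀ i, {m | expPoint m ∈ weightFace (exponents F) (topWeight a t₁) ∧
      MvPowerSeries.coeff m (F i) ≠ 0}.Finite)
  (hnd : NonDegenerateOn F (weightFace (exponents F) (topWeight a t₁))) {u₁ : Fin n → K}
  (hu₁ : u₁ ∈ unitTorus K n)

include hK hϖ hϖ0 hF hv hb ha hfin hnd hu₁

theorem locallyRational_coneFamily (hσ : ∀ i, 0 < coordSum (a i)) :
    LocallyRational μ (poleFactor (residueCard K) (min l n) 1)
      (fun u t => powSum (coneCoeff ϖ a b v (scaledCoeff ϖ M F) t) u) u₁ t₁ := by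
  by_cases h0 : powSum (coneCoeff ϖ a b v (scaledCoeff ϖ M F) t₁) u₁ = 0
  swap
  · exact (locallyRational_coneFamily_of_ne_zero hK μ hϖ hF hu₁ h0).of_dvd (one_dvd _)
  rw [← one_sub_C_mul_X_eq_poleFactor]
  rcases le_total l n with hln | hnl
  · rw [min_eq_left hln]
    exact locallyRational_coneFamily_of_submersive hK μ hϖ hF hu₁ h0
      (uniformlySubmersiveAt_coneFamily hϖ hϖ0 hF hv hb ha hfin hnd hu₁ hln h0)
  · rw [min_eq_right hnl]
    -- A zero with n ≤ l forces all tᵢ to be finite, so t₁ is isolated and an injective derivative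
    -- suffices.
    have hω : topWeight a t₁ = 0 := by_contra fun hω =>
      powSum_ne_zero_of_topWeight_ne_zero hϖ hϖ0 hF hv hb ha hfin hnd hu₁ hnl hω h0
    have htop (i) : t₁ i ≠ ⊤ := fun hi => by
      obtain ⟨j, -, hj⟩ := Finset.exists_ne_zero_of_sum_ne_zero (hσ i).ne'
      have := topWeight_pos hi (Nat.pos_of_ne_zero hj)
      rw [hω] at this
      exact lt_irrefl _ this
    have ht : 𝓝 t₁ = pure t₁ := by
      rw [nhds_pi, ← Filter.pi_pure]
      congr 1
      exact funext fun i => ENat.nhds_eq_pure (htop i)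
    obtain ⟨A, hA, -, hinj⟩ :=
      hasStrictFDerivAt_powSum_of_eq_zero hϖ hϖ0 hF hv hb ha hfin hnd hu₁ h0
    obtain ⟨σ, hσ⟩ := A.toLinearMap.exists_leftInverse_of_injective
      (LinearMap.ker_eq_bot.2 (hinj hnl))
    exact locallyRational_of_immersive hK μ ht h0 A (LinearMap.toContinuousLinearMap σ)
      (fun w => LinearMap.congr_fun hσ w) hA.hasFDerivAt

end Polynomials

theorem norm_conePoint_of_mem_unitTorus {t : κ → ℕ∞} {u : Fin n → K} (hu : u ∈ unitTorus K n)
    (j : Fin n) : ‖conePoint ϖ M a b t u j‖ = ‖conePoint ϖ M a b t 1 j‖ := by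
  simp [conePoint, hu j]

include hϖ0 in
theorem exists_eq_top_of_conePoint_eq_zero {t : κ → ℕ∞} {j : Fin n}
    (h : conePoint ϖ M a b t 1 j = 0) : ∃ i, t i = ⊤ ∧ 0 < a i j := by
  rw [conePoint, Pi.one_apply, mul_one, mul_eq_zero, Finset.prod_eq_zero_iff] at h
  obtain ⟨i, -, hi⟩ := h.resolve_left (pow_ne_zero _ hϖ0)
  refine ⟨i, by_contra fun ht => ?_, Nat.pos_of_ne_zero fun h0 => ?_⟩
  · rw [unifPow, if_neg ht] at hi
    exact pow_ne_zero _ (pow_ne_zero _ hϖ0) hi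
  · rw [h0, pow_zero] at hi
    exact one_ne_zero hi

include hK hϖ hϖ0 hF hv hb ha in
/-- If the rank condition holds on the compact faces, then the family attached to a cone is locally
rational at the parameters which correspond to points near the origin. -/
theorem exists_pos_locallyRational_coneFamily (hn : 0 < n)
    (hnd : ∀ τ, IsFace (mapPolyhedron F) τ → IsCompact τ → NonDegenerateOn F τ) {D : ℂ[X]}
    (hD : l < n → poleFactor (residueCard K) l 1 ∣ D) :
    ∃ δ > 0, ∀ t₁ : κ → ℕ∞, ∀ u₁ ∈ unitTorus K n, ‖conePoint ϖ M a b t₁ u₁‖ < δ →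
      LocallyRational μ D
        (fun u t => powSum (coneCoeff ϖ a b v (scaledCoeff ϖ M F) t) u) u₁ t₁ := by
  -- An open condition that implies local rationality. For n ≤ l it reduces to the absence of a
  -- zero, which is why no codimension poles appear then.
  let Good : (κ → ℕ∞) → (Fin n → K) → Prop := fun t u =>
    powSum (coneCoeff ϖ a b v (scaledCoeff ϖ M F) t) u ≠ 0 ∨ (l < n ∧
      UniformlySubmersiveAt (fun u t => powSum (coneCoeff ϖ a b v (scaledCoeff ϖ M F) t) u) u t)
  have hgood (t₁ : κ → ℕ∞) (u₁ : Fin n → K) (hu₁ : u₁ ∈ unitTorus K n) (h : Good t₁ u₁) :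
      LocallyRational μ D
        (fun u t => powSum (coneCoeff ϖ a b v (scaledCoeff ϖ M F) t) u) u₁ t₁ := by
    by_cases h0 : powSum (coneCoeff ϖ a b v (scaledCoeff ϖ M F) t₁) u₁ = 0
    · obtain ⟨hln, hs⟩ := h.resolve_left (not_not.2 h0)
      have h1 := locallyRational_coneFamily_of_submersive hK μ hϖ hF hu₁ h0 hs
      rw [one_sub_C_mul_X_eq_poleFactor] at h1
      exact h1.of_dvd (hD hln)
    · exact (locallyRational_coneFamily_of_ne_zero hK μ hϖ hF hu₁ h0).of_dvd (one_dvd _)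
  have hev (t₁ : κ → ℕ∞) (ht₁ : conePoint ϖ M a b t₁ (1 : Fin n → K) = 0) :
      ∀ᶠ t in 𝓝 t₁, ∀ u ∈ unitTorus K n, Good t u := by
    -- If the limiting point is the origin, every coordinate is killed by some aᵢ with tᵢ = ∞. All
    -- entries of `topWeight` are then positive, and its face is compact.
    have hpos (j) : 0 < topWeight a t₁ j := by
      obtain ⟨i, hi, hij⟩ := exists_eq_top_of_conePoint_eq_zero hϖ0 (congrFun ht₁ j)
      exact topWeight_pos hi hij
    have hmin (m) (hm : m ∈ exponents F) :
        natPairing (topWeight a t₁) v ≤ natPairing (topWeight a t₁) m :=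
      natPairing_topWeight_le fun i => ha i m hm
    have hfin (i : Fin l) : {m | expPoint m ∈ weightFace (exponents F) (topWeight a t₁) ∧
        MvPowerSeries.coeff m (F i) ≠ 0}.Finite := by
      refine (finite_natPairing_eq hpos (natPairing (topWeight a t₁) v)).subset fun m hm => ?_
      have h2 := ((mem_weightFace_iff hv hmin).1 hm.1).2
      rw [pairing_expPoint] at h2
      exact_mod_cast h2
    have hnd' := hnd _ (isFace_weightFace hv hmin) (isCompact_weightFace hpos hv hmin)
    refine isCompact_unitTorus.eventually_forall_of_forall_eventually fun u hu => ?_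
    by_cases h0 : powSum (coneCoeff ϖ a b v (scaledCoeff ϖ M F) t₁) u = 0
    · have hln : l < n := by
        by_contra! hnl
        refine powSum_ne_zero_of_topWeight_ne_zero hϖ hϖ0 hF hv hb ha hfin hnd' hu hnl
          (fun hω => ?_) h0
        have := hpos ⟨0, hn⟩
        rw [hω] at this
        exact lt_irrefl _ this
      filter_upwards [(uniformlySubmersiveAt_coneFamily hϖ hϖ0 hF hv hb ha hfin hnd' hu hln.le
        h0).eventually] with p hp
      exact Or.inr ⟨hln, hp⟩
    · have h1 : Tendsto (fun p : (Fin n → K) × (κ → ℕ∞) =>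
          powSum (coneCoeff ϖ a b v (scaledCoeff ϖ M F) p.2) p.1) (𝓝 (u, t₁))
          (𝓝 (powSum (coneCoeff ϖ a b v (scaledCoeff ϖ M F) t₁) u)) :=
        tendsto_powSum (tendsto_coneCoeff hϖ hF) (eventually_norm_coneCoeff_sub_le hϖ hF t₁)
          (unitTorus_subset_polydisc hu)
      have h2 : ∀ᶠ p : (Fin n → K) × (κ → ℕ∞) in 𝓝 (u, t₁),
          powSum (coneCoeff ϖ a b v (scaledCoeff ϖ M F) p.2) p.1 ≠ 0 := h1.eventually_ne h0
      have h3 : ContinuousAt (Prod.swap : (κ → ℕ∞) × (Fin n → K) → _) (t₁, u) :=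
        continuous_swap.continuousAt
      filter_upwards [h3.eventually h2] with p hp
      exact Or.inl hp
  -- On this compact set of possibly bad parameters the limiting point is never the origin, so its
  -- norm has a positive lower bound. The norm does not depend on u in the torus, hence the
  -- evaluation at 1.
  let B : Set (κ → ℕ∞) := (interior {t | ∀ u ∈ unitTorus K n, Good t u})ᶜ
  have hB : IsCompact B := isOpen_interior.isClosed_compl.isCompact
  have hcont : Continuous fun t : κ → ℕ∞ => ‖conePoint ϖ M a b t (1 : Fin n → K)‖ :=
    ((continuous_conePoint hϖ M).comp (Continuous.prodMk_right (1 : Fin n → K))).norm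
  obtain ⟨δ, hδ, hδB⟩ : ∃ δ > 0, ∀ t ∈ B, δ ≤ ‖conePoint ϖ M a b t (1 : Fin n → K)‖ := by
    rcases B.eq_empty_or_nonempty with hBe | hBne
    · exact ⟨1, one_pos, fun t ht => absurd ht (by rw [hBe]; exact Set.notMem_empty t)⟩
    · obtain ⟨t₀, ht₀, hmin⟩ := hB.exists_isMinOn hBne hcont.continuousOn
      refine ⟨_, norm_pos_iff.2 fun h0 => ht₀ ?_, fun t ht => hmin ht⟩
      exact mem_interior_iff_mem_nhds.2 (hev t₀ h0)
  refine ⟨δ, hδ, fun t₁ u₁ hu₁ ht => hgood t₁ u₁ hu₁ ?_⟩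
  have hnorm : ‖conePoint ϖ M a b t₁ u₁‖ = ‖conePoint ϖ M a b t₁ (1 : Fin n → K)‖ := by
    simp only [Pi.norm_def]
    congr 1
    refine Finset.sup_congr rfl fun j _ => ?_
    exact NNReal.eq (norm_conePoint_of_mem_unitTorus hu₁ j)
  have hmem : t₁ ∉ B := fun h => not_le.2 ht (hnorm ▸ hδB t₁ h)
  exact interior_subset (not_not.1 hmem) u₁ hu₁

end LocalRationality

/-! ### The main theorem -/

section Main

open Filter Polynomial MeasureTheory

variable {K : Type*} [NontriviallyNormedField K] [IsUltrametricDist K] {n l : ℕ}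

theorem isOpen_smallBox {ϖ : K} (hϖ0 : ϖ ≠ 0) (n M : ℕ) : IsOpen (smallBox ϖ n M) := by
  rw [smallBox_eq_closedBall]
  exact IsUltrametricDist.isOpen_closedBall _ (pow_ne_zero _ (norm_ne_zero_iff.2 hϖ0))

theorem exists_smallBox_subset {ϖ : K} (hϖ : ‖ϖ‖ < 1) {s : Set (Fin n → K)}
    (hs : s ∈ 𝓝 (0 : Fin n → K)) : ∃ M, smallBox ϖ n M ⊆ s := by
  obtain ⟨ε, hε, hεs⟩ := Metric.nhds_basis_closedBall.mem_iff.1 hs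
  obtain ⟨M, hM⟩ := exists_pow_lt_of_lt_one hε hϖ
  refine ⟨M, fun x hx => hεs ?_⟩
  rw [mem_closedBall_zero_iff, pi_norm_le_iff_of_nonneg hε.le]
  exact fun j => (hx j).trans hM.le

theorem exponents_nonempty {F : Fin l → MvPowerSeries (Fin n) K} (h : ∃ i, F i ≠ 0) :
    (exponents F).Nonempty := by
  obtain ⟨i, hi⟩ := h
  obtain ⟨m, hm⟩ := (MvPowerSeries.ne_zero_iff_exists_coeff_ne_zero _).1 hi
  exact ⟨m, i, hm⟩

theorem pos_of_constantCoeff_eq_zero {F : Fin l → MvPowerSeries (Fin n) K}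
    (h0 : ∀ i, MvPowerSeries.constantCoeff (F i) = 0) (h : ∃ i, F i ≠ 0) : 0 < n := by
  obtain ⟨m, i, hm⟩ := exponents_nonempty h
  refine Nat.pos_of_ne_zero ?_
  rintro rfl
  refine hm ?_
  rw [Subsingleton.elim m 0, MvPowerSeries.coeff_zero_eq_constantCoeff_apply, h0]

/-- These are the terms of the series at the point with all coordinates ϖ^M, which lies in the box
of convergence. -/
theorem tendsto_scaledCoeff {ϖ : K} {M : ℕ} {F : Fin l → MvPowerSeries (Fin n) K}
    {f : (Fin n → K) → (Fin l → K)}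
    (hf : ∀ x ∈ smallBox ϖ n M, ∀ i, HasSum (fun m : Fin n →₀ ℕ =>
      MvPowerSeries.coeff m (F i) * m.prod fun j e => x j ^ e) (f x i)) :
    Tendsto (scaledCoeff ϖ M F) cofinite (𝓝 0) := by
  refine tendsto_pi_nhds.2 fun i => ?_
  have h := (hf (fun _ => ϖ ^ M) (fun j => (norm_pow ϖ M).le) i).summable.tendsto_cofinite_zero
  refine h.congr fun m => ?_
  rw [scaledCoeff, natPairing, Finsupp.prod_fintype _ _ (by simp), mul_comm,
    ← Finset.prod_pow_eq_pow_sum]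
  simp only [pow_mul]

variable [ProperSpace K] [CharZero K] [MeasurableSpace K] [BorelSpace K]
  (hK : IsNormalizedNorm K) {μ : Measure (Fin n → K)} [μ.IsAddHaarMeasure]
  (hμ : μ {x | ∀ j, ‖x j‖ ≤ 1} = 1)

include hK hμ

theorem zetaPolesIn_of_analytic {U : Set (Fin n → K)} {f : (Fin n → K) → (Fin l → K)}
    {F : Fin l → MvPowerSeries (Fin n) K} (hU : IsOpen U) (h0U : 0 ∈ U) (hfU : AnalyticOnNhd K f U)
    (hfF : IsTaylorSeriesAtOrigin f F) (hnd : StronglyNonDegenerateAtOrigin F) :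
    ∃ V ⊆ U, IsOpen V ∧ 0 ∈ V ∧
      ∀ Φ : (Fin n → K) → ℂ, IsSchwartzBruhat Φ → Function.support Φ ⊆ V →
        ZetaPolesIn μ Φ f
          (facetPoles (residueCard K) (mapPolyhedron F) ∪ codimPoles (residueCard K) l) ∧
        (n ≤ l → ZetaPolesIn μ Φ f (facetPoles (residueCard K) (mapPolyhedron F))) := by
  have hq := one_lt_residueCard hK
  have hqr : (1 : ℝ) < residueCard K := by exact_mod_cast hq
  obtain ⟨ϖ, hϖ⟩ := exists_uniformizer hK
  have h1 : ‖ϖ‖ < 1 := by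
    rw [hϖ]
    exact inv_lt_one_of_one_lt₀ hqr
  have h0 : ϖ ≠ 0 := norm_pos_iff.1 (by rw [hϖ]; positivity)
  obtain ⟨M, hM⟩ := exists_smallBox_subset h1 (inter_mem (hU.mem_nhds h0U) hfF)
  have hf : ∀ x ∈ smallBox ϖ n M, ∀ i, HasSum (fun m : Fin n →₀ ℕ =>
      MvPowerSeries.coeff m (F i) * m.prod fun j e => x j ^ e) (f x i) := fun x hx => (hM hx).2
  have hMU : smallBox ϖ n M ⊆ U := fun x hx => (hM hx).1
  have hF := tendsto_scaledCoeff hf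
  obtain ⟨C⟩ := nonempty_coneDecomposition (exponents_nonempty hnd.nonconstant)
  -- For l ≥ n the denominator is trivial, which yields the sharper statement without the poles on
  -- Re s = -l.
  let D : ℂ[X] := if l < n then poleFactor (residueCard K) l 1 else 1
  have hD : l < n → poleFactor (residueCard K) l 1 ∣ D := fun h => by
    simp only [D, if_pos h, dvd_refl]
  choose δ hδ hloc using fun c => exists_pos_locallyRational_coneFamily hK μ h1 h0 hF (C.v_mem c)
    (C.b_min c) (C.a_min c) (pos_of_constantCoeff_eq_zero hnd.map_zero hnd.nonconstant)
    hnd.nonDegenerateOn hD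
  refine ⟨smallBox ϖ n M ∩ ⋂ c, Metric.ball 0 (δ c), fun x hx => hMU hx.1,
    (isOpen_smallBox h0 n M).inter (isOpen_iInter_of_finite fun c => Metric.isOpen_ball),
    ⟨fun j => ?_, Set.mem_iInter.2 fun c => Metric.mem_ball_self (hδ c)⟩, fun Φ hΦ hΦV => ?_⟩
  · rw [Pi.zero_apply, norm_zero]
    positivity
  have hsupp : Function.support Φ ⊆ smallBox ϖ n M := fun x hx => (hΦV hx).1
  have hintegrable (s : ℂ) (hs : 0 < s.re) : Integrable (zetaIntegrand Φ f s) μ :=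
    integrable_zetaIntegrand hΦ.1 (isCompact_smallBox ϖ n M) hsupp (hfU.continuousOn.mono hMU) hs
  have hrat : RationalWithDenom (residueCard K) (D * C.denom (residueCard K))
      (fun s => ∫ x, zetaIntegrand Φ f s x ∂μ) := by
    refine rationalWithDenom_integral_zetaIntegrand hK hμ hϖ hF hf hΦ.1 hsupp hintegrable C
      fun c t₁ u hu => ?_
    by_cases hz : Φ (conePoint ϖ M (C.a c) (C.b c) t₁ u) = 0
    · exact Or.inl hz
    · right
      refine hloc c t₁ u hu ?_
      have := Set.mem_iInter.1 (hΦV hz).2 c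
      rwa [mem_ball_zero_iff] at this
  rcases le_or_gt n l with hnl | hln
  · have hD1 : D = 1 := if_neg (not_lt.2 hnl)
    rw [hD1, one_mul] at hrat
    have := zetaPolesIn_of_rationalWithDenom hK hintegrable hrat
      (fun s hs => C.eval_denom_ne_zero hq hs) fun s => C.mem_facetPoles_of_eval_eq_zero hq
    exact ⟨this.mono Set.subset_union_left, fun _ => this⟩
  · have hD1 : D = poleFactor (residueCard K) l 1 := if_pos hln
    rw [hD1] at hrat
    refine ⟨zetaPolesIn_of_rationalWithDenom hK hintegrable hrat (fun s hs => ?_) fun s hs => ?_,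
      fun h => absurd hln (not_lt.2 h)⟩
    · rw [eval_mul]
      exact mul_ne_zero (eval_poleFactor_ne_zero hq (Or.inr one_pos) (Or.inl hs))
        (C.eval_denom_ne_zero hq hs)
    · rw [eval_mul, mul_eq_zero] at hs
      exact hs.elim (fun h => Or.inr (mem_codimPoles_of_eval_eq_zero hq h))
        fun h => Or.inl (C.mem_facetPoles_of_eval_eq_zero hq h)

/-- Here M = 0 and no parameter is hidden by the support of Φ. The faces of all the weights
`topWeight` occur, including the whole polyhedron for finite parameters, so the rank condition is
needed on noncompact faces too. -/
theorem zetaPolesIn_of_polynomial {f : Fin l → MvPolynomial (Fin n) K}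
    (hnd : StronglyNonDegenerate f) :
    ZetaPolesIn μ (Set.indicator {x | ∀ j, ‖x j‖ ≤ 1} 1) (fun x i => MvPolynomial.eval x (f i))
      (facetPoles (residueCard K) (mapPolyhedron fun i => (f i : MvPowerSeries (Fin n) K)) ∪
        codimPoles (residueCard K) (min l n)) := by
  have hq := one_lt_residueCard hK
  have hqr : (1 : ℝ) < residueCard K := by exact_mod_cast hq
  obtain ⟨ϖ, hϖ⟩ := exists_uniformizer hK
  have h1 : ‖ϖ‖ < 1 := by
    rw [hϖ]
    exact inv_lt_one_of_one_lt₀ hqr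
  have h0 : ϖ ≠ 0 := norm_pos_iff.1 (by rw [hϖ]; positivity)
  set F : Fin l → MvPowerSeries (Fin n) K := fun i => (f i : MvPowerSeries (Fin n) K) with hFdef
  have hbox : {x : Fin n → K | ∀ j, ‖x j‖ ≤ 1} = smallBox ϖ n 0 := by
    simp only [smallBox, pow_zero]
  have hne : ∃ i, F i ≠ 0 := by
    obtain ⟨i, hi⟩ := hnd.nonconstant
    exact ⟨i, fun h => hi (MvPolynomial.coe_eq_zero_iff.1 h)⟩
  have hf : ∀ x ∈ smallBox ϖ n 0, ∀ i, HasSum (fun m : Fin n →₀ ℕ =>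
      MvPowerSeries.coeff m (F i) * m.prod fun j e => x j ^ e) (MvPolynomial.eval x (f i)) := by
    intro x _ i
    rw [MvPolynomial.eval_eq]
    refine hasSum_sum_of_ne_finset_zero fun m hm => ?_
    rw [hFdef, MvPolynomial.coeff_coe, MvPolynomial.notMem_support_iff.1 hm, zero_mul]
  have hF := tendsto_scaledCoeff hf
  obtain ⟨C⟩ := nonempty_coneDecomposition (exponents_nonempty hne)
  have hΦ : IsLocallyConstant
      (Set.indicator {x : Fin n → K | ∀ j, ‖x j‖ ≤ 1} (1 : (Fin n → K) → ℂ)) := by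
    rw [hbox]
    have hclopen : IsClopen (smallBox ϖ n 0) :=
      ⟨(isCompact_smallBox ϖ n 0).isClosed, isOpen_smallBox h0 n 0⟩
    rw [← LocallyConstant.coe_charFn ℂ hclopen]
    exact (LocallyConstant.charFn ℂ hclopen).isLocallyConstant
  have hsupp : Function.support
      (Set.indicator {x : Fin n → K | ∀ j, ‖x j‖ ≤ 1} (1 : (Fin n → K) → ℂ)) ⊆ smallBox ϖ n 0 := by
    rw [hbox]
    exact Set.support_indicator_subset
  have hintegrable (s : ℂ) (hs : 0 < s.re) := integrable_zetaIntegrand (μ := μ) hΦ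
    (isCompact_smallBox ϖ n 0) hsupp (f := fun x i => MvPolynomial.eval x (f i))
    (continuous_pi fun i => MvPolynomial.continuous_eval (f i)).continuousOn hs
  have hrat := rationalWithDenom_integral_zetaIntegrand hK hμ hϖ hF hf hΦ hsupp hintegrable C
    (D := poleFactor (residueCard K) (min l n) 1) fun c t₁ u hu => by
      have hmin (m) (hm : m ∈ exponents F) :
          natPairing (topWeight (C.a c) t₁) (C.v c) ≤ natPairing (topWeight (C.a c) t₁) m :=
        natPairing_topWeight_le fun i => C.a_min c i m hm
      refine Or.inr (locallyRational_coneFamily hK μ h1 h0 hF (C.v_mem c) (C.b_min c) (C.a_min c)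
        (fun i => ((f i).support.finite_toSet).subset fun m hm => ?_)
        (hnd.nonDegenerateOn _ (isFace_weightFace (C.v_mem c) hmin)) hu
        fun i => coordSum_pos_of_gcd_eq_one (C.mem_facetNormals c i).1)
      have h := hm.2
      rw [hFdef, MvPolynomial.coeff_coe] at h
      exact MvPolynomial.mem_support_iff.2 h
  refine zetaPolesIn_of_rationalWithDenom hK hintegrable hrat (fun s hs => ?_) fun s hs => ?_
  · rw [eval_mul]
    exact mul_ne_zero (eval_poleFactor_ne_zero hq (Or.inr one_pos) (Or.inl hs))
      (C.eval_denom_ne_zero hq hs)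
  · rw [eval_mul, mul_eq_zero] at hs
    exact hs.elim (fun h => Or.inr (mem_codimPoles_of_eval_eq_zero hq h))
      fun h => Or.inl (C.mem_facetPoles_of_eval_eq_zero hq h)

end Main

theorem theorem6 (p : ℕ) [Fact p.Prime]
    (K : Type*) [NontriviallyNormedField K] [IsUltrametricDist K]
    [Algebra ℚ_[p] K] [FiniteDimensional ℚ_[p] K] [ContinuousSMul ℚ_[p] K]
    (hK : IsNormalizedNorm K)
    [MeasurableSpace K] [BorelSpace K] (n l : ℕ)
    (μ : MeasureTheory.Measure (Fin n → K)) [μ.IsAddHaarMeasure]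
    (hμ : μ {x | ∀ j, ‖x j‖ ≤ 1} = 1) :
    (∀ (U : Set (Fin n → K)) (f : (Fin n → K) → (Fin l → K))
        (F : Fin l → MvPowerSeries (Fin n) K),
      IsOpen U → 0 ∈ U → AnalyticOnNhd K f U → IsTaylorSeriesAtOrigin f F →
      StronglyNonDegenerateAtOrigin F →
      ∃ V ⊆ U, IsOpen V ∧ 0 ∈ V ∧
        ∀ Φ : (Fin n → K) → ℂ, IsSchwartzBruhat Φ → Function.support Φ ⊆ V →
          ZetaPolesIn μ Φ f
            (facetPoles (residueCard K) (mapPolyhedron F) ∪ codimPoles (residueCard K) l) ∧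
          (n ≤ l → ZetaPolesIn μ Φ f (facetPoles (residueCard K) (mapPolyhedron F)))) ∧
    (∀ f : Fin l → MvPolynomial (Fin n) K, StronglyNonDegenerate f →
      ZetaPolesIn μ (Set.indicator {x | ∀ j, ‖x j‖ ≤ 1} 1) (fun x i => MvPolynomial.eval x (f i))
        (facetPoles (residueCard K) (mapPolyhedron fun i => (f i : MvPowerSeries (Fin n) K)) ∪
          codimPoles (residueCard K) (min l n))) := by
  have := properSpace_of_finiteDimensional_padic p K
  have : CharZero K := charZero_of_injective_algebraMap (algebraMap ℚ_[p] K).injective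
  exact ⟨fun U f F hU h0U hf hfF hnd => zetaPolesIn_of_analytic hK hμ hU h0U hf hfF hnd,
    fun f hnd => zetaPolesIn_of_polynomial hK hμ hnd⟩
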